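/- **Theorem 3.5.** Let $F$ be a field of characteristic $0$, let $\ell_1,\dots,\ell_5\ge 0$ be integers, $\ell'_i=\ell_1+\cdots+\ell_i$, $\ell=\ell'_5$, and assume $\ell'_4>0$. Call the coordinates $p\le\ell'_4$ even and the coordinates $p>\ell'_4$ odd. Let $\Gamma$ be an additive subgroup of $\{0\}^{\ell_1}\times F^{\ell_2+\ell_3+\ell_4}\times\{0\}^{\ell_5}$ which contains a basis of this vector space. Put $J=\mathbb Z_+^{\ell_1+\ell_2}\times\mathbb Z^{\ell_3}\times\{0\}^{\ell_4}\times\{0,1\}^{\ell_5}$ and $K=\mathbb Z_+^{\ell'_4}\times\{0,1\}^{\ell_5}$. Let $\mathcal A$ be the superalgebra with basis $x^{\alpha,k}$ ($\alpha\in\Gamma$, $k\in J$) and product $$x^{\alpha,k}x^{\alpha',k'}=(-1)^{\sum_{\ell'_4<p<q\le\ell}k_qk'_p}\,x^{\alpha+\alpha',k+k'}\quad(\text{zero if }k+k'\notin J);$$ $x^{\alpha,k}$ has parity $g(k)=\sum_{p>\ell'_4}k_p \bmod 2$. Let $\partial_1,\dots,\partial_\ell$ be the superderivations $$\partial_p x^{\alpha,k}=\alpha_p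 x^{\alpha,k}+(-1)^{\sum_{\ell'_4<r<p}k_r}\,k_p\,x^{\alpha,k-1_{[p]}},$$ where $1_{[p]}$ is the $p$-th unit vector and the last term is zero if $k-1_{[p]}\notin J$. Let $W$ be the associative superalgebra with basis $x^{\alpha,k}\partial^\mu$ ($\alpha\in\Gamma$, $k\in J$, $\mu\in K$, $\partial^\mu=\partial_1^{\mu_1}\cdots\partial_\ell^{\mu_\ell}$), $\partial_p$ being even for $p\le\ell'_4$ and odd otherwise, with product $$u\partial^\mu\cdot v\partial^\nu=u\sum_{\lambda\le\mu}\binom{\mu}{\lambda}(-1)^{g(v)g(\mu-\lambda)+\sum_{\ell'_4<p<q\le\ell}\left((\mu_q-\lambda_q)\nu_p+(\mu_p-\lambda_p)\lambda_q\right)}\,\partial^\lambda(v)\,\partial^{\mu+\nu-\lambda}$$ for $u,v\in\mathcal A$ with $v$ homogeneous of parity $g(v)$, where $g(\mu)=\sum_{p>\ell'_4}\mu_p$, $\binom\mu\lambda=\prod_p\binom{\mu_p}{\lambda_p}$, and terms with $\mu+\nu-\lambda\notin K$ are zero. With the superbracket $[u,v]=uv-(-1)^{g(u)g(v)}vu$,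 $W$ is a Lie superalgebra. A 2-cocycle on $W$ is a bilinear form $\psi:W\times W\to F$ with $\psi(u,v)=-(-1)^{g(u)g(v)}\psi(v,u)$ and $\psi(u,[v,w])=\psi([u,v],w)+(-1)^{g(u)g(v)}\psi(v,[u,w])$ for all homogeneous $u,v,w\in W$; a 2-coboundary is a form $(u,v)\mapsto f([u,v])$ with $f:W\to F$ linear. $H^2(W,F)$ is the space of 2-cocycles modulo 2-coboundaries, and $[\psi]$ is the class of $\psi$. Write $x^{\alpha,i}\partial^m$ for basis elements of $W$ in one even coordinate, and let $s_r=x^{0,1_{[\ell'_4+r]}}$, $\check\partial_r=\partial_{\ell'_4+r}$ for $1\le r\le\ell_5$. Let $W_0$ be the span of the $x^{\alpha,k}\partial^\mu$ with $k_p=\mu_p=0$ for all odd $p$, and let $W_1$ be the span of the products $s_1^{j_1}\cdots s_{\ell_5}^{j_{\ell_5}}\check\partial_1^{m_1}\cdots\check\partial_{\ell_5}^{m_{\ell_5}}$ with $j_r,m_r\in\{0,1\}$. There is exactly one linear functional $P$ on $W_1$ with $P([W_1,W_1])=0$ and $P(s_1\cdots s_{\ell_5}\check\partial_1\cdots\check\partial_{\ell_5})=1$.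 For a bilinear form $\phi$ on $W_0$ let $\phi\otimes P$ be the bilinear form on $W$ with $(\phi\otimes P)(au,bv)=\phi(a,b)P(uv)$ for $a,b\in W_0$, $u,v\in W_1$. 1. If $\ell'_4=\ell_4=1$, let $\phi_0$ be the bilinear form on $W_0$ with $$\phi_0\bigl(x^\alpha[\partial_1]_m,\;x^\beta[\partial_1]_n\bigr)=\delta_{\alpha+\beta,0}\,(-1)^m\,m!\,n!\binom{\alpha_1+m}{m+n+1}\qquad(\alpha,\beta\in\Gamma,\ m,n\ge 0),$$ where $[\partial_1]_m=\partial_1(\partial_1-1)\cdots(\partial_1-m+1)$ and $\binom an=a(a-1)\cdots(a-n+1)/n!$. Then $\phi_0\otimes P$ is a 2-cocycle and $H^2(W,F)=F\cdot[\phi_0\otimes P]$ is one-dimensional. 2. If $\ell'_4=\ell_3=1$, for $\gamma\in\Gamma$ let $\phi_\gamma$ be the bilinear form on $W_0$ with $$\phi_\gamma\bigl(x^{\alpha,i}\partial^m,\;x^{\beta,j}\partial^n\bigr)=\delta_{\alpha+\beta,\gamma}\,(-1)^m\,m!\,n!\sum_{s=0}^{m+n+1}\binom is\frac{\alpha_1^{\,m+n+1-s}}{(m+n+1-s)!}\cdot\frac{\gamma_1^{\,s-i-j-1}}{(s-i-j-1)!}$$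 for $\alpha,\beta\in\Gamma$, $i,j\in\mathbb Z$, $m,n\ge0$, where $a^r/r!$ is $0$ for $r<0$ and $0^0=1$. Then every $\phi_\gamma\otimes P$ is a 2-cocycle, and $H^2(W,F)=\prod_{\gamma\in\Gamma}F\cdot[\phi_\gamma\otimes P]$ is a direct product with one-dimensional factors: for $u,v\in W$ only finitely many $(\phi_\gamma\otimes P)(u,v)$ are nonzero, and the map $(c_\gamma)_{\gamma\in\Gamma}\mapsto\bigl[\sum_{\gamma}c_\gamma\,\phi_\gamma\otimes P\bigr]$ is a linear isomorphism from $F^\Gamma$ onto $H^2(W,F)$. 3. If $\ell'_2\ge1$ or $\ell'_4\ge2$, then $H^2(W,F)=0$. -/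

import Mathlib

set_option maxSynthPendingDepth 3

noncomputable section

namespace WeylSuper

/-- The data `(ℓ₁, …, ℓ₅, Γ)` of a Lie superalgebra of generalized Weyl type over `F`.
Coordinates are numbered `0, …, ℓ - 1` with `ℓ = ℓ₁ + ℓ₂ + ℓ₃ + ℓ₄ + ℓ₅`; those
with number at least `ℓ₁ + ℓ₂ + ℓ₃ + ℓ₄` are the odd (Grassmann) ones. At least one coordinate is
even. `Γ` lies in `{0}^ℓ₁ × F^(ℓ₂ + ℓ₃ + ℓ₄) × {0}^ℓ₅` and is nondegenerate there: it spans this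
space, i.e. it contains a basis of it. -/
structure WeylData (F : Type*) [Field F] where
  ℓ₁ : ℕ
  ℓ₂ : ℕ
  ℓ₃ : ℕ
  ℓ₄ : ℕ
  ℓ₅ : ℕ
  Γ : AddSubgroup (Fin (ℓ₁ + ℓ₂ + ℓ₃ + ℓ₄ + ℓ₅) → F)
  even_pos : 0 < ℓ₁ + ℓ₂ + ℓ₃ + ℓ₄
  vanish : ∀ α ∈ Γ, ∀ p : Fin (ℓ₁ + ℓ₂ + ℓ₃ + ℓ₄ + ℓ₅),
    (p.val < ℓ₁ ∨ ℓ₁ + ℓ₂ + ℓ₃ + ℓ₄ ≤ p.val) → α p = 0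
  nondegenerate : ∀ v : Fin (ℓ₁ + ℓ₂ + ℓ₃ + ℓ₄ + ℓ₅) → F,
    (∀ p, (p.val < ℓ₁ ∨ ℓ₁ + ℓ₂ + ℓ₃ + ℓ₄ ≤ p.val) → v p = 0) →
      v ∈ Submodule.span F (Γ : Set (Fin (ℓ₁ + ℓ₂ + ℓ₃ + ℓ₄ + ℓ₅) → F))

namespace WeylData

variable {F : Type*} [Field F] (D : WeylData F)

/-- The partial sum `ℓ'₂`. -/
abbrev ℓ'₂ : ℕ := D.ℓ₁ + D.ℓ₂

/-- The partial sum `ℓ'₃`. -/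
abbrev ℓ'₃ : ℕ := D.ℓ₁ + D.ℓ₂ + D.ℓ₃

/-- The partial sum `ℓ'₄`, the number of even coordinates. -/
abbrev ℓ'₄ : ℕ := D.ℓ₁ + D.ℓ₂ + D.ℓ₃ + D.ℓ₄

/-- The number `ℓ` of all coordinates. -/
abbrev ℓ : ℕ := D.ℓ₁ + D.ℓ₂ + D.ℓ₃ + D.ℓ₄ + D.ℓ₅

/-- The odd coordinates. -/
abbrev oddIdx : Finset (Fin D.ℓ) := Finset.univ.filter fun p => D.ℓ'₄ ≤ p.val

/-- The pairs `(p, q)` of odd coordinates with `p < q`. -/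
abbrev oddPairs : Finset (Fin D.ℓ × Fin D.ℓ) :=
  Finset.univ.filter fun r => D.ℓ'₄ ≤ r.1.val ∧ r.1 < r.2

/-- The first coordinate (an even one). -/
def first : Fin D.ℓ := ⟨0, Nat.lt_of_lt_of_le D.even_pos (Nat.le_add_right _ _)⟩

/-- The exponents `k` of the monomials `x^{α,k}`: the set
`J = ℤ₊^(ℓ₁ + ℓ₂) × ℤ^ℓ₃ × {0}^ℓ₄ × {0,1}^ℓ₅`. -/
def J : Set (Fin D.ℓ → ℤ) :=
  {k | ∀ p : Fin D.ℓ, (p.val < D.ℓ'₂ → 0 ≤ k p) ∧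
    (D.ℓ'₃ ≤ p.val → p.val < D.ℓ'₄ → k p = 0) ∧
    (D.ℓ'₄ ≤ p.val → k p = 0 ∨ k p = 1)}

/-- The exponents `μ` of the monomials `∂^μ`: the set `K = ℤ₊^ℓ'₄ × {0,1}^ℓ₅`. -/
def K : Set (Fin D.ℓ → ℕ) := {μ | ∀ p : Fin D.ℓ, D.ℓ'₄ ≤ p.val → μ p ≤ 1}

/-- The superalgebra `𝒜`, a vector space with basis `x^{α,k}`, `α ∈ Γ`, `k ∈ J`. -/
abbrev A : Type _ := (D.Γ × D.J) →₀ F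

open Classical in
/-- The monomial `x^{α,k}` for arbitrary integral `k`; zero if `k ∉ J`. -/
def xmon (α : D.Γ) (k : Fin D.ℓ → ℤ) : D.A :=
  if h : k ∈ D.J then Finsupp.single (α, ⟨k, h⟩) 1 else 0

/-- The product of `𝒜`: `x^{α,k} x^{α',k'} = (-1)^{∑ k_q k'_p} x^{α+α',k+k'}`, where the sum runs
over the odd coordinates `p < q`. -/
def mulA : D.A →ₗ[F] D.A →ₗ[F] D.A :=
  Finsupp.linearCombination F fun a => Finsupp.linearCombination F fun b =>
    ((-1 : F) ^ (∑ r ∈ D.oddPairs, a.2.1 r.2 * b.2.1 r.1)) •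
      D.xmon (a.1 + b.1) (a.2.1 + b.2.1)

/-- The derivation `∂_p` of `𝒜`:
`∂_p x^{α,k} = α_p x^{α,k} + (-1)^{∑ k_r} k_p x^{α,k-1_[p]}`, the sum over the odd coordinates
`r < p`. The first summand (`∂_p⁺`) vanishes when `p` is among the first `ℓ₁` coordinates or odd,
the second one (`∂_p⁻`) when `p` is among the `ℓ₄` coordinates; the sign is `+` for even `p`. -/
def der (p : Fin D.ℓ) : Module.End F D.A :=
  Finsupp.linearCombination F fun a =>
    a.1.1 p • D.xmon a.1 a.2.1 +
      ((-1 : F) ^ (∑ r ∈ D.oddIdx.filter (· < p), a.2.1 r) * (a.2.1 p : F)) •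
        D.xmon a.1 (a.2.1 - Pi.single p 1)

/-- `∂^μ` as an operator on `𝒜`: `v ↦ ∂_1^{μ_1}(∂_2^{μ_2}(⋯ ∂_ℓ^{μ_ℓ}(v)))`. -/
def derPow (μ : Fin D.ℓ → ℕ) : Module.End F D.A :=
  (List.ofFn fun p => D.der p ^ μ p).prod

/-- The index set of the basis `x^{α,k} ∂^μ` of `𝒲`. -/
abbrev Idx : Type _ := D.Γ × D.J × D.K

/-- The superalgebra `𝒲 = 𝒜 ⊗ F[𝒟]` of generalized Weyl type, a vector space with basis
`x^{α,k} ∂^μ`, `α ∈ Γ`, `k ∈ J`, `μ ∈ K`. -/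
abbrev W : Type _ := D.Idx →₀ F

open Classical in
/-- The element `x^{α,k} ∂^μ` of `𝒲`; zero if `k ∉ J` or `μ ∉ K`. -/
def mon (α : D.Γ) (k : Fin D.ℓ → ℤ) (μ : Fin D.ℓ → ℕ) : D.W :=
  if h : k ∈ D.J ∧ μ ∈ D.K then Finsupp.single (α, ⟨k, h.1⟩, ⟨μ, h.2⟩) 1 else 0

/-- The linear map `𝒜 → 𝒲`, `u ↦ u ∂^μ`; zero if `μ ∉ K`. -/
def attach (μ : Fin D.ℓ → ℕ) : D.A →ₗ[F] D.W :=
  Finsupp.linearCombination F fun a => D.mon a.1 a.2.1 μ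

/-- The exponent of `-1` in the term of index `d + lam = μ` of the product
`∂^μ · v ∂^ν`, where `g = g(v)`: the odd operators `∂^d` are moved past `v`
(exponent `g(v) g(d)`), `∂^d ∂^ν` is reordered (exponent `∑ d_q ν_p`), and `∂^μ` is reordered to
`∂^lam ∂^d` (exponent `∑ d_p lam_q`); the sums run over the odd coordinates `p < q`. -/
def signExp (g : ℤ) (d lam ν : Fin D.ℓ → ℕ) : ℤ :=
  g * (∑ p ∈ D.oddIdx, (d p : ℤ)) +
    ∑ r ∈ D.oddPairs, ((d r.2 : ℤ) * ν r.1 + (d r.1 : ℤ) * lam r.2)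

/-- The associative product of `𝒲`:
`u∂^μ · v∂^ν = u ∑_{λ ≤ μ} (μ choose λ) (±1) ∂^λ(v) ∂^{μ+ν-λ}`. -/
def mul : D.W →ₗ[F] D.W →ₗ[F] D.W :=
  Finsupp.linearCombination F fun a => Finsupp.linearCombination F fun b =>
    ∑ lam ∈ Finset.Iic a.2.2.1,
      ((-1 : F) ^ D.signExp (∑ p ∈ D.oddIdx, b.2.1.1 p) (a.2.2.1 - lam) lam b.2.2.1 *
          ∏ p, ((a.2.2.1 p).choose (lam p) : F)) •
        D.attach (a.2.2.1 - lam + b.2.2.1)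
          (D.mulA (D.xmon a.1 a.2.1.1) (D.derPow lam (D.xmon b.1 b.2.1.1)))

/-- The parity of the basis element `x^{α,k} ∂^μ`. -/
def parity (a : D.Idx) : ZMod 2 :=
  ∑ p ∈ D.oddIdx, ((a.2.1.1 p : ZMod 2) + (a.2.2.1 p : ZMod 2))

/-- The homogeneous component of `𝒲` of parity `d`. -/
def component (d : ZMod 2) : Submodule F D.W := Finsupp.supported F F {a | D.parity a = d}

/-- The sign `(-1)^{d e}`. -/
def koszul (d e : ZMod 2) : F := (-1 : F) ^ (d.val * e.val)

/-- The Lie superbracket: the bilinear extension of `[u, v] = u v - (-1)^{g(u) g(v)} v u`. -/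
def bracket : D.W →ₗ[F] D.W →ₗ[F] D.W :=
  Finsupp.linearCombination F fun a => Finsupp.linearCombination F fun b =>
    D.mul (Finsupp.single a 1) (Finsupp.single b 1) -
      (koszul (D.parity a) (D.parity b) : F) •
        D.mul (Finsupp.single b 1) (Finsupp.single a 1)

/-- The space of 2-cocycles on the Lie superalgebra `𝒲` with trivial coefficients. -/
def C2 : Submodule F (D.W →ₗ[F] D.W →ₗ[F] F) where
  carrier := {ψ |
    (∀ d e : ZMod 2, ∀ u ∈ D.component d, ∀ v ∈ D.component e,
      ψ u v = -(koszul d e * ψ v u)) ∧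
    (∀ d e f : ZMod 2, ∀ u ∈ D.component d, ∀ v ∈ D.component e, ∀ w ∈ D.component f,
      ψ u (D.bracket v w) =
        ψ (D.bracket u v) w + koszul d e * ψ v (D.bracket u w))}
  add_mem' := by
    rintro ψ χ ⟨h1, h2⟩ ⟨h3, h4⟩
    refine ⟨fun d e u hu v hv => ?_, fun d e f u hu v hv w hw => ?_⟩
    · simp only [LinearMap.add_apply]
      rw [h1 d e u hu v hv, h3 d e u hu v hv]
      ring
    · simp only [LinearMap.add_apply]
      rw [h2 d e f u hu v hv w hw, h4 d e f u hu v hv w hw]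
      ring
  zero_mem' := by
    refine ⟨fun d e u _ v _ => ?_, fun d e f u _ v _ w _ => ?_⟩ <;> simp
  smul_mem' := by
    rintro c ψ ⟨h1, h2⟩
    refine ⟨fun d e u hu v hv => ?_, fun d e f u hu v hv w hw => ?_⟩
    · simp only [LinearMap.smul_apply, smul_eq_mul]
      rw [h1 d e u hu v hv]
      ring
    · simp only [LinearMap.smul_apply, smul_eq_mul]
      rw [h2 d e f u hu v hv w hw]
      ring

/-- The space of 2-coboundaries `(u, v) ↦ f([u, v])`, `f` a linear functional on `𝒲`. -/
def B2 : Submodule F (D.W →ₗ[F] D.W →ₗ[F] F) :=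
  LinearMap.range
    ({ toFun := fun f => D.bracket.compr₂ f
       map_add' := fun f g => by ext; simp
       map_smul' := fun c f => by ext; simp } :
      (D.W →ₗ[F] F) →ₗ[F] (D.W →ₗ[F] D.W →ₗ[F] F))

/-- The second cohomology group `H²(𝒲, F)`: cocycles modulo coboundaries. -/
abbrev H2 : Type _ := D.C2 ⧸ D.B2.submoduleOf D.C2

/-- The cohomology class of a 2-cocycle. -/
def cls : D.C2 →ₗ[F] D.H2 := (D.B2.submoduleOf D.C2).mkQ

/-- The even Weyl-type part `𝒲₀`, spanned by the `x^{α,k} ∂^μ` with `k`, `μ` zero in all odd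
coordinates. -/
def W₀ : Submodule F D.W :=
  Finsupp.supported F F
    {a | ∀ p : Fin D.ℓ, D.ℓ'₄ ≤ p.val → a.2.1.1 p = 0 ∧ a.2.2.1 p = 0}

/-- The Grassmann part `𝒲₁`, spanned by the products `s_1^{j_1} ⋯ s_{ℓ₅}^{j_{ℓ₅}}
∂̌_1^{m_1} ⋯ ∂̌_{ℓ₅}^{m_{ℓ₅}}` with exponents in `{0, 1}`. -/
def W₁ : Submodule F D.W :=
  Finsupp.supported F F
    {a | a.1 = 0 ∧ ∀ p : Fin D.ℓ, p.val < D.ℓ'₄ → a.2.1.1 p = 0 ∧ a.2.2.1 p = 0}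

/-- The sub-superalgebra of `𝒜` spanned by the `s^j`. -/
def oddA : Submodule F D.A :=
  Finsupp.supported F F {a | a.1 = 0 ∧ ∀ p : Fin D.ℓ, p.val < D.ℓ'₄ → a.2.1 p = 0}

theorem lc_mem {ι M : Type*} [AddCommGroup M] [Module F M] {S : Set ι} {N : Submodule F M}
    {f : ι → M} (h : ∀ a ∈ S, f a ∈ N) {u : ι →₀ F} (hu : u ∈ Finsupp.supported F F S) :
    Finsupp.linearCombination F f u ∈ N := by
  rw [Finsupp.linearCombination_apply]
  exact N.sum_mem fun a ha => N.smul_mem _ (h a (hu ha))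

theorem lc₂_mem {ι κ M : Type*} [AddCommGroup M] [Module F M] {S : Set ι} {T : Set κ}
    {N : Submodule F M} {f : ι → κ → M} (h : ∀ a ∈ S, ∀ b ∈ T, f a b ∈ N) {u : ι →₀ F}
    {v : κ →₀ F} (hu : u ∈ Finsupp.supported F F S) (hv : v ∈ Finsupp.supported F F T) :
    Finsupp.linearCombination F (fun a => Finsupp.linearCombination F (f a)) u v ∈ N := by
  rw [Finsupp.linearCombination_apply, Finsupp.sum, LinearMap.sum_apply]
  exact N.sum_mem fun a ha => N.smul_mem _ (lc_mem (h a (hu ha)) hv)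

theorem xmon_mem {k : Fin D.ℓ → ℤ} (hk : ∀ p : Fin D.ℓ, p.val < D.ℓ'₄ → k p = 0) :
    D.xmon 0 k ∈ D.oddA := by
  unfold xmon
  split_ifs with h
  · exact Finsupp.single_mem_supported F 1 ⟨rfl, hk⟩
  · exact zero_mem _

theorem mulA_mem {u v : D.A} (hu : u ∈ D.oddA) (hv : v ∈ D.oddA) : D.mulA u v ∈ D.oddA := by
  refine lc₂_mem (fun a ha b hb => ?_) hu hv
  rw [ha.1, hb.1, add_zero]
  refine Submodule.smul_mem _ _ (D.xmon_mem fun p hp => ?_)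
  simp [ha.2 p hp, hb.2 p hp]

theorem der_mem {p : Fin D.ℓ} (hp : D.ℓ'₄ ≤ p.val) {u : D.A} (hu : u ∈ D.oddA) :
    D.der p u ∈ D.oddA := by
  refine lc_mem (fun a ha => ?_) hu
  rw [ha.1]
  refine add_mem (Submodule.smul_mem _ _ (D.xmon_mem fun q hq => ha.2 q hq))
    (Submodule.smul_mem _ _ (D.xmon_mem fun q hq => ?_))
  have hqp : q ≠ p := by
    rintro rfl
    omega
  simp [ha.2 q hq, Pi.single_eq_of_ne hqp]

theorem derPow_mem {μ : Fin D.ℓ → ℕ} (hμ : ∀ p : Fin D.ℓ, p.val < D.ℓ'₄ → μ p = 0) {u : D.A}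
    (hu : u ∈ D.oddA) : D.derPow μ u ∈ D.oddA := by
  have key : ∀ l : List (Module.End F D.A), (∀ x ∈ l, ∀ v ∈ D.oddA, x v ∈ D.oddA) →
      l.prod u ∈ D.oddA := by
    intro l
    induction l with
    | nil => intro _; simpa using hu
    | cons x l ih =>
      intro h
      rw [List.prod_cons, Module.End.mul_apply]
      exact h x (by simp) _ (ih fun y hy => h y (by simp [hy]))
  refine key _ fun x hx v hv => ?_
  obtain ⟨p, rfl⟩ := (List.mem_ofFn' _ _).1 hx
  rcases Nat.lt_or_ge p.val D.ℓ'₄ with hp | hp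
  · simpa [hμ p hp] using hv
  · have : ∀ n : ℕ, (D.der p ^ n) v ∈ D.oddA := by
      intro n
      induction n with
      | zero => simpa using hv
      | succ n ih =>
        rw [pow_succ', Module.End.mul_apply]
        exact D.der_mem hp ih
    exact this _

theorem mon_mem {k : Fin D.ℓ → ℤ} {μ : Fin D.ℓ → ℕ}
    (h : ∀ p : Fin D.ℓ, p.val < D.ℓ'₄ → k p = 0 ∧ μ p = 0) : D.mon 0 k μ ∈ D.W₁ := by
  unfold mon
  split_ifs with h'
  · exact Finsupp.single_mem_supported F 1 ⟨rfl, h⟩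
  · exact zero_mem _

/-- `𝒲₁` is closed under the product. -/
theorem mul_mem_W₁ {u v : D.W} (hu : u ∈ D.W₁) (hv : v ∈ D.W₁) : D.mul u v ∈ D.W₁ := by
  refine lc₂_mem (fun a ha b hb => ?_) hu hv
  refine Submodule.sum_mem _ fun lam hlam => Submodule.smul_mem _ _ ?_
  have hl : ∀ p : Fin D.ℓ, p.val < D.ℓ'₄ → lam p = 0 := fun p hp =>
    Nat.le_zero.1 ((Finset.mem_Iic.1 hlam p).trans (ha.2 p hp).2.le)
  refine lc_mem (fun c hc => ?_) (D.mulA_mem (u := D.xmon a.1 a.2.1.1) ?_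
    (D.derPow_mem hl (u := D.xmon b.1 b.2.1.1) ?_))
  · rw [hc.1]
    refine D.mon_mem fun p hp => ⟨hc.2 p hp, ?_⟩
    simp [(ha.2 p hp).2, (hb.2 p hp).2]
  · rw [ha.1]
    exact D.xmon_mem fun p hp => (ha.2 p hp).1
  · rw [hb.1]
    exact D.xmon_mem fun p hp => (hb.2 p hp).1

/-- `𝒲₁` is closed under the superbracket. -/
theorem bracket_mem_W₁ {u v : D.W} (hu : u ∈ D.W₁) (hv : v ∈ D.W₁) : D.bracket u v ∈ D.W₁ := by
  refine lc₂_mem (fun a ha b hb => ?_) hu hv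
  have ha' : (Finsupp.single a 1 : D.W) ∈ D.W₁ := Finsupp.single_mem_supported F 1 ha
  have hb' : (Finsupp.single b 1 : D.W) ∈ D.W₁ := Finsupp.single_mem_supported F 1 hb
  exact sub_mem (D.mul_mem_W₁ ha' hb') (Submodule.smul_mem _ _ (D.mul_mem_W₁ hb' ha'))

/-- The element `u₁ = s_1 ⋯ s_{ℓ₅} ∂̌_1 ⋯ ∂̌_{ℓ₅}` of `𝒲₁`. -/
def u₁ : D.W₁ :=
  ⟨D.mon 0 (fun p => if D.ℓ'₄ ≤ p.val then 1 else 0)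
      (fun p => if D.ℓ'₄ ≤ p.val then 1 else 0),
    D.mon_mem fun p hp => by simp [Nat.not_le.2 hp]⟩

/-- `P` is the linear functional on `𝒲₁` with `P(u₁) = 1` and `P([𝒲₁, 𝒲₁]) = 0`. -/
def IsSupertrace (P : D.W₁ →ₗ[F] F) : Prop :=
  P D.u₁ = 1 ∧ ∀ u v : D.W₁, P ⟨D.bracket u v, D.bracket_mem_W₁ u.2 v.2⟩ = 0

/-- `Φ(a u, b v) = φ(a, b) P(u v)` for `a, b ∈ 𝒲₀` and `u, v ∈ 𝒲₁`, i.e. `Φ = φ ⊗ P`. -/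
def IsTensor (Φ : D.W →ₗ[F] D.W →ₗ[F] F) (φ : D.W₀ →ₗ[F] D.W₀ →ₗ[F] F) (P : D.W₁ →ₗ[F] F) :
    Prop :=
  ∀ (a b : D.W₀) (u v : D.W₁),
    Φ (D.mul a u) (D.mul b v) = φ a b * P ⟨D.mul u v, D.mul_mem_W₁ u.2 v.2⟩

theorem mon₁_aux {p : Fin D.ℓ} (hp : D.ℓ'₄ ≤ p.val) : p ≠ D.first := by
  rintro rfl
  exact absurd (Nat.le_zero.1 hp) D.even_pos.ne'

/-- The element `x^α t_1^i ∂_1^m` of `𝒲₀` (first coordinate only; zero if `i` is not allowed). -/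
def mon₁ (α : D.Γ) (i : ℤ) (m : ℕ) : D.W₀ :=
  ⟨D.mon α (Pi.single D.first i) (Pi.single D.first m), by
    unfold mon
    split_ifs with h
    · refine Finsupp.single_mem_supported F 1 fun p hp => ?_
      simp [Pi.single_eq_of_ne (D.mon₁_aux hp)]
    · exact zero_mem _⟩

/-- The element `x^α [∂_1]_m` of `𝒲₀`, where `[∂_1]_m = ∂_1 (∂_1 - 1) ⋯ (∂_1 - m + 1)`. -/
def fallMon (α : D.Γ) (m : ℕ) : D.W₀ :=
  (descPochhammer F m).sum fun r c => c • D.mon₁ α 0 r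

end WeylData

/-- The binomial coefficient `a (a - 1) ⋯ (a - n + 1) / n!` for `a` in a field. -/
def gbinom {F : Type*} [Field F] (a : F) (n : ℕ) : F :=
  (∏ i ∈ Finset.range n, (a - i)) / (n.factorial : F)

/-- The divided power `a^m / m!`, zero for `m < 0`; here `a^0 = 1` also for `a = 0`. -/
def divPow {F : Type*} [Field F] (a : F) (m : ℤ) : F :=
  if m < 0 then 0 else a ^ m.toNat / (m.toNat.factorial : F)

namespace WeylData

variable {F : Type*} [Field F] (D : WeylData F)

open Classical in
/-- `φ` is the Kac-Peterson type cocycle `φ₀` on `𝒲₀` (used when `ℓ'₄ = ℓ₄ = 1`):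
`φ₀(x^α [∂_1]_m, x^β [∂_1]_n) = δ_{α+β,0} (-1)^m m! n! (α + m choose m + n + 1)`. -/
def IsPhiZero (φ : D.W₀ →ₗ[F] D.W₀ →ₗ[F] F) : Prop :=
  ∀ (α β : D.Γ) (m n : ℕ),
    φ (D.fallMon α m) (D.fallMon β n) =
      if α + β = 0 then
        (-1) ^ m * (m.factorial : F) * (n.factorial : F) *
          gbinom (α.1 D.first + (m : F)) (m + n + 1)
      else 0

open Classical in
/-- `φ` is the cocycle `φ_γ` on `𝒲₀` (used when `ℓ'₄ = ℓ₃ = 1`):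
`φ_γ(x^{α,i} ∂^m, x^{β,j} ∂^n) = δ_{α+β,γ} (-1)^m m! n!
∑_{s=0}^{m+n+1} (i choose s) α^{m+n+1-s}/(m+n+1-s)! ⬝ γ^{s-i-j-1}/(s-i-j-1)!`. -/
def IsPhi (γ : D.Γ) (φ : D.W₀ →ₗ[F] D.W₀ →ₗ[F] F) : Prop :=
  ∀ (α β : D.Γ) (i j : ℤ) (m n : ℕ),
    φ (D.mon₁ α i m) (D.mon₁ β j n) =
      if α + β = γ then
        (-1) ^ m * (m.factorial : F) * (n.factorial : F) *
          ∑ s ∈ Finset.range (m + n + 2),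
            gbinom (i : F) s * divPow (α.1 D.first) ((m : ℤ) + n + 1 - s) *
              divPow (γ.1 D.first) ((s : ℤ) - i - j - 1)
      else 0

end WeylData

end WeylSuper

end

/-! Upper bound. Let `z` be an even element with a partner `z'` such that `[z, z'] = 1`, and let `ad
z` be locally nilpotent. Then `ad z` and right multiplication by `z'` satisfy the Heisenberg
relation, so `ad z` is onto (`heisenberg_surjective`). If `ψ(z, ·)` vanishes on the centralizer of
`z`, it has the form `f ∘ ad z`, and induction on the nilpotency order of `u` gives `ψ(u, v) = f([u,
v])` (`CocycleAt.exists_eq`). Such pairs are `t_p, -∂_p` and `x^β`, `-β_p⁻¹ x^{-β} ∂_p`. So a class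
is controlled by `ψ(z, ·)` on the centralizer of `z`, and this functional kills brackets of
centralizing elements. With two even coordinates there is a second pair commuting with `z`, every
centralizing element is a bracket of centralizing elements, and the cohomology is zero
(`mem_B2_of_two_le`).

With one even coordinate the centralizer is spanned by the monomials free of `∂_1` (`mem_powSpan`,
`mem_of_heisenberg`). A monomial that misses some `s_r` or `∂̌_r` is a multiple of a bracket with
`∂̌_r` or `s_r` (`m_eq_br`), so only the elements `top α i` matter (`eq_zero_of_top`). The cocycle
identity for `∂_1` relates the values on these. No freedom is left for a polynomial coordinate
(`mem_B2_of_poly`), one scalar for each `γ`, at `i = -1`, for a Laurent coordinate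
(`mem_B2_of_laurent`), and one scalar for an exponential coordinate (`mem_B2_of_exp`).

Lower bound. A skew form with the cyclic identity `φ(ab, c) = φ(a, bc) + φ(b, ca)` on the
associative algebra `𝒲₀`, multiplied by the supertrace of `𝒲₁`, is a cocycle on `𝒲` (`tens_mem_C2`).
In the Laurent case `x^{α,i}` behaves like `t^i e^{αt}` and `φ` is a weighted residue of
`f^{(m+n+1)} g`. In the exponential case `φ` is the finite sum `∑_{0 ≤ k < α} p(k - α) q(k)`,
extended polynomially to `α ∈ F`. Coboundaries vanish on pairs with zero bracket, and evaluation on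
such pairs shows that the classes are independent.

All of this uses that `𝒲` is associative. A basis element acts from the left as a composition of
generator operators, and these commute with right multiplications (`mul_assoc'`). -/

noncomputable section

namespace WeylSuper

open Finset

/-! ### Signs -/

/-- The sign `(-1)^n`. -/
def sgn (F : Type*) [Field F] (n : ℤ) : F := (-1 : F) ^ n

section Sign

variable {F : Type*} [Field F]

theorem sgn_add (a b : ℤ) : sgn F (a + b) = sgn F a * sgn F b :=
  zpow_add₀ (neg_ne_zero.2 one_ne_zero) a b

@[simp] theorem sgn_zero : sgn F 0 = 1 := zpow_zero _

@[simp] theorem sgn_one : sgn F 1 = -1 := zpow_one _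

theorem sgn_two_mul (a : ℤ) : sgn F (2 * a) = 1 := by
  rw [sgn, zpow_mul]
  norm_num

@[simp] theorem sgn_mul_self (a : ℤ) : sgn F a * sgn F a = 1 := by
  rw [← sgn_add, ← two_mul, sgn_two_mul]

theorem sgn_congr {a b : ℤ} (c : ℤ) (h : a = b + 2 * c) : sgn F a = sgn F b := by
  rw [h, sgn_add, sgn_two_mul, mul_one]

theorem sgn_neg (a : ℤ) : sgn F (-a) = sgn F a := sgn_congr (-a) (by ring)

theorem sgn_sub (a b : ℤ) : sgn F (a - b) = sgn F a * sgn F b := by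
  rw [sub_eq_add_neg, sgn_add, sgn_neg]

theorem sgn_ne_zero (a : ℤ) : sgn F a ≠ 0 := zpow_ne_zero _ (neg_ne_zero.2 one_ne_zero)

end Sign

/-! ### Sums over multi-indices -/

section Pascal

variable {ι F : Type*} [Fintype ι] [DecidableEq ι] [Field F]

/-- Pascal's rule in the single coordinate `p`. The guard `1 ≤ lam p` is needed because the
subtraction truncates at zero. -/
theorem prod_choose_add_single (μ lam : ι → ℕ) (p : ι) :
    ∏ q, (((μ + Pi.single p 1 : ι → ℕ) q).choose (lam q) : F) =
      ∏ q, ((μ q).choose (lam q) : F) +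
        if 1 ≤ lam p then ∏ q, ((μ q).choose ((lam - Pi.single p 1 : ι → ℕ) q) : F) else 0 := by
  have h1 : ∏ q ∈ univ.erase p, (((μ + Pi.single p 1 : ι → ℕ) q).choose (lam q) : F) =
      ∏ q ∈ univ.erase p, ((μ q).choose (lam q) : F) :=
    prod_congr rfl fun q hq => by simp [Pi.single_eq_of_ne (ne_of_mem_erase hq)]
  have h2 : ∏ q, ((μ q).choose ((lam - Pi.single p 1 : ι → ℕ) q) : F) =
      ((μ p).choose (lam p - 1) : F) * ∏ q ∈ univ.erase p, ((μ q).choose (lam q) : F) := by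
    rw [← mul_prod_erase univ _ (mem_univ p)]
    congr 1
    · simp
    · exact prod_congr rfl fun q hq => by simp [Pi.single_eq_of_ne (ne_of_mem_erase hq)]
  rw [h2, ← mul_prod_erase univ _ (mem_univ p), h1,
    ← mul_prod_erase univ (fun q => ((μ q).choose (lam q) : F)) (mem_univ p)]
  simp only [Pi.add_apply, Pi.single_eq_same]
  rcases h : lam p with _ | s
  · simp
  · rw [if_pos (by omega), Nat.choose_succ_succ, Nat.add_sub_cancel]
    push_cast
    ring

/-- The extra unit in coordinate `p` goes either to `lam` or to its complement. With `G` the summand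
of the product formula this passes from the expansion for `∂^μ` to that for `∂_p ∂^μ`. -/
theorem sum_Iic_add_single {M : Type*} [AddCommGroup M] [Module F M]
    (G : (ι → ℕ) → (ι → ℕ) → M) (μ : ι → ℕ) (p : ι) :
    ∑ lam ∈ Iic (μ + Pi.single p 1),
        (∏ q, (((μ + Pi.single p 1 : ι → ℕ) q).choose (lam q) : F)) • G lam (μ + Pi.single p 1 - lam) =
      ∑ lam ∈ Iic μ, (∏ q, ((μ q).choose (lam q) : F)) •
        (G (lam + Pi.single p 1) (μ - lam) + G lam (μ - lam + Pi.single p 1)) := by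
  simp only [prod_choose_add_single, add_smul, smul_add, sum_add_distrib]
  rw [add_comm]
  congr 1
  · simp only [ite_smul, zero_smul]
    rw [← sum_filter]
    symm
    refine sum_nbij' (fun lam => lam + Pi.single p 1) (fun lam => lam - Pi.single p 1) ?_ ?_ ?_ ?_ ?_
    · intro lam h
      rw [mem_Iic] at h
      rw [mem_filter, mem_Iic]
      exact ⟨by gcongr, by simp⟩
    · intro lam h
      rw [mem_filter, mem_Iic] at h
      rw [mem_Iic]
      exact tsub_le_iff_right.2 h.1
    · intro lam _
      simp
    · intro lam h
      rw [mem_filter] at h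
      refine tsub_add_cancel_of_le fun q => ?_
      rcases eq_or_ne q p with rfl | hq
      · simpa using h.2
      · simp [Pi.single_eq_of_ne hq]
    · intro lam _
      simp only [add_tsub_cancel_right, add_tsub_add_eq_tsub_right]
  · symm
    -- The indices added to `Iic μ` exceed `μ` somewhere, so their binomial coefficient is zero.
    rw [← sum_subset (s₁ := Iic μ) (s₂ := Iic (μ + Pi.single p 1))]
    · refine sum_congr rfl fun lam h => ?_
      rw [mem_Iic] at h
      rw [tsub_add_eq_add_tsub h]
    · exact Iic_subset_Iic.2 le_self_add
    · intro lam _ h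
      rw [mem_Iic, Pi.le_def, not_forall] at h
      obtain ⟨q, hq⟩ := h
      rw [prod_eq_zero (mem_univ q) (by rw [Nat.choose_eq_zero_of_lt (not_le.1 hq), Nat.cast_zero]),
        zero_smul]

end Pascal

/-- Moving a factor to its place in an ordered product of operators commuting up to signs. -/
theorem mul_prod_ofFn {F M : Type*} [Field F] [Ring M] [Algebra F M] :
    ∀ {n : ℕ} (T : Fin n → M) (e : Fin n → Fin n → ℤ)
      (_ : ∀ p q, q < p → T p * T q = sgn F (e p q) • (T q * T p)) (m : Fin n → ℕ) (p : Fin n),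
      T p * (List.ofFn fun q => T q ^ m q).prod =
        sgn F (∑ r with r < p, e p r * m r) •
          (List.ofFn fun q => T q ^ (m + Pi.single p 1 : Fin n → ℕ) q).prod
  | 0, _, _, _, _, p => p.elim0
  | n + 1, T, e, hT, m, p => by
    rw [List.ofFn_succ, List.ofFn_succ, List.prod_cons, List.prod_cons]
    refine Fin.cases ?_ (fun p => ?_) p
    · have h1 : ∀ i : Fin n, (m + Pi.single 0 1 : Fin (n + 1) → ℕ) i.succ = m i.succ := fun i => by simp
      simp [h1, pow_succ', mul_assoc]
    · have h0 : (m + Pi.single p.succ 1 : Fin (n + 1) → ℕ) 0 = m 0 := by simp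
      have h1 : ∀ i : Fin n, (m + Pi.single p.succ 1 : Fin (n + 1) → ℕ) i.succ =
          ((fun i => m i.succ) + Pi.single p 1 : Fin n → ℕ) i := fun i => by simp [Pi.single_apply]
      have hc : ∀ j : ℕ, T p.succ * T 0 ^ j = sgn F (e p.succ 0 * j) • (T 0 ^ j * T p.succ) := by
        intro j
        induction j with
        | zero => simp
        | succ j ih =>
          rw [pow_succ, ← mul_assoc, ih, smul_mul_assoc, mul_assoc, hT _ _ (Fin.succ_pos p),
            mul_smul_comm, smul_smul, ← sgn_add, ← mul_assoc]
          congr 2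
          push_cast
          ring
      have hs : ∑ r with r < p.succ, e p.succ r * m r =
          e p.succ 0 * m 0 + ∑ r with r < p, e p.succ r.succ * m r.succ := by
        simp only [sum_filter]
        rw [Fin.sum_univ_succ]
        simp
      have ih := mul_prod_ofFn (F := F) (fun i => T i.succ) (fun i j => e i.succ j.succ)
        (fun p q h => hT _ _ (Fin.succ_lt_succ_iff.2 h)) (fun i => m i.succ) p
      simp only [h0, h1]
      rw [← mul_assoc, hc, smul_mul_assoc, mul_assoc, ih, mul_smul_comm, smul_smul, hs, sgn_add]

namespace WeylData

variable {F : Type*} [Field F] (D : WeylData F)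

/-- `1` for odd coordinates, `0` for even ones. -/
def odd (p : Fin D.ℓ) : ℤ := if D.ℓ'₄ ≤ p.val then 1 else 0

/-- The sum of the odd entries. -/
def deg (f : Fin D.ℓ → ℤ) : ℤ := ∑ p ∈ D.oddIdx, f p

/-- The sum of the odd entries left of `p`. -/
def below (p : Fin D.ℓ) (f : Fin D.ℓ → ℤ) : ℤ := ∑ r ∈ D.oddIdx.filter (· < p), f r

/-- The sum of the odd entries right of `p` if `p` is odd. -/
def above (p : Fin D.ℓ) (f : Fin D.ℓ → ℤ) : ℤ := D.odd p * ∑ r ∈ D.oddIdx.filter (p < ·), f r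

/-- The reordering exponent `∑ f_q h_p` over odd `p < q`. -/
def pair (f h : Fin D.ℓ → ℤ) : ℤ := ∑ r ∈ D.oddPairs, f r.2 * h r.1

/-- The unit vector. -/
abbrev e (p : Fin D.ℓ) : Fin D.ℓ → ℤ := Pi.single p 1

/-- The unit vector with natural entries. -/
abbrev en (p : Fin D.ℓ) : Fin D.ℓ → ℕ := Pi.single p 1

/-- The cast of a natural multi-index. -/
def cz (μ : Fin D.ℓ → ℕ) : Fin D.ℓ → ℤ := fun p => μ p

theorem cz_add (μ ν : Fin D.ℓ → ℕ) : D.cz (μ + ν) = D.cz μ + D.cz ν := by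
  ext; simp [cz]

theorem cz_zero : D.cz 0 = 0 := by ext; simp [cz]

theorem cz_en (p : Fin D.ℓ) : D.cz (D.en p) = D.e p := by
  ext q; simp [cz, Pi.single_apply]

theorem deg_add (f g : Fin D.ℓ → ℤ) : D.deg (f + g) = D.deg f + D.deg g := by
  simp [deg, sum_add_distrib]

theorem deg_sub (f g : Fin D.ℓ → ℤ) : D.deg (f - g) = D.deg f - D.deg g := by
  simp [deg, sum_sub_distrib]

theorem deg_zero : D.deg 0 = 0 := by simp [deg]

theorem below_add (p : Fin D.ℓ) (f g : Fin D.ℓ → ℤ) :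
    D.below p (f + g) = D.below p f + D.below p g := by
  simp [below, sum_add_distrib]

theorem below_sub (p : Fin D.ℓ) (f g : Fin D.ℓ → ℤ) :
    D.below p (f - g) = D.below p f - D.below p g := by
  simp [below, sum_sub_distrib]

theorem below_zero (p : Fin D.ℓ) : D.below p 0 = 0 := by simp [below]

theorem pair_add_left (f g h : Fin D.ℓ → ℤ) : D.pair (f + g) h = D.pair f h + D.pair g h := by
  simp [pair, sum_add_distrib, add_mul]

theorem pair_add_right (f g h : Fin D.ℓ → ℤ) : D.pair f (g + h) = D.pair f g + D.pair f h := by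
  simp [pair, sum_add_distrib, mul_add]

theorem pair_sub_left (f g h : Fin D.ℓ → ℤ) : D.pair (f - g) h = D.pair f h - D.pair g h := by
  simp [pair, sum_sub_distrib, sub_mul]

theorem pair_sub_right (f g h : Fin D.ℓ → ℤ) : D.pair f (g - h) = D.pair f g - D.pair f h := by
  simp [pair, sum_sub_distrib, mul_sub]

theorem pair_zero_left (f : Fin D.ℓ → ℤ) : D.pair 0 f = 0 := by simp [pair]

theorem pair_zero_right (f : Fin D.ℓ → ℤ) : D.pair f 0 = 0 := by simp [pair]

theorem odd_of_le {p : Fin D.ℓ} (h : D.ℓ'₄ ≤ p.val) : D.odd p = 1 := if_pos h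

theorem odd_of_lt {p : Fin D.ℓ} (h : p.val < D.ℓ'₄) : D.odd p = 0 := if_neg (not_le.2 h)

theorem deg_e (p : Fin D.ℓ) : D.deg (D.e p) = D.odd p := by
  simp [deg, odd, Pi.single_apply]

theorem below_e (p q : Fin D.ℓ) : D.below p (D.e q) = if q < p then D.odd q else 0 := by
  simp [below, odd, Pi.single_apply, ← ite_and, and_comm]

theorem pair_e_left (p : Fin D.ℓ) (f : Fin D.ℓ → ℤ) : D.pair (D.e p) f = D.below p f := by
  rw [pair, below]
  symm
  refine sum_of_injOn (fun r => (r, p)) (fun a _ b _ h => (Prod.mk.inj h).1) ?_ ?_ ?_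
  · intro r hr
    simpa using hr
  · rintro ⟨a, b⟩ h1 h2
    rcases eq_or_ne b p with rfl | hb
    · refine absurd ⟨a, ?_, rfl⟩ h2
      simpa using h1
    · simp [Pi.single_eq_of_ne hb]
  · intro r _
    simp

theorem pair_e_right (p : Fin D.ℓ) (f : Fin D.ℓ → ℤ) : D.pair f (D.e p) = D.above p f := by
  rw [pair, above, odd]
  split_ifs with hp
  · rw [one_mul]
    symm
    refine sum_of_injOn (fun r => (p, r)) (fun a _ b _ h => (Prod.mk.inj h).2) ?_ ?_ ?_
    · intro r hr
      simp only [coe_filter, mem_univ, true_and, Set.mem_ofPred_eq, mem_filter] at hr ⊢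
      exact ⟨hp, hr.2⟩
    · rintro ⟨a, b⟩ h1 h2
      rcases eq_or_ne a p with rfl | ha
      · refine absurd ⟨b, ?_, rfl⟩ h2
        simp only [mem_filter, mem_univ, true_and, coe_filter, Set.mem_ofPred_eq] at h1 ⊢
        exact ⟨h1.1.trans h1.2.le, h1.2⟩
      · simp [Pi.single_eq_of_ne ha]
    · intro r _
      simp
  · rw [zero_mul]
    refine sum_eq_zero fun r hr => ?_
    have : r.1 ≠ p := by
      rintro rfl
      exact hp (mem_filter.1 hr).2.1
    simp [Pi.single_eq_of_ne this]

theorem below_of_lt {p : Fin D.ℓ} (h : p.val < D.ℓ'₄) (f : Fin D.ℓ → ℤ) : D.below p f = 0 := by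
  refine sum_eq_zero fun r hr => ?_
  simp only [mem_filter, mem_univ, true_and] at hr
  have := Fin.lt_def.1 hr.2
  omega

theorem odd_mul_below (p : Fin D.ℓ) (f : Fin D.ℓ → ℤ) :
    D.odd p * D.below p f = D.below p f := by
  rcases lt_or_ge p.val D.ℓ'₄ with h | h
  · rw [D.below_of_lt h, mul_zero]
  · rw [D.odd_of_le h, one_mul]

theorem odd_mul_deg (p : Fin D.ℓ) (f : Fin D.ℓ → ℤ) :
    D.odd p * D.deg f = D.below p f + D.odd p * f p + D.above p f := by
  rcases lt_or_ge p.val D.ℓ'₄ with h | h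
  · rw [D.below_of_lt h, above, D.odd_of_lt h]
    simp
  · rw [above, D.odd_of_le h, one_mul, one_mul, one_mul, deg, below, add_assoc,
      ← sum_filter_add_sum_filter_not D.oddIdx (· < p)]
    congr 1
    have : D.oddIdx.filter (fun r => ¬ r < p) = insert p (D.oddIdx.filter (p < ·)) := by
      ext r
      simp only [mem_filter, mem_univ, true_and, mem_insert, not_lt, le_iff_eq_or_lt]
      constructor
      · rintro ⟨h1, h2 | h2⟩
        · exact Or.inl h2.symm
        · exact Or.inr ⟨h1, h2⟩
      · rintro (rfl | h1)
        · exact ⟨by simpa [le_iff_eq_or_lt] using h, Or.inl rfl⟩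
        · exact ⟨h1.1, Or.inr h1.2⟩
    rw [this, sum_insert (by simp)]

/-! ### Exponents -/

variable {D}

theorem zero_mem_J : (0 : Fin D.ℓ → ℤ) ∈ D.J := fun _ => ⟨fun _ => le_rfl, fun _ _ => rfl,
  fun _ => Or.inl rfl⟩

theorem zero_mem_K : (0 : Fin D.ℓ → ℕ) ∈ D.K := fun _ _ => Nat.zero_le _

theorem K_of_le {μ ν : Fin D.ℓ → ℕ} (h : ν ≤ μ) (hμ : μ ∈ D.K) : ν ∈ D.K :=
  fun p hp => (h p).trans (hμ p hp)

theorem sub_e_mem_J {k : Fin D.ℓ → ℤ} (hk : k ∈ D.J) {p : Fin D.ℓ} (h : k p ≠ 0) :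
    k - D.e p ∈ D.J := by
  intro q
  rcases eq_or_ne q p with rfl | hq
  · simp only [Pi.sub_apply, Pi.single_eq_same]
    obtain ⟨h1, h2, h3⟩ := hk q
    refine ⟨fun h' => ?_, fun h' h'' => absurd (h2 h' h'') h, fun h' => Or.inl ?_⟩
    · have := h1 h'
      omega
    · have := h3 h'
      omega
  · simpa [Pi.single_eq_of_ne hq] using hk q

theorem add_mem_J {k l : Fin D.ℓ → ℤ} (hk : k ∈ D.J) (hl : l ∈ D.J)
    (h : ∀ p : Fin D.ℓ, D.ℓ'₄ ≤ p.val → k p = 0 ∨ l p = 0) : k + l ∈ D.J := by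
  intro p
  obtain ⟨h1, h2, h3⟩ := hk p
  obtain ⟨h4, h5, h6⟩ := hl p
  simp only [Pi.add_apply]
  refine ⟨fun h' => add_nonneg (h1 h') (h4 h'), fun h' h'' => by rw [h2 h' h'', h5 h' h'', add_zero],
    fun h' => ?_⟩
  rcases h p h' with h0 | h0
  · rw [h0, zero_add]
    exact h6 h'
  · rw [h0, add_zero]
    exact h3 h'

theorem add_not_mem_J {k l : Fin D.ℓ → ℤ} (hk : k ∈ D.J) (hl : l ∈ D.J) (h : k + l ∉ D.J) :
    ∃ p : Fin D.ℓ, D.ℓ'₄ ≤ p.val ∧ k p = 1 ∧ l p = 1 := by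
  by_contra! hc
  refine h (add_mem_J hk hl fun p hp => ?_)
  have h1 := (hk p).2.2 hp
  have h2 := (hl p).2.2 hp
  have h3 := hc p hp
  omega

/-- `l + m` leaves `J` only through an entry `2` in an odd coordinate, and `k` is nonnegative there.
Hence a vanishing monomial stays zero after left multiplication. -/
theorem add_add_not_mem_J {k l m : Fin D.ℓ → ℤ} (hk : k ∈ D.J) (hl : l ∈ D.J) (hm : m ∈ D.J)
    (h : l + m ∉ D.J) : k + (l + m) ∉ D.J := by
  intro hc
  obtain ⟨p, hp, h1, h2⟩ := add_not_mem_J hl hm h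
  have h3 := (hc p).2.2 hp
  have h4 := (hk p).2.2 hp
  simp only [Pi.add_apply] at h3
  omega

theorem not_mem_J_of_two_le {k : Fin D.ℓ → ℤ} {p : Fin D.ℓ} (hp : D.ℓ'₄ ≤ p.val) (h : 2 ≤ k p) :
    k ∉ D.J := by
  intro hk
  have := (hk p).2.2 hp
  omega

/-- `K` is closed downwards, so each of its indices is reached from `0` by unit steps inside `K`.
This reduces statements about `∂^μ` to single `∂_p`. -/
theorem K_induction {P : (Fin D.ℓ → ℕ) → Prop} (h0 : P 0)
    (h1 : ∀ μ p, μ + D.en p ∈ D.K → P μ → P (μ + D.en p)) : ∀ μ ∈ D.K, P μ := by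
  suffices H : ∀ n : ℕ, ∀ μ ∈ D.K, ∑ p, μ p = n → P μ from fun μ hμ => H _ μ hμ rfl
  intro n
  induction n with
  | zero =>
    intro μ _ h
    have : μ = 0 := by
      ext p
      exact (sum_eq_zero_iff.1 h) p (mem_univ p)
    rwa [this]
  | succ n ih =>
    intro μ hμ h
    have : ∃ p, μ p ≠ 0 := by
      by_contra! hc
      simp [hc] at h
    obtain ⟨p, hp⟩ := this
    have hle : D.en p ≤ μ := by
      intro q
      rcases eq_or_ne q p with rfl | hq
      · simpa using Nat.one_le_iff_ne_zero.2 hp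
      · simp [Pi.single_eq_of_ne hq]
    have he : μ - D.en p + D.en p = μ := tsub_add_cancel_of_le hle
    rw [← he]
    refine h1 _ p (he.symm ▸ hμ) (ih _ (K_of_le tsub_le_self hμ) ?_)
    have h2 : ∑ q, (μ - D.en p) q + ∑ q, D.en p q = n + 1 := by
      rw [← sum_add_distrib, ← h]
      exact sum_congr rfl fun q _ => congrFun he q
    simpa using h2

variable (D)

/-! ### Monomials -/

variable {D} in
theorem xmon_of_mem {α : D.Γ} {k : Fin D.ℓ → ℤ} (hk : k ∈ D.J) :
    D.xmon α k = Finsupp.single (α, ⟨k, hk⟩) 1 := dif_pos hk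

variable {D} in
theorem xmon_of_not_mem {α : D.Γ} {k : Fin D.ℓ → ℤ} (hk : k ∉ D.J) : D.xmon α k = 0 := dif_neg hk

variable {D} in
theorem mon_of_mem {α : D.Γ} {k : Fin D.ℓ → ℤ} {μ : Fin D.ℓ → ℕ} (hk : k ∈ D.J) (hμ : μ ∈ D.K) :
    D.mon α k μ = Finsupp.single (α, ⟨k, hk⟩, ⟨μ, hμ⟩) 1 := dif_pos ⟨hk, hμ⟩

variable {D} in
theorem mon_of_not_mem_J {α : D.Γ} {k : Fin D.ℓ → ℤ} {μ : Fin D.ℓ → ℕ} (hk : k ∉ D.J) :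
    D.mon α k μ = 0 := dif_neg fun h => hk h.1

variable {D} in
theorem mon_of_not_mem_K {α : D.Γ} {k : Fin D.ℓ → ℤ} {μ : Fin D.ℓ → ℕ} (hμ : μ ∉ D.K) :
    D.mon α k μ = 0 := dif_neg fun h => hμ h.2

theorem single_eq_mon (a : D.Idx) : (Finsupp.single a 1 : D.W) = D.mon a.1 a.2.1 a.2.2 :=
  (mon_of_mem a.2.1.2 a.2.2.2).symm

theorem single_eq_xmon (a : D.Γ × D.J) : (Finsupp.single a 1 : D.A) = D.xmon a.1 a.2 :=
  (xmon_of_mem a.2.2).symm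

variable {D} in
/-- Linear maps out of `𝒲` agree if they agree on the monomials. -/
theorem ext_mon {M : Type*} [AddCommGroup M] [Module F M] {f g : D.W →ₗ[F] M}
    (h : ∀ α, ∀ k ∈ D.J, ∀ μ ∈ D.K, f (D.mon α k μ) = g (D.mon α k μ)) : f = g := by
  refine Finsupp.lhom_ext' fun a => LinearMap.ext_ring ?_
  simpa [single_eq_mon] using h a.1 a.2.1 a.2.1.2 a.2.2 a.2.2.2

variable {D} in
theorem ext_xmon {M : Type*} [AddCommGroup M] [Module F M] {f g : D.A →ₗ[F] M}
    (h : ∀ α, ∀ k ∈ D.J, f (D.xmon α k) = g (D.xmon α k)) : f = g := by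
  refine Finsupp.lhom_ext' fun a => LinearMap.ext_ring ?_
  simpa [single_eq_xmon] using h a.1 a.2 a.2.2

theorem attach_xmon (α : D.Γ) (k : Fin D.ℓ → ℤ) (μ : Fin D.ℓ → ℕ) :
    D.attach μ (D.xmon α k) = D.mon α k μ := by
  by_cases hk : k ∈ D.J
  · rw [xmon_of_mem hk, attach, Finsupp.linearCombination_single, one_smul]
  · rw [xmon_of_not_mem hk, mon_of_not_mem_J hk, map_zero]

theorem attach_of_not_mem {μ : Fin D.ℓ → ℕ} (hμ : μ ∉ D.K) : D.attach μ = 0 :=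
  ext_xmon fun α k _ => by rw [attach_xmon, mon_of_not_mem_K hμ, LinearMap.zero_apply]

variable {D} in
theorem der_xmon {k : Fin D.ℓ → ℤ} (hk : k ∈ D.J) (p : Fin D.ℓ) (α : D.Γ) :
    D.der p (D.xmon α k) = α.1 p • D.xmon α k +
      (sgn F (D.below p k) * (k p : F)) • D.xmon α (k - D.e p) := by
  rw [xmon_of_mem hk, der, Finsupp.linearCombination_single, one_smul, xmon_of_mem hk]
  rfl

theorem gamma_odd (α : D.Γ) {p : Fin D.ℓ} (hp : D.ℓ'₄ ≤ p.val) : α.1 p = 0 :=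
  D.vanish α.1 α.2 p (Or.inr hp)

/-! ### The derivations -/

/-- For odd `p` and `q`, lowering the smaller coordinate removes an entry to the left of the larger
one, which flips exactly one of the two signs. For all other pairs no sign changes. -/
theorem der_comm {p q : Fin D.ℓ} (hpq : p ≠ q) :
    D.der p * D.der q = sgn F (D.odd p * D.odd q) • (D.der q * D.der p) := by
  refine ext_xmon fun α k hk => ?_
  have expand : ∀ p q : Fin D.ℓ, p ≠ q → D.der p (D.der q (D.xmon α k)) =
      (α.1 q * α.1 p) • D.xmon α k +
      (α.1 q * (sgn F (D.below p k) * (k p : F))) • D.xmon α (k - D.e p) +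
      ((sgn F (D.below q k) * (k q : F)) * α.1 p) • D.xmon α (k - D.e q) +
      ((sgn F (D.below q k) * (k q : F)) * (sgn F (D.below p (k - D.e q)) * (k p : F))) •
        D.xmon α (k - D.e q - D.e p) := by
    intro p q hpq
    rw [der_xmon hk, map_add, map_smul, map_smul, der_xmon hk]
    by_cases hq : k q = 0
    · simp [hq, smul_smul]
    · rw [der_xmon (sub_e_mem_J hk hq)]
      simp only [Pi.sub_apply, Pi.single_eq_of_ne hpq, sub_zero, smul_add, smul_smul]
      abel
  rw [Module.End.mul_apply, LinearMap.smul_apply, Module.End.mul_apply, expand p q hpq,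
    expand q p hpq.symm, sub_right_comm k (D.e q)]
  simp only [smul_add, smul_smul, below_sub, below_e, sgn_sub]
  rcases lt_or_ge p.val D.ℓ'₄ with hp | hp
  · rw [D.odd_of_lt hp, D.below_of_lt hp]
    have : ¬ q < p ∨ D.odd q = 0 := by
      by_cases h : q < p
      · exact Or.inr (D.odd_of_lt (lt_trans (Fin.lt_def.1 h) hp))
      · exact Or.inl h
    have h2 : (if q < p then D.odd q else 0) = 0 := by
      rcases this with h | h
      · rw [if_neg h]
      · rw [h, ite_self]
    have h3 : (if p < q then (0 : ℤ) else 0) = 0 := ite_self _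
    rw [h2, h3]
    simp only [zero_mul, sgn_zero, one_mul, mul_one]
    module
  rcases lt_or_ge q.val D.ℓ'₄ with hq | hq
  · rw [D.odd_of_lt hq, D.below_of_lt hq]
    have h2 : (if p < q then D.odd p else 0) = 0 :=
      if_neg fun h => by have := Fin.lt_def.1 h; omega
    have h3 : (if q < p then (0 : ℤ) else 0) = 0 := ite_self _
    rw [h2, h3]
    simp only [mul_zero, sgn_zero, one_mul, mul_one]
    module
  · rw [D.odd_of_le hp, D.odd_of_le hq, D.gamma_odd α hp, D.gamma_odd α hq]
    rcases lt_or_gt_of_ne hpq with h | h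
    · rw [if_pos h, if_neg (not_lt.2 h.le)]
      simp only [mul_one, sgn_zero, sgn_one]
      module
    · rw [if_pos h, if_neg (not_lt.2 h.le)]
      simp only [mul_one, sgn_zero, sgn_one]
      module

theorem der_sq {p : Fin D.ℓ} (hp : D.ℓ'₄ ≤ p.val) : D.der p * D.der p = 0 := by
  refine ext_xmon fun α k hk => ?_
  rw [Module.End.mul_apply, der_xmon hk, D.gamma_odd α hp, zero_smul, zero_add, map_smul,
    LinearMap.zero_apply]
  by_cases h : k p = 0
  · simp [h]
  · have h1 : k p = 1 := ((hk p).2.2 hp).resolve_left h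
    rw [der_xmon (sub_e_mem_J hk h), D.gamma_odd α hp]
    simp [h1]

/-- `∂_p` moves to its place in the ordered product and picks up signs from the odd factors on its
left. Since powers are only reordered, `lam` may lie outside `K`. -/
theorem der_derPow (p : Fin D.ℓ) (lam : Fin D.ℓ → ℕ) :
    D.der p * D.derPow lam =
      sgn F (D.below p (D.cz lam)) • D.derPow (lam + D.en p) := by
  have h := mul_prod_ofFn (F := F) D.der (fun p q => D.odd p * D.odd q)
    (fun p q h => D.der_comm h.ne') lam p
  have hs : ∑ r with r < p, D.odd p * D.odd r * (lam r : ℤ) = D.below p (D.cz lam) := by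
    have h1 : ∑ r with r < p, D.odd p * D.odd r * (lam r : ℤ) =
        D.odd p * D.below p (D.cz lam) := by
      rw [below, mul_sum, filter_filter, sum_filter, sum_filter]
      refine sum_congr rfl fun r _ => ?_
      simp only [odd, cz]
      split_ifs <;> simp_all
    rw [h1, odd_mul_below]
  rw [hs] at h
  exact h

end WeylData

end WeylSuper

end

/-! ### The generators as operators on `𝒲` and their commutation relations -/

noncomputable section

namespace WeylSuper

open Finset

namespace WeylData

variable {F : Type*} [Field F] (D : WeylData F)

/-! ### Left multiplication by generators -/

/-- Left multiplication by `x^{α,k}`. -/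
def leftX (α : D.Γ) (k : Fin D.ℓ → ℤ) : Module.End F D.W :=
  Finsupp.linearCombination F fun b =>
    sgn F (D.pair k b.2.1.1) • D.mon (α + b.1) (k + b.2.1.1) b.2.2.1

/-- Left multiplication by `∂_p`. -/
def leftD (p : Fin D.ℓ) : Module.End F D.W :=
  Finsupp.linearCombination F fun b =>
    D.attach b.2.2.1 (D.der p (D.xmon b.1 b.2.1.1)) +
      sgn F (D.odd p * D.deg b.2.1.1 + D.below p (D.cz b.2.2.1)) •
        D.mon b.1 b.2.1.1 (b.2.2.1 + D.en p)

/-- Left multiplication by `∂^μ`. -/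
def leftPow (μ : Fin D.ℓ → ℕ) : Module.End F D.W :=
  Finsupp.linearCombination F fun b =>
    ∑ lam ∈ Iic μ, (∏ p, ((μ p).choose (lam p) : F)) •
      D.attach (μ - lam + b.2.2.1)
        (sgn F (D.signExp (D.deg b.2.1.1) (μ - lam) lam b.2.2.1) •
          D.derPow lam (D.xmon b.1 b.2.1.1))

/-- The elements of `𝒜` of given degree in the odd variables. -/
def homA (g : ℤ) : Submodule F D.A := Finsupp.supported F F {a | D.deg a.2.1 = g}

/-- In this form the exponent consists of additive and biadditive pieces, which expand under the
addition lemmas for `deg` and `pair`. -/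
theorem signExp_eq (g : ℤ) (d lam ν : Fin D.ℓ → ℕ) :
    D.signExp g d lam ν = g * D.deg (D.cz d) + D.pair (D.cz d) (D.cz ν) +
      D.pair (D.cz lam) (D.cz d) := by
  rw [signExp, deg, pair, pair, add_assoc, ← sum_add_distrib]
  congr 2
  ext r
  simp only [cz]
  ring

variable {D}

theorem xmon_mem_homA (α : D.Γ) (k : Fin D.ℓ → ℤ) : D.xmon α k ∈ D.homA (D.deg k) := by
  by_cases hk : k ∈ D.J
  · rw [xmon_of_mem hk]
    exact Finsupp.single_mem_supported F 1 rfl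
  · rw [xmon_of_not_mem hk]
    exact zero_mem _

theorem der_mem_homA {g : ℤ} {v : D.A} (hv : v ∈ D.homA g) (p : Fin D.ℓ) :
    D.der p v ∈ D.homA (g - D.odd p) := by
  refine lc_mem (S := {a : D.Γ × D.J | D.deg a.2.1 = g}) (fun a ha => ?_) hv
  replace ha : D.deg a.2.1 = g := ha
  refine add_mem ?_ (Submodule.smul_mem _ _ ?_)
  · rcases lt_or_ge p.val D.ℓ'₄ with hp | hp
    · refine Submodule.smul_mem _ _ ?_
      have := xmon_mem_homA a.1 a.2.1
      rw [D.odd_of_lt hp, sub_zero]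
      rwa [ha] at this
    · rw [D.gamma_odd a.1 hp, zero_smul]
      exact zero_mem _
  · have := xmon_mem_homA a.1 (a.2.1 - D.e p)
    rwa [deg_sub, deg_e, ha] at this

theorem derPow_mem_homA {g : ℤ} {v : D.A} (hv : v ∈ D.homA g) (lam : Fin D.ℓ → ℕ) :
    D.derPow lam v ∈ D.homA (g - D.deg (D.cz lam)) := by
  -- `lam` need not lie in `K`, so the induction is on its total order instead of `K_induction`.
  suffices H : ∀ n : ℕ, ∀ lam : Fin D.ℓ → ℕ, ∑ p, lam p = n →
      D.derPow lam v ∈ D.homA (g - D.deg (D.cz lam)) from H _ lam rfl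
  intro n
  induction n with
  | zero =>
    intro lam h
    have : lam = 0 := by
      ext p
      exact (sum_eq_zero_iff.1 h) p (mem_univ p)
    subst this
    simpa [derPow, cz_zero, deg_zero] using hv
  | succ n ih =>
    intro lam h
    have : ∃ p, lam p ≠ 0 := by
      by_contra! hc
      simp [hc] at h
    obtain ⟨p, hp⟩ := this
    have hle : D.en p ≤ lam := by
      intro q
      rcases eq_or_ne q p with rfl | hq
      · simpa using Nat.one_le_iff_ne_zero.2 hp
      · simp [Pi.single_eq_of_ne hq]
    obtain ⟨m, rfl⟩ : ∃ m, lam = m + D.en p := ⟨lam - D.en p, (tsub_add_cancel_of_le hle).symm⟩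
    have hm : ∑ q, m q = n := by
      simpa [sum_add_distrib] using h
    have h1 := der_mem_homA (ih m hm) p
    rw [← Module.End.mul_apply, der_derPow, LinearMap.smul_apply] at h1
    have h2 := Submodule.smul_mem _ (sgn F (D.below p (D.cz m))) h1
    rw [smul_smul, sgn_mul_self, one_smul] at h2
    rwa [cz_add, cz_en, deg_add, deg_e, ← sub_sub]

/-- The hypothesis covers `l ∉ J`: the left side is then zero, and the formula holds only if the
right side vanishes too. -/
theorem leftX_mon {α : D.Γ} {k : Fin D.ℓ → ℤ} (β : D.Γ) {l : Fin D.ℓ → ℤ}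
    (h : l ∉ D.J → k + l ∉ D.J) (ν : Fin D.ℓ → ℕ) :
    D.leftX α k (D.mon β l ν) = sgn F (D.pair k l) • D.mon (α + β) (k + l) ν := by
  by_cases hl : l ∈ D.J
  · by_cases hν : ν ∈ D.K
    · rw [mon_of_mem hl hν, leftX, Finsupp.linearCombination_single, one_smul]
    · rw [mon_of_not_mem_K hν, mon_of_not_mem_K hν, map_zero, smul_zero]
  · rw [mon_of_not_mem_J hl, mon_of_not_mem_J (h hl), map_zero, smul_zero]

/-- The sign depends only on the degree of the left factor, so the formula passes from monomials to
homogeneous `v`. It is needed for `v = ∂^lam(x^{α,k})`, which is not a monomial. -/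
theorem leftD_attach {g : ℤ} {v : D.A} (hv : v ∈ D.homA g) (p : Fin D.ℓ) (ν : Fin D.ℓ → ℕ) :
    D.leftD p (D.attach ν v) = D.attach ν (D.der p v) +
      sgn F (D.odd p * g + D.below p (D.cz ν)) • D.attach (ν + D.en p) v := by
  rw [homA, Finsupp.supported_eq_span_single] at hv
  induction hv using Submodule.span_induction with
  | mem x hx =>
    obtain ⟨a, ha : D.deg a.2.1 = g, rfl⟩ := hx
    beta_reduce
    rw [single_eq_xmon, attach_xmon, attach_xmon]
    by_cases hν : ν ∈ D.K
    · rw [mon_of_mem a.2.2 hν, leftD, Finsupp.linearCombination_single, one_smul]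
      simp only [ha]
    · have : ν + D.en p ∉ D.K := fun h => hν (K_of_le le_self_add h)
      rw [mon_of_not_mem_K hν, mon_of_not_mem_K this, attach_of_not_mem D hν]
      simp
  | zero => simp
  | add x y _ _ hx hy =>
    simp only [map_add, hx, hy, smul_add]
    abel
  | smul c x _ hx =>
    simp only [map_smul, hx, smul_add]
    rw [smul_comm c]

theorem leftD_mon {k : Fin D.ℓ → ℤ} (hk : k ∈ D.J) (p : Fin D.ℓ) (α : D.Γ) (ν : Fin D.ℓ → ℕ) :
    D.leftD p (D.mon α k ν) = α.1 p • D.mon α k ν +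
      (sgn F (D.below p k) * (k p : F)) • D.mon α (k - D.e p) ν +
      sgn F (D.odd p * D.deg k + D.below p (D.cz ν)) • D.mon α k (ν + D.en p) := by
  rw [← attach_xmon, leftD_attach (xmon_mem_homA α k), der_xmon hk, map_add, map_smul, map_smul]
  simp only [attach_xmon]

theorem leftPow_mon {k : Fin D.ℓ → ℤ} (hk : k ∈ D.J) (α : D.Γ) (μ : Fin D.ℓ → ℕ)
    {ν : Fin D.ℓ → ℕ} (hν : ν ∈ D.K) :
    D.leftPow μ (D.mon α k ν) = ∑ lam ∈ Iic μ, (∏ p, ((μ p).choose (lam p) : F)) •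
      D.attach (μ - lam + ν)
        (sgn F (D.signExp (D.deg k) (μ - lam) lam ν) • D.derPow lam (D.xmon α k)) := by
  rw [mon_of_mem hk hν, leftPow, Finsupp.linearCombination_single, one_smul]

theorem leftPow_zero : D.leftPow 0 = 1 := by
  refine ext_mon fun α k hk ν hν => ?_
  rw [leftPow_mon hk _ _ hν]
  have : Iic (0 : Fin D.ℓ → ℕ) = {0} := by
    ext x
    rw [mem_Iic, mem_singleton]
    exact nonpos_iff_eq_zero
  rw [this, sum_singleton, signExp_eq]
  simp [cz_zero, deg_zero, pair_zero_left, derPow, attach_xmon]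

/-- `leftD p` either differentiates or raises the `∂`-exponent, and these are the two alternatives
in `sum_Iic_add_single`. It remains to compare signs term by term. -/
theorem leftD_mul_leftPow {μ : Fin D.ℓ → ℕ} {p : Fin D.ℓ} (h : μ + D.en p ∈ D.K) :
    D.leftD p * D.leftPow μ = sgn F (D.below p (D.cz μ)) • D.leftPow (μ + D.en p) := by
  refine ext_mon fun α k hk ν hν => ?_
  rw [Module.End.mul_apply, LinearMap.smul_apply, leftPow_mon hk _ _ hν, leftPow_mon hk _ _ hν,
    map_sum, sum_Iic_add_single (fun lam d => D.attach (d + ν)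
        (sgn F (D.signExp (D.deg k) d lam ν) • D.derPow lam (D.xmon α k))) μ p, smul_sum]
  refine sum_congr rfl fun lam hlam => ?_
  rw [mem_Iic] at hlam
  rw [map_smul, smul_comm]
  congr 1
  obtain ⟨d, rfl⟩ : ∃ d, μ = lam + d := ⟨μ - lam, (add_tsub_cancel_of_le hlam).symm⟩
  rw [add_tsub_cancel_left]
  -- Membership of `μ + 1_p` in `K` forces `lam p = 0` for odd `p`. Otherwise the terms with raised
  -- exponent would carry an extra `(-1)^{lam p}`.
  have hodd : D.odd p * (lam p : ℤ) = 0 := by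
    rcases lt_or_ge p.val D.ℓ'₄ with hp | hp
    · rw [D.odd_of_lt hp, zero_mul]
    · have := h p hp
      simp only [Pi.add_apply, Pi.single_eq_same] at this
      have : lam p = 0 := by omega
      rw [this, Nat.cast_zero, mul_zero]
  have hdeg := D.odd_mul_deg p (D.cz lam)
  rw [leftD_attach (Submodule.smul_mem _ _ (derPow_mem_homA (xmon_mem_homA α k) lam)), map_smul,
    ← Module.End.mul_apply, der_derPow, smul_add]
  congr 1
  · simp only [map_smul, LinearMap.smul_apply, smul_smul, ← sgn_add]
    congr 1
    simp only [signExp_eq, cz_add, cz_en, below_add, pair_add_left, pair_e_left]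
    exact sgn_congr (-D.below p (D.cz d)) (by ring)
  · rw [show d + D.en p + ν = d + ν + D.en p by abel]
    simp only [map_smul, smul_smul, ← sgn_add]
    congr 1
    simp only [signExp_eq, cz_add, cz_en, below_add, pair_add_left, pair_add_right, pair_e_left,
      pair_e_right, deg_add, deg_e]
    change D.odd p * D.cz lam p = 0 at hodd
    rw [hodd] at hdeg
    refine sgn_congr (-D.below p (D.cz lam) - D.above p (D.cz lam)) ?_
    linear_combination -hdeg

/-- The two cross terms cancel, because `der p` lowers the degree by one and so flips the sign with
which `∂_p` passes. -/
theorem leftD_sq {p : Fin D.ℓ} (hp : D.ℓ'₄ ≤ p.val) : D.leftD p * D.leftD p = 0 := by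
  refine ext_mon fun α k hk ν hν => ?_
  have h0 : ν + D.en p + D.en p ∉ D.K := fun h => by
    have := h p hp
    simp at this
  rw [Module.End.mul_apply, ← attach_xmon, leftD_attach (xmon_mem_homA α k), map_add, map_smul,
    leftD_attach (xmon_mem_homA α k), leftD_attach (der_mem_homA (xmon_mem_homA α k) p),
    ← Module.End.mul_apply (D.der p), der_sq D hp, attach_of_not_mem D h0, D.odd_of_le hp,
    show 1 * (D.deg k - 1) + D.below p (D.cz ν) = 1 * D.deg k + D.below p (D.cz ν) - 1 by ring,
    sgn_sub]
  simp

/-- Leaving `K` means that `p` is odd and `μ p = 1`, so a factor `∂_p` can be pulled out of `∂^μ`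
and meets the other one. -/
theorem leftD_mul_leftPow_eq_zero {μ : Fin D.ℓ → ℕ} {p : Fin D.ℓ} (hμ : μ ∈ D.K)
    (h : μ + D.en p ∉ D.K) : D.leftD p * D.leftPow μ = 0 := by
  have hp : D.ℓ'₄ ≤ p.val ∧ μ p = 1 := by
    by_contra hc
    refine h fun q hq => ?_
    have := hμ q hq
    rcases eq_or_ne q p with rfl | hqp
    · have : μ q ≠ 1 := fun h' => hc ⟨hq, h'⟩
      simp only [Pi.add_apply, Pi.single_eq_same]
      omega
    · simpa [Pi.single_eq_of_ne hqp] using this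
  obtain ⟨m, rfl⟩ : ∃ m, μ = m + D.en p := ⟨μ - D.en p, by
    refine (tsub_add_cancel_of_le fun q => ?_).symm
    rcases eq_or_ne q p with rfl | hq
    · simp [hp.2]
    · simp [Pi.single_eq_of_ne hq]⟩
  have h1 : D.leftPow (m + D.en p) =
      sgn F (D.below p (D.cz m)) • (D.leftD p * D.leftPow m) := by
    rw [leftD_mul_leftPow hμ, smul_smul, sgn_mul_self, one_smul]
  rw [h1, mul_smul_comm, ← mul_assoc, leftD_sq hp.1, zero_mul, smul_zero]

open Classical in
theorem leftX_mul_leftX {k l : Fin D.ℓ → ℤ} (hk : k ∈ D.J) (hl : l ∈ D.J) (α β : D.Γ) :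
    D.leftX α k * D.leftX β l =
      if k + l ∈ D.J then sgn F (D.pair k l) • D.leftX (α + β) (k + l) else 0 := by
  refine ext_mon fun γ m hm ν _ => ?_
  rw [Module.End.mul_apply, leftX_mon γ (fun h => absurd hm h), map_smul,
    leftX_mon _ (add_add_not_mem_J hk hl hm), smul_smul, ← sgn_add, ← add_assoc, ← add_assoc]
  split_ifs with h
  · rw [LinearMap.smul_apply, leftX_mon _ (fun h => absurd hm h), smul_smul, ← sgn_add,
      pair_add_right, pair_add_left]
    congr 2
    ring
  · rw [mon_of_not_mem_J, smul_zero, LinearMap.zero_apply]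
    have := add_add_not_mem_J hm hk hl h
    rwa [add_comm] at this

theorem leftD_mul_leftX {k : Fin D.ℓ → ℤ} (hk : k ∈ D.J) (p : Fin D.ℓ) (α : D.Γ) :
    D.leftD p * D.leftX α k = α.1 p • D.leftX α k +
      (sgn F (D.below p k) * (k p : F)) • D.leftX α (k - D.e p) +
      sgn F (D.odd p * D.deg k) • (D.leftX α k * D.leftD p) := by
  refine ext_mon fun β l hl ν hν => ?_
  simp only [Module.End.mul_apply, LinearMap.add_apply, LinearMap.smul_apply]
  rw [leftX_mon β (fun h => absurd hl h), leftD_mon hl, map_smul, map_add, map_add, map_smul,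
    map_smul, map_smul, leftX_mon β (fun h => absurd hl h), leftX_mon β (fun h => absurd hl h),
    leftX_mon β (fun h => absurd hl h)]
  have e1 : (l p : F) • D.leftX α k (D.mon β (l - D.e p) ν) =
      (l p : F) • sgn F (D.pair k (l - D.e p)) • D.mon (α + β) (k + l - D.e p) ν := by
    by_cases h : l p = 0
    · simp [h]
    · rw [leftX_mon β (fun h' => absurd (sub_e_mem_J hl h) h'), add_sub_assoc]
  rw [mul_smul _ (l p : F), e1, show k - D.e p + l = k + l - D.e p by abel]
  have hdk := D.odd_mul_deg p k
  by_cases hkl : k + l ∈ D.J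
  · rw [leftD_mon hkl]
    simp only [smul_add, smul_smul, pair_sub_left, pair_sub_right, pair_e_left, pair_e_right,
      below_add, deg_add]
    -- For odd `p`, `l p ≠ 0` excludes `k p = 1` because `k + l ∈ J`. So the sign `(-1)^{k_p}` is
    -- invisible next to the factor `l p`.
    have hpp : (l p : F) * sgn F (D.odd p * k p) = l p := by
      rcases lt_or_ge p.val D.ℓ'₄ with hp | hp
      · rw [D.odd_of_lt hp, zero_mul, sgn_zero, mul_one]
      · have h1 := (hkl p).2.2 hp
        have h2 := (hk p).2.2 hp
        have h3 := (hl p).2.2 hp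
        simp only [Pi.add_apply] at h1
        rcases h3 with h3 | h3
        · simp [h3]
        · have : k p = 0 := by omega
          simp [this]
    have s1 : sgn F (D.odd p * D.deg k) * (sgn F (D.below p l) *
        ((l p : F) * sgn F (D.pair k l - D.above p k))) =
        sgn F (D.pair k l + D.below p k + D.below p l) * l p := by
      have : sgn F (D.odd p * D.deg k + D.below p l + (D.pair k l - D.above p k)) =
          sgn F (D.pair k l + D.below p k + D.below p l) * sgn F (D.odd p * k p) := by
        rw [← sgn_add, hdk]
        congr 1
        ring
      rw [sgn_add, sgn_add] at this
      linear_combination (l p : F) * this + sgn F (D.pair k l + D.below p k + D.below p l) * hpp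
    have s2 : sgn F (D.odd p * D.deg k) * (sgn F (D.odd p * D.deg l + D.below p (D.cz ν)) *
        sgn F (D.pair k l)) = sgn F (D.pair k l) *
          sgn F (D.odd p * (D.deg k + D.deg l) + D.below p (D.cz ν)) := by
      simp only [← sgn_add]
      congr 1
      ring
    have s3 : sgn F (D.below p k) * (k p : F) * sgn F (D.pair k l - D.below p l) =
        sgn F (D.pair k l + D.below p k + D.below p l) * k p := by
      rw [sgn_sub, sgn_add, sgn_add]
      ring
    have s4 : sgn F (D.pair k l) * (sgn F (D.below p k + D.below p l) * ((k + l) p : ℤ)) =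
        sgn F (D.pair k l + D.below p k + D.below p l) * k p +
        sgn F (D.pair k l + D.below p k + D.below p l) * l p := by
      simp only [sgn_add, Pi.add_apply, Int.cast_add]
      ring
    have s5 : sgn F (D.odd p * D.deg k) * (β.1 p * sgn F (D.pair k l)) =
        β.1 p * sgn F (D.pair k l) := by
      rcases lt_or_ge p.val D.ℓ'₄ with hp | hp
      · rw [D.odd_of_lt hp, zero_mul, sgn_zero, one_mul]
      · rw [D.gamma_odd β hp]
        ring
    rw [s1, s2, s3, s4, s5, show (α + β).1 p = α.1 p + β.1 p from rfl]
    module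
  · rw [mon_of_not_mem_J hkl, mon_of_not_mem_J hkl]
    simp only [smul_zero, map_zero, zero_add, add_zero]
    -- An odd `q` has entry `1` in both `k` and `l`. If `q = p`, the two remaining terms cancel; if
    -- `q ≠ p`, the entry `2` persists and every term is zero.
    obtain ⟨q, hq, h1, h2⟩ := add_not_mem_J hk hl hkl
    rcases eq_or_ne q p with rfl | hqp
    · simp only [smul_smul, pair_sub_left, pair_sub_right, pair_e_left, pair_e_right]
      rw [← add_smul]
      symm
      convert zero_smul F _ using 2
      rw [h1, h2, Int.cast_one, mul_one, one_mul]
      simp only [← sgn_add]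
      rw [hdk, D.odd_of_le hq, h1]
      have : sgn F (D.below q k + 1 * 1 + D.above q k + (D.below q l + (D.pair k l - D.above q k))) =
        sgn F ((D.below q k + (D.pair k l - D.below q l)) + 1) :=
          sgn_congr (D.below q l) (by ring)
      rw [this, sgn_add _ 1, sgn_one]
      ring
    · rw [mon_of_not_mem_J]
      · simp
      · refine not_mem_J_of_two_le hq ?_
        simp [h1, h2, Pi.single_eq_of_ne hqp]

end WeylData

end WeylSuper

end

/-! ### Associativity of `𝒲` -/

noncomputable section

namespace WeylSuper

open Finset

namespace WeylData

variable {F : Type*} [Field F] {D : WeylData F}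

/-! ### The associative algebra -/

theorem attach_mulA {k : Fin D.ℓ → ℤ} (hk : k ∈ D.J) (α : D.Γ) (ν : Fin D.ℓ → ℕ) (v : D.A) :
    D.attach ν (D.mulA (D.xmon α k) v) = D.leftX α k (D.attach ν v) := by
  suffices H : D.attach ν ∘ₗ D.mulA (D.xmon α k) = D.leftX α k ∘ₗ D.attach ν from
    LinearMap.congr_fun H v
  refine ext_xmon fun β l hl => ?_
  rw [LinearMap.comp_apply, LinearMap.comp_apply, attach_xmon,
    leftX_mon β (fun h => absurd hl h), xmon_of_mem hk, xmon_of_mem hl, mulA,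
    Finsupp.linearCombination_single, one_smul, Finsupp.linearCombination_single, one_smul,
    map_smul, attach_xmon]
  rfl

/-- Left multiplication by a basis element is a composition of generator operators. Associativity
then only requires that each of these commutes with right multiplications. -/
theorem mul_mon {k : Fin D.ℓ → ℤ} (hk : k ∈ D.J) {μ : Fin D.ℓ → ℕ} (hμ : μ ∈ D.K) (α : D.Γ) :
    D.mul (D.mon α k μ) = D.leftX α k * D.leftPow μ := by
  refine ext_mon fun β l hl ν hν => ?_
  rw [Module.End.mul_apply, leftPow_mon hl _ _ hν, map_sum, mon_of_mem hk hμ, mon_of_mem hl hν,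
    mul, Finsupp.linearCombination_single, one_smul, Finsupp.linearCombination_single, one_smul]
  refine sum_congr rfl fun lam _ => ?_
  rw [map_smul, ← attach_mulA hk, map_smul, map_smul, smul_smul, mul_comm]
  rfl

theorem leftX_mul {k : Fin D.ℓ → ℤ} (hk : k ∈ D.J) (α : D.Γ) (v w : D.W) :
    D.mul (D.leftX α k v) w = D.leftX α k (D.mul v w) := by
  suffices H : D.mul.flip w ∘ₗ D.leftX α k = D.leftX α k ∘ₗ D.mul.flip w from
    LinearMap.congr_fun H v
  refine ext_mon fun β l hl ν hν => ?_
  simp only [LinearMap.comp_apply, LinearMap.flip_apply]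
  have h := leftX_mul_leftX hk hl α β
  rw [leftX_mon β (fun h => absurd hl h), mul_mon hl hν, Module.End.mul_apply,
    ← Module.End.mul_apply (D.leftX α k), h, map_smul, LinearMap.smul_apply]
  split_ifs with hkl
  · rw [mul_mon hkl hν, LinearMap.smul_apply, Module.End.mul_apply]
  · rw [mon_of_not_mem_J hkl]
    simp

/-- `leftD_mul_leftX` moves `∂_p` past `x^{β,l}`; what is left is `∂_p ∂^ν`, which is again a basis
element up to sign, or zero. -/
theorem leftD_mul (p : Fin D.ℓ) (v w : D.W) :
    D.mul (D.leftD p v) w = D.leftD p (D.mul v w) := by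
  suffices H : D.mul.flip w ∘ₗ D.leftD p = D.leftD p ∘ₗ D.mul.flip w from
    LinearMap.congr_fun H v
  refine ext_mon fun β l hl ν hν => ?_
  simp only [LinearMap.comp_apply, LinearMap.flip_apply]
  have h := LinearMap.congr_fun (leftD_mul_leftX hl p β) (D.leftPow ν w)
  rw [leftD_mon hl, mul_mon hl hν, Module.End.mul_apply, ← Module.End.mul_apply (D.leftD p), h]
  simp only [map_add, map_smul, LinearMap.add_apply, LinearMap.smul_apply, mul_mon hl hν,
    Module.End.mul_apply]
  congr 1
  · congr 1
    by_cases h0 : l p = 0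
    · simp [h0]
    · rw [mul_mon (sub_e_mem_J hl h0) hν, Module.End.mul_apply]
  · rw [← Module.End.mul_apply (D.leftD p)]
    by_cases hp : ν + D.en p ∈ D.K
    · rw [leftD_mul_leftPow hp, mul_mon hl hp, LinearMap.smul_apply, map_smul, smul_smul,
        ← sgn_add, Module.End.mul_apply]
    · rw [leftD_mul_leftPow_eq_zero hν hp, mon_of_not_mem_K hp]
      simp

theorem leftPow_mul {μ : Fin D.ℓ → ℕ} (hμ : μ ∈ D.K) :
    ∀ v w : D.W, D.mul (D.leftPow μ v) w = D.leftPow μ (D.mul v w) := by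
  refine K_induction (P := fun μ => ∀ v w : D.W, D.mul (D.leftPow μ v) w = D.leftPow μ (D.mul v w))
    ?_ (fun μ p h ih v w => ?_) μ hμ
  · simp [leftPow_zero]
  · have h1 : D.leftPow (μ + D.en p) =
        sgn F (D.below p (D.cz μ)) • (D.leftD p * D.leftPow μ) := by
      rw [leftD_mul_leftPow h, smul_smul, sgn_mul_self, one_smul]
    rw [h1]
    simp only [LinearMap.smul_apply, Module.End.mul_apply, map_smul, leftD_mul, ih]

theorem mul_assoc' (u v w : D.W) : D.mul (D.mul u v) w = D.mul u (D.mul v w) := by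
  suffices H : (D.mul.flip w) ∘ₗ D.mul.flip v = D.mul.flip (D.mul v w) from
    LinearMap.congr_fun H u
  refine ext_mon fun α k hk μ hμ => ?_
  simp only [LinearMap.comp_apply, LinearMap.flip_apply]
  rw [mul_mon hk hμ, Module.End.mul_apply, leftX_mul hk, leftPow_mul hμ, Module.End.mul_apply]

theorem leftX_zero : D.leftX 0 0 = 1 := by
  refine ext_mon fun β l hl ν _ => ?_
  rw [leftX_mon β (fun h => absurd hl h), pair_zero_left, sgn_zero, one_smul, zero_add, zero_add]
  rfl

theorem leftPow_one {μ : Fin D.ℓ → ℕ} (hμ : μ ∈ D.K) :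
    D.leftPow μ (D.mon 0 0 0) = D.mon 0 0 μ := by
  refine K_induction (P := fun μ => D.leftPow μ (D.mon 0 0 0) = D.mon 0 0 μ)
    ?_ (fun μ p h ih => ?_) μ hμ
  · simp [leftPow_zero]
  · have h1 : D.leftPow (μ + D.en p) =
        sgn F (D.below p (D.cz μ)) • (D.leftD p * D.leftPow μ) := by
      rw [leftD_mul_leftPow h, smul_smul, sgn_mul_self, one_smul]
    rw [h1, LinearMap.smul_apply, Module.End.mul_apply, ih, leftD_mon zero_mem_J]
    simp [deg_zero, smul_smul]

theorem one_mul' (v : D.W) : D.mul (D.mon 0 0 0) v = v := by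
  rw [mul_mon zero_mem_J zero_mem_K, leftX_zero, leftPow_zero]
  rfl

theorem mul_one' (v : D.W) : D.mul v (D.mon 0 0 0) = v := by
  suffices H : D.mul.flip (D.mon 0 0 0) = LinearMap.id from LinearMap.congr_fun H v
  refine ext_mon fun α k hk μ hμ => ?_
  rw [LinearMap.flip_apply, mul_mon hk hμ, Module.End.mul_apply, leftPow_one hμ,
    leftX_mon _ (fun h => absurd zero_mem_J h), pair_zero_right]
  simp

variable (D) in
/-- The space `𝒲` regarded as an associative algebra. -/
def R : Type _ := D.W

instance : AddCommGroup D.R := Finsupp.instAddCommGroup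

instance : Module F D.R := Finsupp.module _ _

instance : Ring D.R where
  __ := (inferInstance : AddCommGroup D.R)
  mul u v := D.mul u v
  one := D.mon 0 0 0
  left_distrib u v w := map_add (D.mul u) v w
  right_distrib u v w := LinearMap.map_add₂ D.mul u v w
  zero_mul v := LinearMap.map_zero₂ D.mul v
  mul_zero u := map_zero (D.mul u)
  mul_assoc := mul_assoc'
  one_mul := one_mul'
  mul_one := mul_one'

instance : Algebra F D.R :=
  Algebra.ofModule (fun r u v => LinearMap.map_smul₂ D.mul r u v)
    (fun r u v => map_smul (D.mul u) r v)

theorem mul_def (u v : D.R) : u * v = (D.mul u v : D.W) := rfl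

/-- The monomial `x^{α,k} ∂^μ` in the algebra. -/
def m (α : D.Γ) (k : Fin D.ℓ → ℤ) (μ : Fin D.ℓ → ℕ) : D.R := D.mon α k μ

/-- The element `x^{α,k}`. -/
def x (α : D.Γ) (k : Fin D.ℓ → ℤ) : D.R := m α k 0

variable (D) in
/-- The element `∂_p`. -/
def d (p : Fin D.ℓ) : D.R := m 0 0 (D.en p)

theorem x_zero : x 0 0 = (1 : D.R) := rfl

theorem en_mem_K (p : Fin D.ℓ) : D.en p ∈ D.K := fun q _ => by
  rcases eq_or_ne q p with rfl | hq
  · simp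
  · simp [Pi.single_eq_of_ne hq]

theorem x_mul {k : Fin D.ℓ → ℤ} (hk : k ∈ D.J) (α : D.Γ) (v : D.R) :
    x α k * v = (D.leftX α k v : D.W) := by
  rw [mul_def, x, m, mul_mon hk zero_mem_K, leftPow_zero, mul_one]

theorem leftPow_en (p : Fin D.ℓ) : D.leftPow (D.en p) = D.leftD p := by
  have h := leftD_mul_leftPow (D := D) (μ := 0) (p := p) (by simpa using en_mem_K p)
  rw [leftPow_zero, mul_one, zero_add, cz_zero, below_zero, sgn_zero, one_smul] at h
  exact h.symm

theorem d_mul (p : Fin D.ℓ) (v : D.R) : D.d p * v = (D.leftD p v : D.W) := by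
  rw [mul_def, d, m, mul_mon zero_mem_J (en_mem_K p), leftX_zero, one_mul, leftPow_en]

theorem x_mul_m {k l : Fin D.ℓ → ℤ} (hk : k ∈ D.J) (hl : l ∈ D.J) (α β : D.Γ)
    (ν : Fin D.ℓ → ℕ) : x α k * m β l ν = sgn F (D.pair k l) • m (α + β) (k + l) ν := by
  rw [x_mul hk]
  exact leftX_mon β (fun h => absurd hl h) ν

theorem x_mul_x {k l : Fin D.ℓ → ℤ} (hk : k ∈ D.J) (hl : l ∈ D.J) (α β : D.Γ) :
    x α k * x β l = sgn F (D.pair k l) • x (α + β) (k + l) := x_mul_m hk hl α β 0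

theorem x_mul_dm {k : Fin D.ℓ → ℤ} (hk : k ∈ D.J) (α : D.Γ) (ν : Fin D.ℓ → ℕ) :
    x α k * m 0 0 ν = m α k ν := by
  rw [x_mul_m hk zero_mem_J, pair_zero_right, sgn_zero, one_smul, add_zero, add_zero]

theorem d_mul_m {k : Fin D.ℓ → ℤ} (hk : k ∈ D.J) (p : Fin D.ℓ) (α : D.Γ) (ν : Fin D.ℓ → ℕ) :
    D.d p * m α k ν = α.1 p • m α k ν +
      (sgn F (D.below p k) * (k p : F)) • m α (k - D.e p) ν +
      sgn F (D.odd p * D.deg k + D.below p (D.cz ν)) • m α k (ν + D.en p) := by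
  rw [d_mul]
  exact leftD_mon hk p α ν

theorem d_mul_x {k : Fin D.ℓ → ℤ} (hk : k ∈ D.J) (p : Fin D.ℓ) (α : D.Γ) :
    D.d p * x α k = α.1 p • x α k + (sgn F (D.below p k) * (k p : F)) • x α (k - D.e p) +
      sgn F (D.odd p * D.deg k) • (x α k * D.d p) := by
  rw [x, d_mul_m hk, cz_zero, below_zero, add_zero, zero_add, d, ← x, x_mul_dm hk]
  rfl

theorem d_mul_dm (p : Fin D.ℓ) (ν : Fin D.ℓ → ℕ) :
    D.d p * m 0 0 ν = sgn F (D.below p (D.cz ν)) • m 0 0 (ν + D.en p) := by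
  rw [d_mul_m zero_mem_J, deg_zero, mul_zero, zero_add]
  simp

/-- The odd coordinates come last, so if the smaller of two coordinates is odd, both are. -/
theorem below_e_add_below_e {p q : Fin D.ℓ} (hpq : p ≠ q) :
    D.below p (D.e q) + D.below q (D.e p) = D.odd p * D.odd q := by
  have h : ∀ p q : Fin D.ℓ, p < q → D.odd p = D.odd p * D.odd q := fun p q h => by
    rcases lt_or_ge p.val D.ℓ'₄ with hp | hp
    · rw [D.odd_of_lt hp, zero_mul]
    · rw [D.odd_of_le (hp.trans (Fin.lt_def.1 h).le), mul_one]
  rw [below_e, below_e]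
  rcases lt_or_gt_of_ne hpq with h' | h'
  · rw [if_neg (not_lt.2 h'.le), if_pos h', zero_add]
    exact h p q h'
  · rw [if_pos h', if_neg (not_lt.2 h'.le), add_zero, mul_comm]
    exact h q p h'

theorem d_mul_d {p q : Fin D.ℓ} (hpq : p ≠ q) :
    D.d p * D.d q = sgn F (D.odd p * D.odd q) • (D.d q * D.d p) := by
  have h : ∀ p q : Fin D.ℓ, D.d p * D.d q =
      sgn F (D.below p (D.e q)) • m 0 0 (D.en q + D.en p) := fun p q => by
    rw [← cz_en, ← d_mul_dm]
    rfl
  rw [h, h, smul_smul, ← sgn_add, ← below_e_add_below_e hpq, add_comm (D.en p) (D.en q)]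
  congr 1
  exact sgn_congr (-D.below q (D.e p)) (by ring)

theorem d_sq {p : Fin D.ℓ} (hp : D.ℓ'₄ ≤ p.val) : D.d p * D.d p = 0 := by
  have : D.d p * m 0 0 (D.en p) = 0 := by
    rw [d_mul_dm, m, mon_of_not_mem_K]
    · exact smul_zero _
    · intro h
      have := h p hp
      simp at this
  exact this

/-- Linear maps out of the algebra agree if they agree on the monomials. -/
theorem R.ext_m {M : Type*} [AddCommGroup M] [Module F M] {f g : D.R →ₗ[F] M}
    (h : ∀ α, ∀ k ∈ D.J, ∀ μ ∈ D.K, f (m α k μ) = g (m α k μ)) : f = g :=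
  ext_mon (f := f) (g := g) h

theorem R.induction {P : D.R → Prop} (hm : ∀ α, ∀ k ∈ D.J, ∀ μ ∈ D.K, P (m α k μ))
    (h0 : P 0) (hadd : ∀ u v, P u → P v → P (u + v)) (hsmul : ∀ (c : F) u, P u → P (c • u))
    (u : D.R) : P u := by
  refine Finsupp.induction_linear (motive := P) u h0 hadd fun a c => ?_
  have h := hsmul c _ (hm a.1 a.2.1 a.2.1.2 a.2.2 a.2.2.2)
  rw [m, ← single_eq_mon] at h
  have e : (Finsupp.single a c : D.W) = c • Finsupp.single a 1 := by simp
  rw [e]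
  exact h

end WeylData

end WeylSuper

end

/-! ### Abstract criteria for a cocycle to be a coboundary -/

noncomputable section

namespace WeylSuper

open Finset

/-! ### Heisenberg pairs of operators -/

section Heisenberg

variable {F V : Type*} [Field F] [CharZero F] [AddCommGroup V] [Module F V]

/-- On sums `∑ m^j c_j` with `A c_j = 0` the operator `A` acts as `d/dm`. -/
theorem heisenberg_pow {A m : Module.End F V} (h : A * m = m * A + 1) {c : V} (hc : A c = 0)
    (k : ℕ) : A ((m ^ (k + 1)) c) = ((k : F) + 1) • (m ^ k) c := by
  have h' : ∀ v, A (m v) = m (A v) + v := fun v => LinearMap.congr_fun h v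
  induction k with
  | zero => simp [h', hc]
  | succ k ih =>
    rw [pow_succ', Module.End.mul_apply, h', ih, map_smul, ← Module.End.mul_apply, ← pow_succ']
    push_cast
    module

theorem heisenberg_pow_pow {A m : Module.End F V} (h : A * m = m * A + 1) {c : V} (hc : A c = 0)
    (k n : ℕ) : (A ^ n) ((m ^ (k + n)) c) = ((k + n).descFactorial n : F) • (m ^ k) c := by
  induction n with
  | zero => simp
  | succ n ih =>
    rw [pow_succ, Module.End.mul_apply, ← add_assoc, heisenberg_pow h hc, map_smul, ih, smul_smul,
      Nat.succ_descFactorial_succ]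
    push_cast
    rfl

/-- A locally nilpotent operator with `[A, m] = 1` is onto, also on stable subspaces. -/
theorem heisenberg_surjective {A m : Module.End F V} (h : A * m = m * A + 1)
    (hA : ∀ v, ∃ n : ℕ, (A ^ n) v = 0) (S : Submodule F V) (hSA : ∀ v ∈ S, A v ∈ S)
    (hSm : ∀ v ∈ S, m v ∈ S) {v : V} (hv : v ∈ S) : ∃ w ∈ S, A w = v := by
  have hSAn : ∀ n : ℕ, ∀ v ∈ S, (A ^ n) v ∈ S := fun n => by
    induction n with
    | zero => simp
    | succ n ih =>
      intro v hv
      rw [pow_succ, Module.End.mul_apply]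
      exact ih _ (hSA v hv)
  have hSmn : ∀ n : ℕ, ∀ v ∈ S, (m ^ n) v ∈ S := fun n => by
    induction n with
    | zero => simp
    | succ n ih =>
      intro v hv
      rw [pow_succ, Module.End.mul_apply]
      exact ih _ (hSm v hv)
  obtain ⟨n, hn⟩ := hA v
  induction n generalizing v with
  | zero => exact ⟨0, S.zero_mem, by simpa using hn.symm⟩
  | succ n ih =>
    have hc : A ((A ^ n) v) = 0 := by rwa [← Module.End.mul_apply, ← pow_succ']
    have hcS := hSAn n v hv
    set c := (A ^ n) v with hcdef
    have h1 := heisenberg_pow_pow h hc 0 n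
    have hne : (n.factorial : F) ≠ 0 := Nat.cast_ne_zero.2 n.factorial_ne_zero
    have hne' : ((n : F) + 1) ≠ 0 := by exact_mod_cast n.succ_ne_zero
    rw [zero_add, Nat.descFactorial_self, pow_zero, Module.End.one_apply] at h1
    -- `c = A^n v` is killed by `A`. Subtracting `m^n c / n!` lowers the nilpotency order of `v`,
    -- and the subtracted term has the preimage `m^{n+1} c / (n! (n + 1))`.
    obtain ⟨w, hw, hAw⟩ := ih (v := v - (n.factorial : F)⁻¹ • (m ^ n) c)
      (S.sub_mem hv (S.smul_mem _ (hSmn n c hcS))) (by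
        rw [map_sub, map_smul, h1, smul_smul, inv_mul_cancel₀ hne, one_smul, sub_self])
    refine ⟨w + ((n.factorial : F)⁻¹ * ((n : F) + 1)⁻¹) • (m ^ (n + 1)) c,
      S.add_mem hw (S.smul_mem _ (hSmn _ c hcS)), ?_⟩
    rw [map_add, map_smul, heisenberg_pow h hc, hAw, smul_smul, mul_assoc, inv_mul_cancel₀ hne',
      mul_one]
    abel

/-- The sums `∑ m^j b_j` with `b_j ∈ B`. -/
def powSpan (m : Module.End F V) (B : Submodule F V) : Submodule F V :=
  ⨆ j : ℕ, B.map (m ^ j)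

/-- If every vector is a sum `∑ m^j b_j` with `b_j ∈ B ≤ ker A`, then `B = ker A`. -/
theorem mem_of_heisenberg {A m : Module.End F V} (h : A * m = m * A + 1) {B : Submodule F V}
    (hB : ∀ b ∈ B, A b = 0) {v : V} (hv : v ∈ powSpan m B) (hAv : A v = 0) : v ∈ B := by
  rw [powSpan, Submodule.mem_iSup_iff_exists_finsupp] at hv
  obtain ⟨f, hf, rfl⟩ := hv
  choose b hb hbf using fun j => Submodule.mem_map.1 (hf j)
  have hsum : f.sum (fun _ x => x) = ∑ j ∈ range (f.support.sup id + 1), (m ^ j) (b j) := by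
    rw [Finsupp.sum_of_support_subset f (s := range (f.support.sup id + 1)) ?_ _ (by simp)]
    · simp only [hbf]
    · intro j hj
      rw [mem_range, Nat.lt_succ_iff]
      exact le_sup (f := id) hj
  rw [hsum] at hAv ⊢
  clear hsum
  generalize f.support.sup id = n at hAv ⊢
  induction n with
  | zero => simpa using hb 0
  | succ n ih =>
    -- `A^{n+1}` kills the sum since `A` does. It also kills the terms of lower degree and turns the
    -- leading one into `(n + 1)! b_{n+1}`.
    have h0 : b (n + 1) = 0 := by
      have h1 : (A ^ (n + 1)) (∑ j ∈ range (n + 1 + 1), (m ^ j) (b j)) = 0 := by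
        rw [pow_succ, Module.End.mul_apply, hAv, map_zero]
      have h2 : ∀ j ∈ range (n + 1), (A ^ (n + 1)) ((m ^ j) (b j)) = 0 := by
        intro j hj
        obtain ⟨i, hi⟩ := Nat.exists_eq_add_of_lt (mem_range.1 hj)
        have h3 := heisenberg_pow_pow h (hB _ (hb j)) 0 j
        rw [zero_add, pow_zero] at h3
        rw [hi, show j + i + 1 = (i + 1) + j by ring, pow_add, Module.End.mul_apply, h3, map_smul,
          pow_succ, Module.End.mul_apply, Module.End.one_apply, hB _ (hb j), map_zero, smul_zero]
      have h4 := heisenberg_pow_pow h (hB _ (hb (n + 1))) 0 (n + 1)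
      rw [map_sum, sum_range_succ, sum_eq_zero h2, zero_add] at h1
      rw [zero_add, h1, Nat.descFactorial_self, pow_zero, Module.End.one_apply] at h4
      exact (smul_eq_zero.1 h4.symm).resolve_left (Nat.cast_ne_zero.2 (Nat.factorial_ne_zero _))
    rw [sum_range_succ, h0, map_zero, add_zero] at hAv ⊢
    exact ih hAv

end Heisenberg

/-! ### Forms with the cocycle property for an even element -/

section Abstract

variable {F R : Type*} [Field F] [Ring R] [Algebra F R]

/-- The inner derivation `w ↦ z w - w z`. -/
def adj (z : R) : Module.End F R := LinearMap.mulLeft F z - LinearMap.mulRight F z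

theorem adj_apply (z w : R) : adj (F := F) z w = z * w - w * z := rfl

theorem adj_mul (z u v : R) : adj (F := F) z (u * v) = adj (F := F) z u * v + u * adj (F := F) z v := by
  simp only [adj_apply]
  noncomm_ring

/-- `ad z` is a derivation which takes `z'` to `1`. -/
theorem adj_heisenberg {z z' : R} (h : z * z' - z' * z = 1) :
    adj (F := F) z * LinearMap.mulRight F z' = LinearMap.mulRight F z' * adj (F := F) z + 1 := by
  ext w
  simp only [Module.End.mul_apply, LinearMap.add_apply, LinearMap.mulRight_apply, adj_mul,
    Module.End.one_apply]
  rw [adj_apply z z', h, mul_one]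

/-- The cocycle and derivation properties of the bracket and of a form for the element `z`. -/
structure CocycleAt (br : R →ₗ[F] R →ₗ[F] R) (ψ : R →ₗ[F] R →ₗ[F] F) (z : R) : Prop where
  jacobi : ∀ u v, adj (F := F) z (br u v) = br (adj (F := F) z u) v + br u (adj (F := F) z v)
  cocycle : ∀ u v, ψ z (br u v) = ψ (adj (F := F) z u) v + ψ u (adj (F := F) z v)

variable {br : R →ₗ[F] R →ₗ[F] R} {ψ : R →ₗ[F] R →ₗ[F] F}

/-- A cocycle for which `ψ(z, ·)` vanishes on the centralizer of `z` is a coboundary if `ad z` is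
locally nilpotent and `[z, z'] = 1`. -/
theorem CocycleAt.exists_eq [CharZero F] {z z' : R} (h : CocycleAt br ψ z) (hz : z * z' - z' * z = 1)
    (hnil : ∀ v, ∃ n : ℕ, (adj (F := F) z ^ n) v = 0)
    (h0 : ∀ c, adj (F := F) z c = 0 → ψ z c = 0) : ∃ f : R →ₗ[F] F, br.compr₂ f = ψ := by
  have hsurj : Function.Surjective (adj (F := F) z) := fun v => by
    obtain ⟨w, -, hw⟩ := heisenberg_surjective (adj_heisenberg hz) hnil ⊤ (by simp) (by simp)
      (Submodule.mem_top (x := v))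
    exact ⟨w, hw⟩
  obtain ⟨g, hg⟩ := LinearMap.exists_rightInverse_of_surjective _ (LinearMap.range_eq_top.2 hsurj)
  have hg' : ∀ w, adj (F := F) z (g w) = w := fun w => LinearMap.congr_fun hg w
  -- Since `ψ(z, ·)` vanishes on the kernel of the surjection `ad z`, it factors through it, and the
  -- factor `f` is the required functional.
  let f : R →ₗ[F] F := ψ z ∘ₗ g
  have hf : ∀ w, f (adj (F := F) z w) = ψ z w := fun w => by
    have := h0 (g (adj (F := F) z w) - w) (by rw [map_sub, hg', sub_self])
    rwa [map_sub, sub_eq_zero] at this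
  refine ⟨f, ?_⟩
  have key : ∀ n : ℕ, ∀ u, (adj (F := F) z ^ n) u = 0 → ∀ v, ψ u v = f (br u v) := by
    intro n
    induction n with
    | zero => intro u hu v; simp [show u = 0 by simpa using hu]
    | succ n ih =>
      intro u hu v
      -- For `v = ad z w`, applying `f` to the derivation rule for `ad z [u, w]` and comparing with
      -- the cocycle identity reduces the claim to `ad z u`, of lower nilpotency order.
      obtain ⟨w, rfl⟩ := hsurj v
      rw [pow_succ, Module.End.mul_apply] at hu
      have h1 := h.cocycle u w
      have h2 := hf (br u w)
      rw [h.jacobi, map_add, ← ih _ hu, h1] at h2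
      exact (add_left_cancel h2).symm
  ext u v
  obtain ⟨n, hn⟩ := hnil u
  exact (key n u hn v).symm

/-- `ψ(z, [u, v]) = 0` for `u`, `v` in the centralizer of `z`. -/
theorem CocycleAt.eq_zero {z u v : R} (h : CocycleAt br ψ z) (hu : adj (F := F) z u = 0)
    (hv : adj (F := F) z v = 0) : ψ z (br u v) = 0 := by
  rw [h.cocycle, hu, hv]
  simp

/-- The case of a second element `y` of the same kind commuting with `z`. -/
theorem CocycleAt.exists_eq_of_pair [CharZero F] {z z' y y' : R} (h : CocycleAt br ψ z)
    (hbr : ∀ v, br y v = adj (F := F) y v)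
    (hz : z * z' - z' * z = 1) (hy : y * y' - y' * y = 1) (hzy : adj (F := F) z y = 0)
    (hzy' : adj (F := F) z y' = 0)
    (hnil : ∀ v, ∃ n : ℕ, (adj (F := F) z ^ n) v = 0)
    (hnil' : ∀ v, ∃ n : ℕ, (adj (F := F) y ^ n) v = 0) : ∃ f : R →ₗ[F] F, br.compr₂ f = ψ := by
  refine h.exists_eq hz hnil fun c hc => ?_
  have h1 : ∀ v ∈ LinearMap.ker (adj (F := F) z),
      adj (F := F) y v ∈ LinearMap.ker (adj (F := F) z) := by
    intro v hv
    rw [LinearMap.mem_ker] at hv ⊢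
    rw [adj_apply y, map_sub, adj_mul, adj_mul, hzy, hv]
    simp
  have h2 : ∀ v ∈ LinearMap.ker (adj (F := F) z),
      LinearMap.mulRight F y' v ∈ LinearMap.ker (adj (F := F) z) := by
    intro v hv
    rw [LinearMap.mem_ker] at hv ⊢
    rw [LinearMap.mulRight_apply, adj_mul, hzy', hv]
    simp
  -- The centralizer of `z` is stable under `ad y` and under right multiplication by `y'`, so `c =
  -- [y, w]` with `w` again in the centralizer.
  obtain ⟨w, hw, rfl⟩ := heisenberg_surjective (adj_heisenberg hy) hnil' _ h1 h2
    (LinearMap.mem_ker.2 hc)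
  rw [← hbr]
  exact h.eq_zero hzy (LinearMap.mem_ker.1 hw)

end Abstract

/-! ### The grading -/

namespace WeylData

theorem koszul_zero_left {F : Type*} [Field F] (e : ZMod 2) : (koszul 0 e : F) = 1 := by
  simp [koszul]

theorem koszul_zero_right {F : Type*} [Field F] (e : ZMod 2) : (koszul e 0 : F) = 1 := by
  simp [koszul]

theorem koszul_comm {F : Type*} [Field F] (d e : ZMod 2) : (koszul d e : F) = koszul e d := by
  simp [koszul, mul_comm]

theorem koszul_add_left {F : Type*} [Field F] (a b c : ZMod 2) :
    (koszul (a + b) c : F) = koszul a c * koszul b c := by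
  unfold koszul
  rw [← pow_add, neg_one_pow_eq_pow_mod_two]
  conv_rhs => rw [neg_one_pow_eq_pow_mod_two]
  congr 1
  revert a b c
  decide

theorem koszul_add_right {F : Type*} [Field F] (a b c : ZMod 2) :
    (koszul a (b + c) : F) = koszul a b * koszul a c := by
  rw [koszul_comm, koszul_add_left, koszul_comm b, koszul_comm c]

theorem koszul_mul_self {F : Type*} [Field F] (a b : ZMod 2) :
    (koszul a b : F) * koszul a b = 1 := by
  unfold koszul
  rw [← mul_pow]
  simp

variable {F : Type*} [Field F] {D : WeylData F}

variable (D) in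
/-- The homogeneous components as subspaces of the algebra. -/
def comp (e : ZMod 2) : Submodule F D.R := D.component e

theorem parity_eq (a : D.Idx) :
    D.parity a = ((D.deg a.2.1.1 + D.deg (D.cz a.2.2.1) : ℤ) : ZMod 2) := by
  simp [parity, deg, cz, sum_add_distrib]

theorem m_mem (α : D.Γ) (k : Fin D.ℓ → ℤ) (μ : Fin D.ℓ → ℕ) :
    m α k μ ∈ D.comp ((D.deg k + D.deg (D.cz μ) : ℤ) : ZMod 2) := by
  by_cases h : k ∈ D.J ∧ μ ∈ D.K
  · rw [m, mon_of_mem h.1 h.2]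
    exact Finsupp.single_mem_supported F 1 (parity_eq _)
  · have : m α k μ = 0 := dif_neg h
    rw [this]
    exact zero_mem _

/-- A linear map sends a component to a subspace if it does so for monomials. -/
theorem comp_le_comap {M : Type*} [AddCommGroup M] [Module F M] {f : D.R →ₗ[F] M}
    {N : Submodule F M} {e : ZMod 2}
    (h : ∀ α, ∀ k ∈ D.J, ∀ μ ∈ D.K, ((D.deg k + D.deg (D.cz μ) : ℤ) : ZMod 2) = e →
      f (m α k μ) ∈ N) {u : D.R} (hu : u ∈ D.comp e) : f u ∈ N := by
  have hu' : u ∈ Finsupp.supported F F {a | D.parity a = e} := hu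
  rw [Finsupp.supported_eq_span_single] at hu'
  have : Submodule.span F ((fun i => (Finsupp.single i 1 : D.W)) '' {a | D.parity a = e}) ≤
      Submodule.comap f N := by
    refine Submodule.span_le.2 ?_
    rintro _ ⟨a, ha, rfl⟩
    have h1 := h a.1 a.2.1 a.2.1.2 a.2.2 a.2.2.2 ((parity_eq a).symm.trans ha)
    rw [m, ← single_eq_mon] at h1
    exact h1
  exact this hu'

theorem comp_sup : D.comp 0 ⊔ D.comp 1 = ⊤ := by
  refine eq_top_iff.2 fun u _ => ?_
  refine R.induction (P := fun u => u ∈ D.comp 0 ⊔ D.comp 1) (fun α k _ μ _ => ?_)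
    (zero_mem _) (fun _ _ => add_mem) (fun c _ => Submodule.smul_mem _ c) u
  have h := m_mem α k μ
  generalize ((D.deg k + D.deg (D.cz μ) : ℤ) : ZMod 2) = e at h
  have he : ∀ e : ZMod 2, e = 0 ∨ e = 1 := by decide
  rcases he e with rfl | rfl
  · exact Submodule.mem_sup_left h
  · exact Submodule.mem_sup_right h

/-- A property closed under sums holds if it holds for homogeneous elements. -/
theorem hom_induction {P : D.R → Prop} (h : ∀ e, ∀ u ∈ D.comp e, P u)
    (hadd : ∀ u v, P u → P v → P (u + v)) (u : D.R) : P u := by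
  have hu : u ∈ D.comp 0 ⊔ D.comp 1 := by
    rw [comp_sup]
    trivial
  obtain ⟨a, ha, b, hb, rfl⟩ := Submodule.mem_sup.1 hu
  exact hadd _ _ (h 0 a ha) (h 1 b hb)

theorem x_mul_mem {k : Fin D.ℓ → ℤ} (hk : k ∈ D.J) (α : D.Γ) {e : ZMod 2} {v : D.R}
    (hv : v ∈ D.comp e) : x α k * v ∈ D.comp ((D.deg k : ZMod 2) + e) := by
  refine comp_le_comap (f := LinearMap.mulLeft F (x α k)) (fun β l hl ν _ he => ?_) hv
  rw [LinearMap.mulLeft_apply, x_mul_m hk hl]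
  have := m_mem (α + β) (k + l) ν
  rw [deg_add, add_assoc, Int.cast_add, he] at this
  exact Submodule.smul_mem _ _ this

theorem d_mul_mem (p : Fin D.ℓ) {e : ZMod 2} {v : D.R}
    (hv : v ∈ D.comp e) : D.d p * v ∈ D.comp ((D.odd p : ZMod 2) + e) := by
  refine comp_le_comap (f := LinearMap.mulLeft F (D.d p)) (fun β l hl ν _ he => ?_) hv
  rw [LinearMap.mulLeft_apply, d_mul_m hl]
  refine add_mem (add_mem ?_ ?_) ?_
  · rcases lt_or_ge p.val D.ℓ'₄ with hp | hp
    · have := m_mem β l ν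
      rw [he] at this
      rw [D.odd_of_lt hp, Int.cast_zero, zero_add]
      exact Submodule.smul_mem _ _ this
    · rw [D.gamma_odd β hp, zero_smul]
      exact zero_mem _
  · have := m_mem β (l - D.e p) ν
    have h2 : ((D.deg (l - D.e p) + D.deg (D.cz ν) : ℤ) : ZMod 2) = (D.odd p : ZMod 2) + e := by
      rw [← he, deg_sub, deg_e]
      push_cast
      linear_combination -(CharTwo.two_eq_zero (R := ZMod 2)) * (D.odd p : ZMod 2)
    rw [h2] at this
    exact Submodule.smul_mem _ _ this
  · have := m_mem β l (ν + D.en p)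
    have h2 : ((D.deg l + D.deg (D.cz (ν + D.en p)) : ℤ) : ZMod 2) = (D.odd p : ZMod 2) + e := by
      rw [← he, cz_add, cz_en, deg_add, deg_e]
      push_cast
      ring
    rw [h2] at this
    exact Submodule.smul_mem _ _ this

theorem dm_succ {μ : Fin D.ℓ → ℕ} (p : Fin D.ℓ) :
    (m 0 0 (μ + D.en p) : D.R) = sgn F (D.below p (D.cz μ)) • (D.d p * m 0 0 μ) := by
  rw [d_mul_dm, smul_smul, sgn_mul_self, one_smul]

theorem mul_mem_comp {a b : ZMod 2} {u v : D.R} (hu : u ∈ D.comp a) (hv : v ∈ D.comp b) :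
    u * v ∈ D.comp (a + b) := by
  refine comp_le_comap (f := LinearMap.mulRight F v) (fun β l hl ν hν he => ?_) hu
  rw [LinearMap.mulRight_apply, ← x_mul_dm hl, mul_assoc, ← he, Int.cast_add, add_assoc]
  refine x_mul_mem hl β ?_
  refine K_induction (P := fun ν => m 0 0 ν * v ∈ D.comp ((D.deg (D.cz ν) : ZMod 2) + b)) ?_
    (fun μ p _ ih => ?_) ν hν
  · rw [← x, x_zero, one_mul, cz_zero, deg_zero, Int.cast_zero, zero_add]
    exact hv
  · rw [dm_succ, smul_mul_assoc, mul_assoc, cz_add, cz_en, deg_add, deg_e, Int.cast_add, add_comm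
      (D.deg (D.cz μ) : ZMod 2), add_assoc]
    exact Submodule.smul_mem _ _ (d_mul_mem p ih)

variable (D) in
/-- The superbracket on the algebra. -/
def br : D.R →ₗ[F] D.R →ₗ[F] D.R := D.bracket

theorem br_apply {a b : ZMod 2} {u v : D.R} (hu : u ∈ D.comp a) (hv : v ∈ D.comp b) :
    D.br u v = u * v - (koszul a b : F) • (v * u) := by
  have key : ∀ i j : D.Idx, D.bracket (Finsupp.single i 1) (Finsupp.single j 1) =
      D.mul (Finsupp.single i 1) (Finsupp.single j 1) -
        (koszul (D.parity i) (D.parity j) : F) •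
          D.mul (Finsupp.single j 1) (Finsupp.single i 1) := by
    intro i j
    rw [bracket, Finsupp.linearCombination_single, one_smul, Finsupp.linearCombination_single,
      one_smul]
  have step : ∀ α, ∀ k ∈ D.J, ∀ μ ∈ D.K, ((D.deg k + D.deg (D.cz μ) : ℤ) : ZMod 2) = a →
      D.br (m α k μ) v = m α k μ * v - (koszul a b : F) • (v * m α k μ) := by
    intro α k hk μ hμ ha
    rw [← sub_eq_zero]
    refine comp_le_comap (N := ⊥) (f := D.br (m α k μ) - (LinearMap.mulLeft F (m α k μ) -
      (koszul a b : F) • LinearMap.mulRight F (m α k μ))) (fun β l hl ν hν hb => ?_) hv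
    have := key (α, ⟨k, hk⟩, ⟨μ, hμ⟩) (β, ⟨l, hl⟩, ⟨ν, hν⟩)
    rw [← mon_of_mem, ← mon_of_mem, parity_eq, parity_eq, ha, hb] at this
    rw [Submodule.mem_bot, LinearMap.sub_apply, sub_eq_zero]
    exact this
  rw [← sub_eq_zero]
  refine comp_le_comap (N := ⊥) (f := D.br.flip v - (LinearMap.mulRight F v -
      (koszul a b : F) • LinearMap.mulLeft F v)) (fun β l hl ν hν hb => ?_) hu
  rw [Submodule.mem_bot, LinearMap.sub_apply, sub_eq_zero]
  exact step β l hl ν hν hb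

theorem br_even {z : D.R} (hz : z ∈ D.comp 0) (v : D.R) : D.br z v = adj (F := F) z v := by
  refine hom_induction (P := fun v => D.br z v = adj (F := F) z v) (fun e v hv => ?_)
    (fun u v hu hv => by rw [map_add, map_add, hu, hv]) v
  rw [br_apply hz hv, koszul_zero_left, one_smul]
  rfl

theorem adj_mem {z : D.R} (hz : z ∈ D.comp 0) {e : ZMod 2} {v : D.R} (hv : v ∈ D.comp e) :
    adj (F := F) z v ∈ D.comp e := by
  have h1 := mul_mem_comp hz hv
  have h2 := mul_mem_comp hv hz
  rw [zero_add] at h1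
  rw [add_zero] at h2
  exact sub_mem h1 h2

/-- A 2-cocycle as a form on the algebra. -/
def form (D : WeylData F) (ψ : D.W →ₗ[F] D.W →ₗ[F] F) : D.R →ₗ[F] D.R →ₗ[F] F := ψ

/-- For an even element all Koszul signs are `1`, so the super identities become those of an
ordinary derivation and hold for arbitrary `u` and `v`. -/
theorem cocycleAt {ψ : D.W →ₗ[F] D.W →ₗ[F] F} (hψ : ψ ∈ D.C2) {z : D.R} (hz : z ∈ D.comp 0) :
    CocycleAt D.br (D.form ψ) z where
  jacobi u v := by
    refine hom_induction (P := fun u => adj (F := F) z (D.br u v) = D.br (adj (F := F) z u) v +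
      D.br u (adj (F := F) z v)) (fun a u hu => ?_) (fun u u' hu hu' => ?_) u
    · refine hom_induction (P := fun v => adj (F := F) z (D.br u v) = D.br (adj (F := F) z u) v +
        D.br u (adj (F := F) z v)) (fun b v hv => ?_) (fun v v' hv hv' => ?_) v
      · rw [br_apply hu hv, br_apply (adj_mem hz hu) hv, br_apply hu (adj_mem hz hv), map_sub,
          map_smul, adj_mul, adj_mul]
        simp only [smul_add]
        abel
      · simp only [map_add, hv, hv']
        abel
    · simp only [map_add, LinearMap.add_apply, hu, hu']
      abel
  cocycle u v := by
    have hφ : ∀ a b : ZMod 2, ∀ u ∈ D.comp a, ∀ v ∈ D.comp b, D.form ψ z (D.br u v) =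
        D.form ψ (adj (F := F) z u) v + D.form ψ u (adj (F := F) z v) := by
      intro a b u hu v hv
      have := hψ.2 0 a b z hz u hu v hv
      rw [koszul_zero_left, one_mul] at this
      rw [← br_even hz, ← br_even hz]
      exact this
    refine hom_induction (P := fun u => D.form ψ z (D.br u v) = D.form ψ (adj (F := F) z u) v +
      D.form ψ u (adj (F := F) z v)) (fun a u hu => ?_) (fun u u' hu hu' => ?_) u
    · refine hom_induction (P := fun v => D.form ψ z (D.br u v) = D.form ψ (adj (F := F) z u) v +
        D.form ψ u (adj (F := F) z v)) (fun b v hv => hφ a b u hu v hv) (fun v v' hv hv' => ?_) v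
      simp only [map_add, hv, hv']
      abel
    · simp only [map_add, LinearMap.add_apply, hu, hu']
      abel

end WeylData

end WeylSuper

end

/-! ### Local nilpotency, and vanishing for two even coordinates -/

noncomputable section

namespace WeylSuper

open Finset

section Nilpotent

variable {F R : Type*} [Field F] [Ring R] [Algebra F R]

/-- Each term of the Leibniz expansion differentiates `u` at least `n` times or `v` at least `k`
times. -/
theorem adj_pow_mul {z : R} : ∀ (n k : ℕ) {u v : R}, (adj (F := F) z ^ n) u = 0 →
    (adj (F := F) z ^ k) v = 0 → (adj (F := F) z ^ (n + k)) (u * v) = 0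
  | 0, k, u, v, hu, _ => by simp [show u = 0 by simpa using hu]
  | n + 1, 0, u, v, _, hv => by simp [show v = 0 by simpa using hv]
  | n + 1, k + 1, u, v, hu, hv => by
    have hu' := hu
    have hv' := hv
    rw [pow_succ, Module.End.mul_apply] at hu' hv'
    rw [show n + 1 + (k + 1) = n + k + 1 + 1 by ring, pow_succ, Module.End.mul_apply, adj_mul,
      map_add]
    have h1 := adj_pow_mul n (k + 1) hu' hv
    have h2 := adj_pow_mul (n + 1) k hu hv'
    rw [show n + (k + 1) = n + k + 1 by ring] at h1
    rw [show n + 1 + k = n + k + 1 by ring] at h2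
    rw [h1, h2, add_zero]

theorem adj_nilpotent_add {z u v : R} (hu : ∃ n : ℕ, (adj (F := F) z ^ n) u = 0)
    (hv : ∃ n : ℕ, (adj (F := F) z ^ n) v = 0) : ∃ n : ℕ, (adj (F := F) z ^ n) (u + v) = 0 := by
  obtain ⟨n, hn⟩ := hu
  obtain ⟨k, hk⟩ := hv
  have h1 : (adj (F := F) z ^ (n + k)) u = 0 := by
    rw [add_comm, pow_add, Module.End.mul_apply, hn, map_zero]
  have h2 : (adj (F := F) z ^ (n + k)) v = 0 := by
    rw [pow_add, Module.End.mul_apply, hk, map_zero]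
  exact ⟨n + k, by rw [map_add, h1, h2, add_zero]⟩

theorem adj_eq_zero_iff {z u : R} : adj (F := F) z u = 0 ↔ Commute z u := by
  rw [adj_apply, sub_eq_zero]
  rfl

/-- An invertible eigenvector `y` of `ad L` with eigenvalue `c ≠ 0` has a Heisenberg partner. It is
used for `y = x^β` and `L` a combination of even `∂_p`. -/
theorem heisenberg_of_eigenvector {y y₁ L : R} {c : F} (hc : c ≠ 0) (h1 : y * y₁ = 1)
    (h2 : y₁ * y = 1) (hL : L * y = y * L + c • y) :
    y * (-c⁻¹ • (y₁ * L)) - (-c⁻¹ • (y₁ * L)) * y = 1 := by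
  rw [mul_smul_comm, smul_mul_assoc, ← mul_assoc, h1, mul_assoc, hL, mul_add, ← mul_assoc, h2,
    mul_smul_comm, h2]
  simp [smul_smul, inv_mul_cancel₀ hc]

end Nilpotent

section PowSpan

variable {F V : Type*} [Field F] [AddCommGroup V] [Module F V]

theorem le_powSpan (m : Module.End F V) (B : Submodule F V) (j : ℕ) {b : V} (hb : b ∈ B) :
    (m ^ j) b ∈ powSpan m B :=
  Submodule.mem_iSup_of_mem j (Submodule.mem_map_of_mem hb)

theorem powSpan_map_le {m T : Module.End F V} {B : Submodule F V}
    (h : ∀ j : ℕ, ∀ b ∈ B, T ((m ^ j) b) ∈ powSpan m B) {v : V} (hv : v ∈ powSpan m B) :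
    T v ∈ powSpan m B := by
  have : powSpan m B ≤ (powSpan m B).comap T := by
    refine iSup_le fun j => ?_
    rintro _ ⟨b, hb, rfl⟩
    exact h j b hb
  exact this hv

end PowSpan

namespace WeylData

variable {F : Type*} [Field F] {D : WeylData F}

/-! ### Even monomials -/

/-- The exponents vanishing in the odd coordinates. -/
def EvenSupp {M : Type*} [Zero M] (k : Fin D.ℓ → M) : Prop :=
  ∀ p : Fin D.ℓ, D.ℓ'₄ ≤ p.val → k p = 0

theorem EvenSupp.deg {k : Fin D.ℓ → ℤ} (h : EvenSupp k) : D.deg k = 0 :=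
  sum_eq_zero fun p hp => h p (mem_filter.1 hp).2

theorem EvenSupp.below {k : Fin D.ℓ → ℤ} (h : EvenSupp k) (p : Fin D.ℓ) : D.below p k = 0 :=
  sum_eq_zero fun r hr => h r (mem_filter.1 (mem_filter.1 hr).1).2

theorem EvenSupp.pair_left {k : Fin D.ℓ → ℤ} (h : EvenSupp k) (l : Fin D.ℓ → ℤ) :
    D.pair k l = 0 :=
  sum_eq_zero fun r hr => by
    have := (mem_filter.1 hr).2
    rw [h r.2 (this.1.trans (Fin.lt_def.1 this.2).le), zero_mul]

theorem EvenSupp.pair_right {k : Fin D.ℓ → ℤ} (h : EvenSupp k) (l : Fin D.ℓ → ℤ) :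
    D.pair l k = 0 :=
  sum_eq_zero fun r hr => by rw [h r.1 (mem_filter.1 hr).2.1, mul_zero]

theorem evenSupp_zero : EvenSupp (0 : Fin D.ℓ → ℤ) := fun _ _ => rfl

theorem evenSupp_single {p : Fin D.ℓ} (hp : p.val < D.ℓ'₄) (i : ℤ) :
    EvenSupp (Pi.single p i : Fin D.ℓ → ℤ) := fun q hq => by
  refine Pi.single_eq_of_ne ?_ _
  rintro rfl
  omega

theorem single_mem_J {p : Fin D.ℓ} (hp : p.val < D.ℓ'₃) {i : ℤ} (hi : p.val < D.ℓ'₂ → 0 ≤ i) :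
    (Pi.single p i : Fin D.ℓ → ℤ) ∈ D.J := by
  intro q
  rcases eq_or_ne q p with rfl | hq
  · rw [Pi.single_eq_same]
    exact ⟨hi, fun h => absurd hp (not_lt.2 h), fun h =>
      absurd (hp.trans_le (Nat.le_add_right _ _)) (not_lt.2 h)⟩
  · simp [Pi.single_eq_of_ne hq]

theorem x_mem_comp_zero {k : Fin D.ℓ → ℤ} (h : EvenSupp k) (β : D.Γ) : x β k ∈ D.comp 0 := by
  have := m_mem β k 0
  rwa [h.deg, cz_zero, deg_zero, add_zero, Int.cast_zero] at this

theorem d_mem_comp (p : Fin D.ℓ) : D.d p ∈ D.comp (D.odd p : ZMod 2) := by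
  have := m_mem (0 : D.Γ) (0 : Fin D.ℓ → ℤ) (D.en p)
  rwa [deg_zero, cz_en, deg_e, zero_add] at this

theorem EvenSupp.commute_x {k l : Fin D.ℓ → ℤ} (h : EvenSupp k) (hk : k ∈ D.J) (hl : l ∈ D.J)
    (β α : D.Γ) : Commute (x β k) (x α l) := by
  rw [Commute, SemiconjBy, x_mul_x hk hl, x_mul_x hl hk, h.pair_left, h.pair_right, add_comm β,
    add_comm k]

theorem EvenSupp.d_mul {k : Fin D.ℓ → ℤ} (h : EvenSupp k) (hk : k ∈ D.J) (β : D.Γ)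
    (p : Fin D.ℓ) : D.d p * x β k = x β k * D.d p + (β.1 p • x β k + (k p : F) • x β (k - D.e p)) := by
  rw [d_mul_x hk, h.below, h.deg, mul_zero, sgn_zero, one_mul, one_smul]
  abel

theorem EvenSupp.commute_d_odd {k : Fin D.ℓ → ℤ} (h : EvenSupp k) (hk : k ∈ D.J) (β : D.Γ)
    {p : Fin D.ℓ} (hp : D.ℓ'₄ ≤ p.val) : Commute (x β k) (D.d p) := by
  rw [Commute, SemiconjBy, h.d_mul hk, D.gamma_odd β hp, h p hp]
  simp

theorem EvenSupp.sub_e {k : Fin D.ℓ → ℤ} (h : EvenSupp k) {p : Fin D.ℓ} (hp : k p ≠ 0) :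
    EvenSupp (k - D.e p) := fun q hq => by
  have : q ≠ p := by
    rintro rfl
    exact hp (h q hq)
  simp [h q hq, Pi.single_eq_of_ne this]

/-- `[x^{β,k}, ∂_p]` contains no `∂`, hence commutes with `x^{β,k}`. -/
theorem EvenSupp.adj_adj_d {k : Fin D.ℓ → ℤ} (h : EvenSupp k) (hk : k ∈ D.J) (β : D.Γ)
    (p : Fin D.ℓ) : adj (F := F) (x β k) (adj (F := F) (x β k) (D.d p)) = 0 := by
  rw [adj_apply _ (D.d p), h.d_mul hk, sub_add_cancel_left, map_neg, map_add, map_smul, map_smul,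
    adj_eq_zero_iff.2 (Commute.refl (x β k))]
  by_cases h0 : k p = 0
  · simp [h0]
  · rw [adj_eq_zero_iff.2 (h.commute_x hk (sub_e_mem_J hk h0) β β)]
    simp

/-- `ad x^{β,k}` kills every `x^{α,l}`, and its square kills every `∂_p`; products are handled by
`adj_pow_mul`. -/
theorem EvenSupp.nilpotent {k : Fin D.ℓ → ℤ} (h : EvenSupp k) (hk : k ∈ D.J) (β : D.Γ) (v : D.R) :
    ∃ n : ℕ, (adj (F := F) (x β k) ^ n) v = 0 := by
  refine R.induction (P := fun v => ∃ n : ℕ, (adj (F := F) (x β k) ^ n) v = 0)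
    (fun α l hl μ hμ => ?_) ⟨0, by simp⟩ (fun u v => adj_nilpotent_add) (fun c u => ?_) v
  · obtain ⟨n, hn⟩ : ∃ n : ℕ, (adj (F := F) (x β k) ^ n) (m 0 0 μ) = 0 := by
      refine K_induction (P := fun μ => ∃ n : ℕ, (adj (F := F) (x β k) ^ n) (m 0 0 μ) = 0)
        ⟨1, ?_⟩ (fun μ p _ ⟨n, hn⟩ => ⟨2 + n, ?_⟩) μ hμ
      · rw [pow_one]
        exact adj_eq_zero_iff.2 (Commute.one_right _)
      · rw [dm_succ, map_smul, adj_pow_mul 2 n (by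
          rw [pow_two, Module.End.mul_apply]
          exact h.adj_adj_d hk β p) hn, smul_zero]
    refine ⟨1 + n, ?_⟩
    rw [← x_mul_dm hl]
    refine adj_pow_mul 1 n ?_ hn
    rw [pow_one]
    exact adj_eq_zero_iff.2 (h.commute_x hk hl β α)
  · rintro ⟨n, hn⟩
    exact ⟨n, by rw [map_smul, hn, smul_zero]⟩

/-- The element `t_p`. -/
def t (p : Fin D.ℓ) : D.R := x 0 (D.e p)

theorem e_mem_J {p : Fin D.ℓ} (hp : p.val < D.ℓ'₃) : D.e p ∈ D.J :=
  single_mem_J hp fun _ => zero_le_one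

theorem d_mul_t {p : Fin D.ℓ} (hp : p.val < D.ℓ'₃) (q : Fin D.ℓ) :
    D.d q * t p = t p * D.d q + if q = p then 1 else 0 := by
  rw [t, (evenSupp_single (Nat.lt_of_lt_of_le hp (Nat.le_add_right _ _)) 1).d_mul (e_mem_J hp)]
  congr 1
  split_ifs with h
  · subst h
    simp [x_zero]
  · simp [Pi.single_eq_of_ne h]

theorem t_heisenberg {p : Fin D.ℓ} (hp : p.val < D.ℓ'₃) :
    t p * (-D.d p) - (-D.d p) * t p = 1 := by
  rw [neg_mul, d_mul_t hp, if_pos rfl, mul_neg]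
  abel

theorem x_mul_x_neg (γ : D.Γ) : (x γ 0 : D.R) * x (-γ) 0 = 1 := by
  rw [x_mul_x zero_mem_J zero_mem_J, pair_zero_left, sgn_zero, one_smul, add_neg_cancel, add_zero,
    x_zero]

theorem x_neg_mul_x (γ : D.Γ) : (x (-γ) 0 : D.R) * x γ 0 = 1 := by
  have := x_mul_x_neg (-γ)
  rwa [neg_neg] at this

theorem d_mul_x_zero (γ : D.Γ) (p : Fin D.ℓ) :
    D.d p * x γ 0 = x γ 0 * D.d p + γ.1 p • x γ 0 := by
  rw [evenSupp_zero.d_mul zero_mem_J]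
  simp

/-- `Γ` separates the coordinates on which it may be nonzero. -/
theorem exists_gamma {q : Fin D.ℓ} (h1 : D.ℓ₁ ≤ q.val) (h2 : q.val < D.ℓ'₄)
    (φ : (Fin D.ℓ → F) →ₗ[F] F) (h : φ (Pi.single q 1) ≠ 0) : ∃ γ : D.Γ, φ γ.1 ≠ 0 := by
  by_contra! hc
  have hle : Submodule.span F (D.Γ : Set (Fin D.ℓ → F)) ≤ LinearMap.ker φ :=
    Submodule.span_le.2 fun γ hγ => hc ⟨γ, hγ⟩
  refine h (LinearMap.mem_ker.1 (hle (D.nondegenerate _ fun p hp => ?_)))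
  refine Pi.single_eq_of_ne ?_ _
  rintro rfl
  exact hp.elim (not_lt.2 h1) (not_le.2 h2)

/-- A form on the algebra given by `f([u, v])` is a 2-coboundary. -/
theorem mem_B2_of_form {ψ : D.W →ₗ[F] D.W →ₗ[F] F}
    (h : ∃ f : D.R →ₗ[F] F, D.br.compr₂ f = D.form ψ) : ψ ∈ D.B2 := h

variable [CharZero F]

/-- Every cocycle is a coboundary if there are at least two even coordinates. -/
theorem mem_B2_of_two_le (h2 : 2 ≤ D.ℓ'₄) {ψ : D.W →ₗ[F] D.W →ₗ[F] F} (hψ : ψ ∈ D.C2) :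
    ψ ∈ D.B2 := by
  have hℓ : D.ℓ'₄ ≤ D.ℓ := Nat.le_add_right _ _
  refine mem_B2_of_form ?_
  by_cases h3 : 1 ≤ D.ℓ'₃
  · let p : Fin D.ℓ := ⟨0, by omega⟩
    let q : Fin D.ℓ := ⟨1, by omega⟩
    have hp : p.val < D.ℓ'₃ := h3
    have hp4 : p.val < D.ℓ'₄ := Nat.lt_of_lt_of_le two_pos h2
    have hpq : q ≠ p := fun h => absurd (Fin.mk.inj h) one_ne_zero
    have hpe := evenSupp_single (D := D) hp4 1
    have hpJ := e_mem_J hp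
    have hd : Commute (t p) (D.d q) := by
      rw [Commute, SemiconjBy, d_mul_t hp, if_neg hpq, add_zero]
    -- Here `z = t p`. The second element is `t q`, or `x^γ` with `γ q ≠ 0` if coordinate `q` is
    -- exponential.
    by_cases hq : q.val < D.ℓ'₃
    · have hqe := evenSupp_single (D := D) (Nat.lt_of_lt_of_le (m := D.ℓ'₃) hq (Nat.le_add_right _ _)) 1
      have hqJ := e_mem_J hq
      exact (cocycleAt hψ (x_mem_comp_zero hpe 0)).exists_eq_of_pair
        (br_even (x_mem_comp_zero hqe 0)) (t_heisenberg hp) (t_heisenberg hq)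
        (adj_eq_zero_iff.2 (hpe.commute_x hpJ hqJ 0 0)) (adj_eq_zero_iff.2 hd.neg_right)
        (hpe.nilpotent hpJ 0) (hqe.nilpotent hqJ 0)
    · obtain ⟨γ, hγ⟩ := exists_gamma (D := D) (q := q)
        (by have := not_lt.1 hq; simp only [ℓ'₃] at this; omega) h2 (LinearMap.proj q) (by simp)
      exact (cocycleAt hψ (x_mem_comp_zero hpe 0)).exists_eq_of_pair
        (br_even (x_mem_comp_zero evenSupp_zero γ)) (t_heisenberg hp)
        (heisenberg_of_eigenvector hγ (x_mul_x_neg γ) (x_neg_mul_x γ) (d_mul_x_zero γ q))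
        (adj_eq_zero_iff.2 (hpe.commute_x hpJ zero_mem_J 0 _))
        (adj_eq_zero_iff.2 (((hpe.commute_x hpJ zero_mem_J 0 _).mul_right hd).smul_right _))
        (hpe.nilpotent hpJ 0) (evenSupp_zero.nilpotent zero_mem_J γ)
  · let p : Fin D.ℓ := ⟨0, by omega⟩
    let q : Fin D.ℓ := ⟨1, by omega⟩
    have hp4 : p.val < D.ℓ'₄ := Nat.lt_of_lt_of_le two_pos h2
    have hpq : q ≠ p := fun h => absurd (Fin.mk.inj h) one_ne_zero
    have h0 : D.ℓ₁ = 0 := by simp only [ℓ'₃] at h3; omega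
    obtain ⟨β, hβ⟩ := exists_gamma (D := D) (q := p) (h0.le.trans (Nat.zero_le _)) hp4
      (LinearMap.proj p) (by simp)
    -- Both coordinates are exponential and `z = x^β`. The operator `L = β_p ∂_q - β_q ∂_p` commutes
    -- with `x^β`, and `γ` is chosen so that `x^γ` has nonzero eigenvalue under `ad L`; the partner
    -- of `x^γ` built from `L` then commutes with `z`.
    obtain ⟨γ, hγ⟩ := exists_gamma (D := D) (q := q) (h0.le.trans (Nat.zero_le _)) h2
      (β.1 p • LinearMap.proj q - β.1 q • LinearMap.proj p) (by
        simpa [Pi.single_eq_of_ne hpq.symm] using hβ)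
    have hL : ∀ γ : D.Γ, (β.1 p • D.d q - β.1 q • D.d p) * x γ 0 =
        x γ 0 * (β.1 p • D.d q - β.1 q • D.d p) +
          ((β.1 p • LinearMap.proj q - β.1 q • LinearMap.proj p : (Fin D.ℓ → F) →ₗ[F] F) γ.1) •
            x γ 0 := by
      intro γ
      rw [sub_mul, smul_mul_assoc, smul_mul_assoc, d_mul_x_zero, d_mul_x_zero, mul_sub,
        mul_smul_comm, mul_smul_comm]
      simp only [LinearMap.sub_apply, LinearMap.smul_apply, LinearMap.proj_apply, smul_eq_mul]
      module
    have hβL : Commute (x β 0) (β.1 p • D.d q - β.1 q • D.d p) := by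
      rw [Commute, SemiconjBy, hL]
      simp [mul_comm]
    exact (cocycleAt hψ (x_mem_comp_zero evenSupp_zero β)).exists_eq_of_pair
      (br_even (x_mem_comp_zero evenSupp_zero γ))
      (heisenberg_of_eigenvector hβ (x_mul_x_neg β) (x_neg_mul_x β) (d_mul_x_zero β p))
      (heisenberg_of_eigenvector hγ (x_mul_x_neg γ) (x_neg_mul_x γ) (hL γ))
      (adj_eq_zero_iff.2 (evenSupp_zero.commute_x zero_mem_J zero_mem_J _ _))
      (adj_eq_zero_iff.2 (((evenSupp_zero.commute_x zero_mem_J zero_mem_J _ _).mul_right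
        hβL).smul_right _))
      (evenSupp_zero.nilpotent zero_mem_J β) (evenSupp_zero.nilpotent zero_mem_J γ)

end WeylData

end WeylSuper

end

/-! ### Superbrackets of `∂_p` and `s_r` with monomials -/

noncomputable section

namespace WeylSuper

open Finset

namespace WeylData

variable {F : Type*} [Field F] {D : WeylData F}

/-! ### Brackets with generators -/

/-- With this, brackets of a generator with a monomial reduce to brackets with its factors. -/
theorem br_mul {a b c : ZMod 2} {u v w : D.R} (hu : u ∈ D.comp a) (hv : v ∈ D.comp b)
    (hw : w ∈ D.comp c) :
    D.br u (v * w) = D.br u v * w + (koszul a b : F) • (v * D.br u w) := by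
  rw [br_apply hu (mul_mem_comp hv hw), br_apply hu hv, br_apply hu hw, koszul_add_right]
  simp only [sub_mul, mul_sub, smul_sub, smul_mul_assoc, mul_smul_comm, smul_smul, mul_assoc]
  abel

theorem x_mem_comp (α : D.Γ) (k : Fin D.ℓ → ℤ) : x α k ∈ D.comp (D.deg k : ZMod 2) := by
  have := m_mem α k 0
  rwa [cz_zero, deg_zero, add_zero] at this

theorem koszul_intCast (a b : ℤ) : (koszul (a : ZMod 2) (b : ZMod 2) : F) = sgn F (a * b) := by
  have h : ∀ n : ℤ, (n : ZMod 2).val = n % 2 := fun n => by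
    have := ZMod.val_intCast (n := 2) n
    exact_mod_cast this
  have h2 : (koszul (a : ZMod 2) (b : ZMod 2) : F) = sgn F ((a % 2) * (b % 2)) := by
    rw [koszul, sgn, ← h, ← h, ← Nat.cast_mul, zpow_natCast]
  rw [h2]
  have e1 : a % 2 = a - 2 * (a / 2) := by omega
  have e2 : b % 2 = b - 2 * (b / 2) := by omega
  refine sgn_congr (-(a * (b / 2)) - (a / 2) * b + 2 * (a / 2) * (b / 2)) ?_
  rw [e1, e2]
  ring

theorem br_skew {a b : ZMod 2} {u v : D.R} (hu : u ∈ D.comp a) (hv : v ∈ D.comp b) :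
    D.br u v = -((koszul a b : F) • D.br v u) := by
  rw [br_apply hu hv, br_apply hv hu, koszul_comm b a, smul_sub, smul_smul, koszul_mul_self,
    one_smul]
  abel

theorem br_d_d (p q : Fin D.ℓ) : D.br (D.d p) (D.d q) = 0 := by
  rw [br_apply (d_mem_comp p) (d_mem_comp q), koszul_intCast]
  rcases eq_or_ne p q with rfl | hpq
  · rcases lt_or_ge p.val D.ℓ'₄ with hp | hp
    · rw [D.odd_of_lt hp, mul_zero, sgn_zero, one_smul, sub_self]
    · rw [d_sq hp, smul_zero, sub_zero]
  · rw [d_mul_d hpq, sub_self]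

theorem dm_mem_comp (μ : Fin D.ℓ → ℕ) : m 0 0 μ ∈ D.comp (D.deg (D.cz μ) : ZMod 2) := by
  have := m_mem (0 : D.Γ) 0 μ
  rwa [deg_zero, zero_add] at this

theorem br_one (u : D.R) : D.br u 1 = 0 := by
  refine hom_induction (P := fun u => D.br u 1 = 0) (fun e u hu => ?_) (fun u v hu hv => ?_) u
  · have h1 : (1 : D.R) ∈ D.comp 0 := x_mem_comp_zero evenSupp_zero 0
    rw [br_apply hu h1, koszul_zero_right]
    simp
  · rw [map_add, LinearMap.add_apply, hu, hv, add_zero]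

theorem br_d_dm (p : Fin D.ℓ) {μ : Fin D.ℓ → ℕ} (hμ : μ ∈ D.K) : D.br (D.d p) (m 0 0 μ) = 0 := by
  refine K_induction (P := fun μ => D.br (D.d p) (m 0 0 μ) = 0) (br_one _) (fun μ q _ ih => ?_) μ hμ
  rw [dm_succ, map_smul, br_mul (d_mem_comp p) (d_mem_comp q) (dm_mem_comp μ), br_d_d, ih]
  simp

theorem br_d_x (p : Fin D.ℓ) {k : Fin D.ℓ → ℤ} (hk : k ∈ D.J) (α : D.Γ) :
    D.br (D.d p) (x α k) = α.1 p • x α k + (sgn F (D.below p k) * (k p : F)) • x α (k - D.e p) := by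
  rw [br_apply (d_mem_comp p) (x_mem_comp α k), koszul_intCast, d_mul_x hk]
  abel

theorem br_d_m (p : Fin D.ℓ) {k : Fin D.ℓ → ℤ} (hk : k ∈ D.J) {μ : Fin D.ℓ → ℕ} (hμ : μ ∈ D.K)
    (α : D.Γ) : D.br (D.d p) (m α k μ) =
      α.1 p • m α k μ + (sgn F (D.below p k) * (k p : F)) • m α (k - D.e p) μ := by
  rw [← x_mul_dm hk, br_mul (d_mem_comp p) (x_mem_comp α k) (dm_mem_comp μ), br_d_dm p hμ,
    br_d_x p hk, mul_zero, smul_zero, add_zero, add_mul, smul_mul_assoc, smul_mul_assoc]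
  congr 1
  by_cases h0 : k p = 0
  · simp [h0]
  · rw [x_mul_dm (sub_e_mem_J hk h0)]

theorem e_odd_mem_J {r : Fin D.ℓ} (hr : D.ℓ'₄ ≤ r.val) : D.e r ∈ D.J := by
  intro q
  rcases eq_or_ne q r with rfl | hq
  · rw [show D.e q q = 1 from Pi.single_eq_same _ _]
    exact ⟨fun _ => zero_le_one, fun _ h => absurd h (not_lt.2 hr),
      fun _ => Or.inr rfl⟩
  · simp [Pi.single_eq_of_ne hq]

variable (D) in
/-- The odd generator `s_r`. -/
def s (r : Fin D.ℓ) : D.R := x 0 (D.e r)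

theorem s_mem_comp (r : Fin D.ℓ) : D.s r ∈ D.comp (D.odd r : ZMod 2) := by
  have := x_mem_comp (0 : D.Γ) (D.e r)
  rwa [deg_e] at this

theorem br_s_x {r : Fin D.ℓ} (hr : D.ℓ'₄ ≤ r.val) {k : Fin D.ℓ → ℤ} (hk : k ∈ D.J) (α : D.Γ) :
    D.br (D.s r) (x α k) = 0 := by
  rw [br_apply (s_mem_comp r) (x_mem_comp α k), koszul_intCast, s, x_mul_x (e_odd_mem_J hr) hk,
    x_mul_x hk (e_odd_mem_J hr), pair_e_left, pair_e_right, add_comm (0 : D.Γ), add_comm (D.e r),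
    smul_smul, ← sgn_add, odd_mul_deg, D.odd_of_le hr, one_mul]
  rcases (hk r).2.2 hr with h | h
  · rw [h, sgn_congr (a := D.below r k + 0 + D.above r k + D.above r k) (D.above r k)
      (b := D.below r k) (by ring), sub_self]
  · have : (x (α + 0) (k + D.e r) : D.R) = 0 := by
      refine mon_of_not_mem_J (not_mem_J_of_two_le hr ?_)
      simp [h]
    rw [this, smul_zero, smul_zero, sub_self]

theorem br_s_d {r : Fin D.ℓ} (hr : D.ℓ'₄ ≤ r.val) (q : Fin D.ℓ) :
    D.br (D.s r) (D.d q) = if q = r then 1 else 0 := by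
  have h := br_d_x q (e_odd_mem_J hr) (0 : D.Γ)
  rw [br_skew (s_mem_comp r) (d_mem_comp q), koszul_intCast, s, h]
  split_ifs with hq
  · subst hq
    simp [below_e, D.odd_of_le hr, x_zero]
  · simp [Pi.single_eq_of_ne hq]

theorem br_s_dm {r : Fin D.ℓ} (hr : D.ℓ'₄ ≤ r.val) {μ : Fin D.ℓ → ℕ} (hμ : μ ∈ D.K)
    (h0 : μ r = 0) : D.br (D.s r) (m 0 0 μ) = 0 := by
  refine K_induction (P := fun μ => μ r = 0 → D.br (D.s r) (m 0 0 μ) = 0) (fun _ => br_one _)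
    (fun μ q _ ih h0 => ?_) μ hμ h0
  have hq : q ≠ r := by
    rintro rfl
    simp at h0
  have h0' : μ r = 0 := by
    simp only [Pi.add_apply] at h0
    omega
  rw [dm_succ, map_smul, br_mul (s_mem_comp r) (d_mem_comp q) (dm_mem_comp μ), br_s_d hr, ih h0',
    if_neg hq]
  simp

/-- The bracket with `s_r` acts as differentiation by `∂̌_r`, since `s_r` supercommutes with all
other factors. The scalar `c` is a sign; only `c ≠ 0` matters later. -/
theorem br_s_m {r : Fin D.ℓ} (hr : D.ℓ'₄ ≤ r.val) {k : Fin D.ℓ → ℤ} (hk : k ∈ D.J)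
    {μ : Fin D.ℓ → ℕ} (hμ : μ ∈ D.K) (h0 : μ r = 0) (α : D.Γ) :
    ∃ c : F, c ≠ 0 ∧ D.br (D.s r) (m α k (μ + D.en r)) = c • m α k μ := by
  refine ⟨koszul (D.odd r : ZMod 2) (D.deg k : ZMod 2) * sgn F (D.below r (D.cz μ)), ?_, ?_⟩
  · rw [koszul_intCast, ← sgn_add]
    exact sgn_ne_zero _
  · rw [← x_mul_dm hk, br_mul (s_mem_comp r) (x_mem_comp α k) (dm_mem_comp _), br_s_x hr hk,
      dm_succ, map_smul, br_mul (s_mem_comp r) (d_mem_comp r) (dm_mem_comp μ), br_s_dm hr hμ h0,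
      br_s_d hr, if_pos rfl, ← x_mul_dm hk α μ]
    simp [smul_smul]

end WeylData

end WeylSuper

end

/-! ### Centralizers and the values that determine a class for one even coordinate -/

noncomputable section

namespace WeylSuper

open Finset

namespace WeylData

variable {F : Type*} [Field F] {D : WeylData F}

/-! ### Centralizers -/

variable (D) in
/-- The span of the monomials without `∂_p`. -/
def bsub (p : Fin D.ℓ) : Submodule F D.R :=
  Submodule.span F {v | ∃ α, ∃ k ∈ D.J, ∃ μ ∈ D.K, μ p = 0 ∧ v = m α k μ}

theorem m_mem_bsub {p : Fin D.ℓ} (α : D.Γ) (k : Fin D.ℓ → ℤ) {μ : Fin D.ℓ → ℕ} (h : μ p = 0) :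
    m α k μ ∈ D.bsub p := by
  by_cases h' : k ∈ D.J ∧ μ ∈ D.K
  · exact Submodule.subset_span ⟨α, k, h'.1, μ, h'.2, h, rfl⟩
  · have : m α k μ = 0 := dif_neg h'
    rw [this]
    exact zero_mem _

theorem bsub_induction {p : Fin D.ℓ} {M : Type*} [AddCommGroup M] [Module F M] {f : D.R →ₗ[F] M}
    {N : Submodule F M} (h : ∀ α, ∀ k ∈ D.J, ∀ μ ∈ D.K, μ p = 0 → f (m α k μ) ∈ N) {v : D.R}
    (hv : v ∈ D.bsub p) : f v ∈ N := by
  have : D.bsub p ≤ N.comap f := by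
    refine Submodule.span_le.2 ?_
    rintro _ ⟨α, k, hk, μ, hμ, h0, rfl⟩
    exact h α k hk μ hμ h0
  exact this hv

theorem x_mul_mem_bsub {p : Fin D.ℓ} {k : Fin D.ℓ → ℤ} (hk : k ∈ D.J) (α : D.Γ) {v : D.R}
    (hv : v ∈ D.bsub p) : x α k * v ∈ D.bsub p := by
  refine bsub_induction (f := LinearMap.mulLeft F (x α k)) (fun β l hl μ _ h0 => ?_) hv
  rw [LinearMap.mulLeft_apply, x_mul_m hk hl]
  exact Submodule.smul_mem _ _ (m_mem_bsub _ _ h0)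

theorem d_mul_mem_bsub {p q : Fin D.ℓ} (hpq : q ≠ p) {v : D.R} (hv : v ∈ D.bsub p) :
    D.d q * v ∈ D.bsub p := by
  refine bsub_induction (f := LinearMap.mulLeft F (D.d q)) (fun β l hl μ _ h0 => ?_) hv
  rw [LinearMap.mulLeft_apply, d_mul_m hl]
  refine add_mem (add_mem ?_ ?_) ?_ <;> refine Submodule.smul_mem _ _ (m_mem_bsub _ _ ?_)
  · exact h0
  · exact h0
  · rw [Pi.add_apply, h0, show D.en q p = 0 from Pi.single_eq_of_ne hpq.symm _, add_zero]

theorem br_d_mem_bsub {p : Fin D.ℓ} {v : D.R} (hv : v ∈ D.bsub p) :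
    D.br (D.d p) v ∈ D.bsub p := by
  refine bsub_induction (f := D.br (D.d p)) (fun β l hl μ hμ h0 => ?_) hv
  rw [br_d_m p hl hμ]
  exact add_mem (Submodule.smul_mem _ _ (m_mem_bsub _ _ h0))
    (Submodule.smul_mem _ _ (m_mem_bsub _ _ h0))

theorem d_even_mem {p : Fin D.ℓ} (hp : p.val < D.ℓ'₄) : D.d p ∈ D.comp 0 := by
  have := d_mem_comp p
  rwa [D.odd_of_lt hp, Int.cast_zero] at this

/-- Every element is a sum `∑ b_j z'^j` with `b_j` free of `∂_p` if `∂_p = b z'`. -/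
theorem mem_powSpan {p : Fin D.ℓ} (hp : p.val < D.ℓ'₄) {b z' : D.R} (hd : D.d p = b * z')
    (hb : ∀ v ∈ D.bsub p, v * b ∈ D.bsub p) (v : D.R) :
    v ∈ powSpan (LinearMap.mulRight F z') (D.bsub p) := by
  have hcomm : ∀ (u : D.R) (j : ℕ) (w : D.R),
      u * (LinearMap.mulRight F z' ^ j) w = (LinearMap.mulRight F z' ^ j) (u * w) := by
    intro u j
    induction j with
    | zero => simp
    | succ j ih =>
      intro w
      rw [pow_succ, Module.End.mul_apply, ih, Module.End.mul_apply, LinearMap.mulRight_apply,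
        LinearMap.mulRight_apply, mul_assoc]
  have hleft : ∀ u : D.R, (∀ w ∈ D.bsub p, u * w ∈ D.bsub p) →
      ∀ w ∈ powSpan (LinearMap.mulRight F z') (D.bsub p),
        u * w ∈ powSpan (LinearMap.mulRight F z') (D.bsub p) := by
    intro u hu w hw
    refine powSpan_map_le (T := LinearMap.mulLeft F u) (fun j c hc => ?_) hw
    rw [LinearMap.mulLeft_apply, hcomm]
    exact le_powSpan _ _ j (hu c hc)
  refine R.induction (P := fun v => v ∈ powSpan (LinearMap.mulRight F z') (D.bsub p))
    (fun α k hk μ hμ => ?_) (zero_mem _) (fun _ _ => add_mem) (fun c _ => Submodule.smul_mem _ c) v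
  rw [← x_mul_dm hk]
  refine hleft _ (fun w hw => x_mul_mem_bsub hk α hw) _ ?_
  refine K_induction (P := fun μ => m 0 0 μ ∈ powSpan (LinearMap.mulRight F z') (D.bsub p))
    ?_ (fun μ q _ ih => ?_) μ hμ
  · exact le_powSpan _ _ 0 (m_mem_bsub 0 0 rfl)
  · rw [dm_succ]
    refine Submodule.smul_mem _ _ ?_
    rcases eq_or_ne q p with rfl | hq
    · refine powSpan_map_le (T := LinearMap.mulLeft F (D.d q)) (fun j c hc => ?_) ih
      -- The bracket `[∂, c]` creates no new `∂`, and the other term raises the power of `z'` by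
      -- one.
      have h1 : D.d q * c = D.br (D.d q) c + (c * b) * z' := by
        rw [br_even (d_even_mem hp), adj_apply, mul_assoc, ← hd]
        abel
      have h2 : (LinearMap.mulRight F z' ^ j) ((c * b) * z') =
          (LinearMap.mulRight F z' ^ (j + 1)) (c * b) := by
        rw [pow_succ, Module.End.mul_apply, LinearMap.mulRight_apply]
      rw [LinearMap.mulLeft_apply, hcomm, h1, map_add, h2]
      exact add_mem (le_powSpan _ _ _ (br_d_mem_bsub hc)) (le_powSpan _ _ _ (hb c hc))
    · exact hleft _ (fun w hw => d_mul_mem_bsub hq hw) _ ih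

theorem commute_x_dm {k : Fin D.ℓ → ℤ} {β : D.Γ} {μ : Fin D.ℓ → ℕ} (hμ : μ ∈ D.K)
    (h : ∀ q, μ q ≠ 0 → Commute (x β k) (D.d q)) : Commute (x β k) (m 0 0 μ) := by
  refine K_induction (P := fun μ => (∀ q, μ q ≠ 0 → Commute (x β k) (D.d q)) →
    Commute (x β k) (m 0 0 μ)) (fun _ => Commute.one_right _) (fun μ p _ ih h => ?_) μ hμ h
  rw [dm_succ]
  refine Commute.smul_right (Commute.mul_right (h p (by simp)) (ih fun q hq => h q ?_)) _
  simp only [Pi.add_apply]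
  omega

/-- An even `x^{β,k}` commutes with the monomials whose `∂`-part commutes with it. -/
theorem EvenSupp.commute_bsub {p : Fin D.ℓ} {k : Fin D.ℓ → ℤ} (hk : k ∈ D.J) (h : EvenSupp k)
    {β : D.Γ} (hd : ∀ q, q ≠ p → Commute (x β k) (D.d q)) {v : D.R} (hv : v ∈ D.bsub p) :
    adj (F := F) (x β k) v = 0 := by
  refine (Submodule.mem_bot F).1 (bsub_induction (f := adj (F := F) (x β k))
    (fun α l hl μ hμ h0 => ?_) hv)
  refine (Submodule.mem_bot F).2 (adj_eq_zero_iff.2 ?_)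
  rw [← x_mul_dm hl]
  refine (h.commute_x hk hl β α).mul_right (commute_x_dm hμ fun q hq => hd q ?_)
  rintro rfl
  exact hq h0

/-! ### One even coordinate -/

variable (D) in
/-- The vector with entry `1` in the odd coordinates. -/
def topn : Fin D.ℓ → ℕ := fun p => if D.ℓ'₄ ≤ p.val then 1 else 0

variable (D) in
/-- The integral vector with entry `1` in the odd coordinates. -/
def topz : Fin D.ℓ → ℤ := fun p => if D.ℓ'₄ ≤ p.val then 1 else 0

/-- The element `x^{α,i} s_1 ⋯ s_{ℓ₅} ∂̌_1 ⋯ ∂̌_{ℓ₅}`, with `i` in the first coordinate. -/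
def top (α : D.Γ) (i : ℤ) : D.R := m α (Pi.single D.first i + D.topz) D.topn

/-- The monomials that are not divisible by `s_1 ⋯ s_{ℓ₅} ∂̌_1 ⋯ ∂̌_{ℓ₅}` are brackets. -/
theorem m_eq_br {k : Fin D.ℓ → ℤ} (hk : k ∈ D.J) {μ : Fin D.ℓ → ℕ} (hμ : μ ∈ D.K) {r : Fin D.ℓ}
    (hr : D.ℓ'₄ ≤ r.val) (h : k r ≠ 1 ∨ μ r ≠ 1) (α : D.Γ) :
    (∃ c : F, m α k μ = c • D.br (D.d r) (m α (k + D.e r) μ)) ∨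
      ∃ c : F, m α k μ = c • D.br (D.s r) (m α k (μ + D.en r)) := by
  -- If `k r = 0`, a factor `s_r` is inserted and removed by `∂̌_r`. Otherwise `k r = 1`, hence `μ r
  -- = 0`, and an inserted `∂̌_r` is removed by `s_r`.
  by_cases h0 : k r = 0
  · have hl : k + D.e r ∈ D.J := add_mem_J hk (e_odd_mem_J hr) fun q hq => by
      rcases eq_or_ne q r with rfl | hqr
      · exact Or.inl h0
      · exact Or.inr (Pi.single_eq_of_ne hqr _)
    have h1 := br_d_m r hl hμ α
    rw [D.gamma_odd α hr, zero_smul, zero_add, add_sub_cancel_right, Pi.add_apply, h0,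
      show D.e r r = 1 from Pi.single_eq_same _ _, zero_add, Int.cast_one, mul_one] at h1
    refine Or.inl ⟨(sgn F (D.below r (k + D.e r)))⁻¹, ?_⟩
    rw [h1, smul_smul, inv_mul_cancel₀ (sgn_ne_zero _), one_smul]
  · have h1 := (hk r).2.2 hr
    have h2 := hμ r hr
    obtain ⟨c, hc, hbr⟩ := br_s_m hr hk hμ (show μ r = 0 by omega) α
    refine Or.inr ⟨c⁻¹, ?_⟩
    rw [hbr, smul_smul, inv_mul_cancel₀ hc, one_smul]

/-- A functional on the span of the monomials free of `∂_1` that vanishes on brackets is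
determined by the top monomials, if there is one even coordinate. -/
theorem eq_zero_of_top (h4 : D.ℓ'₄ = 1) {τ : D.R →ₗ[F] F}
    (hbr : ∀ u v, (u ∈ D.bsub D.first ∨ ∃ r : Fin D.ℓ, D.ℓ'₄ ≤ r.val ∧ u = D.d r) →
      v ∈ D.bsub D.first → τ (D.br u v) = 0)
    (htop : ∀ α i, τ (top α i) = 0) {c : D.R} (hc : c ∈ D.bsub D.first) : τ c = 0 := by
  refine (Submodule.mem_bot F).1 (bsub_induction (f := τ) (fun α k hk μ hμ h0 => ?_) hc)
  rw [Submodule.mem_bot]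
  have hfirst : ∀ r : Fin D.ℓ, r ≠ D.first → D.ℓ'₄ ≤ r.val := fun r hr => by
    rw [h4, Nat.one_le_iff_ne_zero]
    exact fun h => hr (Fin.ext h)
  by_cases hk1 : ∃ r : Fin D.ℓ, D.ℓ'₄ ≤ r.val ∧ (k r ≠ 1 ∨ μ r ≠ 1)
  · obtain ⟨r, hr, h⟩ := hk1
    rcases m_eq_br hk hμ hr h α with ⟨c, hc⟩ | ⟨c, hc⟩
    · rw [hc, map_smul, hbr _ _ (Or.inr ⟨r, hr, rfl⟩) (m_mem_bsub _ _ h0), smul_zero]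
    · have hne : D.first ≠ r := fun h => D.mon₁_aux hr h.symm
      rw [hc, map_smul, hbr (D.s r) _ (Or.inl (m_mem_bsub _ _ rfl)) (m_mem_bsub α k (by
        rw [Pi.add_apply, h0, show D.en r D.first = 0 from Pi.single_eq_of_ne hne _, add_zero])),
        smul_zero]
  push Not at hk1
  have h3 : ¬ D.ℓ'₄ ≤ D.first.val := fun h => D.mon₁_aux h rfl
  have h1 : k = Pi.single D.first (k D.first) + D.topz := by
    ext r
    rcases eq_or_ne r D.first with rfl | hr
    · simp [topz, h3]
    · rw [Pi.add_apply, Pi.single_eq_of_ne hr, topz, if_pos (hfirst r hr),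
        (hk1 r (hfirst r hr)).1, zero_add]
  have h2 : μ = D.topn := by
    ext r
    rcases eq_or_ne r D.first with rfl | hr
    · rw [h0, topn, if_neg h3]
    · rw [topn, if_pos (hfirst r hr), (hk1 r (hfirst r hr)).2]
  rw [h1, h2]
  exact htop α _

theorem topn_mem_K : D.topn ∈ D.K := fun p hp => by simp [topn, hp]

theorem topn_first : D.topn D.first = 0 := if_neg fun h => D.mon₁_aux h rfl

theorem top_mem_bsub (α : D.Γ) (i : ℤ) : top α i ∈ D.bsub D.first := m_mem_bsub _ _ topn_first

theorem top_mem_J (h4 : D.ℓ'₄ = 1) (i : ℤ) (h0 : D.ℓ₃ = 1 ∨ i = 0) :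
    Pi.single D.first i + D.topz ∈ D.J := by
  intro p
  rcases eq_or_ne p D.first with rfl | hr
  · have h : ¬ D.ℓ'₄ ≤ D.first.val := fun h => D.mon₁_aux h rfl
    rw [Pi.add_apply, Pi.single_eq_same, topz, if_neg h, add_zero]
    have hv : D.first.val = 0 := rfl
    simp only [ℓ'₄, ℓ'₂, ℓ'₃] at h4 h ⊢
    refine ⟨fun h' => ?_, fun h' h'' => ?_, fun h' => absurd h' h⟩ <;> omega
  · have h : D.ℓ'₄ ≤ p.val := by
      rw [h4, Nat.one_le_iff_ne_zero]
      exact fun h => hr (Fin.ext h)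
    rw [Pi.add_apply, Pi.single_eq_of_ne hr, topz, if_pos h]
    simp only [ℓ'₄, ℓ'₂, ℓ'₃] at h ⊢
    refine ⟨fun h' => ?_, fun h' h'' => ?_, fun h' => ?_⟩ <;> omega

/-- Under `ψ(z, ·)` this becomes a relation among the values on top monomials, and it decides how
many of them are free. -/
theorem br_d_top (h4 : D.ℓ'₄ = 1) {i : ℤ} (h0 : D.ℓ₃ = 1 ∨ i = 0) (α : D.Γ) :
    D.br (D.d D.first) (top α i) = α.1 D.first • top α i + (i : F) • top α (i - 1) := by
  have h : ¬ D.ℓ'₄ ≤ D.first.val := fun h => D.mon₁_aux h rfl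
  rw [top, br_d_m _ (top_mem_J h4 i h0) topn_mem_K, D.below_of_lt (not_le.1 h), sgn_zero, one_mul,
    Pi.add_apply, Pi.single_eq_same, topz, if_neg h, add_zero, top, Pi.single_sub]
  congr 3
  abel

section CharZero

variable [CharZero F]

/-- Every `v` is some `[z, w]`, and `1` is central, so both terms of the cocycle identity vanish. -/
theorem form_one {ψ : D.W →ₗ[F] D.W →ₗ[F] F} (hψ : ψ ∈ D.C2) {z z' : D.R} (hz : z ∈ D.comp 0)
    (hzz : z * z' - z' * z = 1) (hnil : ∀ v, ∃ n : ℕ, (adj (F := F) z ^ n) v = 0) (v : D.R) :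
    D.form ψ 1 v = 0 := by
  obtain ⟨w, -, rfl⟩ := heisenberg_surjective (adj_heisenberg hzz) hnil ⊤ (by simp) (by simp)
    (Submodule.mem_top (x := v))
  have h1 : (1 : D.R) ∈ D.comp 0 := x_mem_comp_zero evenSupp_zero 0
  have h2 : ∀ w : D.R, adj (F := F) (1 : D.R) w = 0 := fun w =>
    adj_eq_zero_iff.2 (Commute.one_left w)
  have h3 : D.form ψ 1 (D.br z w) = D.form ψ (adj (F := F) 1 z) w +
      D.form ψ z (adj (F := F) 1 w) := (cocycleAt hψ h1).cocycle z w
  rw [h2, h2, map_zero, map_zero, LinearMap.zero_apply, add_zero] at h3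
  rwa [br_even hz] at h3

/-- `ψ(t_p, [∂_p, c]) = 0` for `c` in the centralizer of `t_p`. -/
theorem form_t_br {ψ : D.W →ₗ[F] D.W →ₗ[F] F} (hψ : ψ ∈ D.C2) {p : Fin D.ℓ}
    (hp : p.val < D.ℓ'₃) {c : D.R} (hc : c ∈ D.bsub p) :
    D.form ψ (t p) (D.br (D.d p) c) = 0 := by
  have hp4 : p.val < D.ℓ'₄ := hp.trans_le (Nat.le_add_right _ _)
  have he := evenSupp_single (D := D) hp4 1
  have hz := x_mem_comp_zero he 0
  have h1 : adj (F := F) (t p) (D.d p) = -1 := by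
    rw [adj_apply, d_mul_t hp, if_pos rfl]
    abel
  have h2 : adj (F := F) (t p) c = 0 := EvenSupp.commute_bsub (e_mem_J hp) he (fun q hq => by
    rw [← t, Commute, SemiconjBy, d_mul_t hp, if_neg hq, add_zero]) hc
  have h3 : D.form ψ (t p) (D.br (D.d p) c) = D.form ψ (adj (F := F) (t p) (D.d p)) c +
      D.form ψ (D.d p) (adj (F := F) (t p) c) := (cocycleAt hψ hz).cocycle (D.d p) c
  rw [h3, h1, h2, map_neg, LinearMap.neg_apply, map_zero, add_zero,
    form_one hψ hz (t_heisenberg hp) (he.nilpotent (e_mem_J hp) 0), neg_zero]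

/-- A cocycle is a coboundary if `ψ(t_p, ·)` vanishes on the monomials free of `∂_p`. -/
theorem exists_of_t {ψ : D.W →ₗ[F] D.W →ₗ[F] F} (hψ : ψ ∈ D.C2) {p : Fin D.ℓ}
    (hp : p.val < D.ℓ'₃) (h : ∀ c ∈ D.bsub p, D.form ψ (t p) c = 0) : ψ ∈ D.B2 := by
  have hp4 : p.val < D.ℓ'₄ := hp.trans_le (Nat.le_add_right _ _)
  have he := evenSupp_single (D := D) hp4 1
  refine mem_B2_of_form ((cocycleAt hψ (x_mem_comp_zero he 0)).exists_eq (t_heisenberg hp)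
    (he.nilpotent (e_mem_J hp) 0) fun c hc => h c ?_)
  refine mem_of_heisenberg (adj_heisenberg (F := F) (t_heisenberg hp)) (fun b hb => ?_)
    (mem_powSpan hp4 (b := -1) (by simp) (fun v hv => by simpa using hv) c) hc
  exact EvenSupp.commute_bsub (e_mem_J hp) he (fun q hq => by
    rw [← t, Commute, SemiconjBy, d_mul_t hp, if_neg hq, add_zero]) hb

/-- Every cocycle is a coboundary if one of the coordinates is of polynomial type. -/
theorem mem_B2_of_poly (h : 1 ≤ D.ℓ'₂) {ψ : D.W →ₗ[F] D.W →ₗ[F] F} (hψ : ψ ∈ D.C2) :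
    ψ ∈ D.B2 := by
  have hp2 : D.first.val < D.ℓ'₂ := h
  have hp3 : D.first.val < D.ℓ'₃ := hp2.trans_le (Nat.le_add_right _ _)
  refine exists_of_t hψ hp3 fun c hc => (Submodule.mem_bot F).1 (bsub_induction
    (f := D.form ψ (t D.first)) (fun α k hk μ hμ h0 => ?_) hc)
  rw [Submodule.mem_bot]
  have hb : D.below D.first = fun _ => 0 :=
    funext fun f => D.below_of_lt (hp3.trans_le (Nat.le_add_right _ _)) f
  -- For `α_1 = 0` this relation is used at `l = k + 1_1`, whose first entry is nonzero because
  -- exponents are nonnegative. For `α_1 ≠ 0` it starts at first exponent `0`, where the second term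
  -- is absent, and ascends.
  have key : ∀ l ∈ D.J, α.1 D.first * D.form ψ (t D.first) (m α l μ) +
      (l D.first : F) * D.form ψ (t D.first) (m α (l - D.e D.first) μ) = 0 := by
    intro l hl
    have := form_t_br hψ hp3 (m_mem_bsub α l h0)
    rwa [br_d_m _ hl hμ, hb, sgn_zero, one_mul, map_add, map_smul, map_smul] at this
  by_cases hα : α.1 D.first = 0
  · have hl : k + D.e D.first ∈ D.J := add_mem_J hk (e_mem_J hp3) fun q hq => Or.inr
      (evenSupp_single (D := D) (hp3.trans_le (Nat.le_add_right _ _)) 1 q hq)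
    have h1 := key _ hl
    rw [hα, zero_mul, zero_add, add_sub_cancel_right] at h1
    refine (mul_eq_zero.1 h1).resolve_left ?_
    have h2 := (hk D.first).1 hp2
    rw [Pi.add_apply, show D.e D.first D.first = 1 from Pi.single_eq_same _ _]
    exact Int.cast_ne_zero.2 (by omega)
  · obtain ⟨n, hn⟩ := Int.eq_ofNat_of_zero_le ((hk D.first).1 hp2)
    induction n generalizing k with
    | zero =>
      have h1 := key k hk
      rw [hn] at h1
      simpa [hα] using h1
    | succ n ih =>
      have hne : k D.first ≠ 0 := by omega
      have h1 := key k hk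
      rw [ih _ (sub_e_mem_J hk hne) (by
        rw [Pi.sub_apply, show D.e D.first D.first = 1 from Pi.single_eq_same _ _, hn]
        push_cast
        ring), mul_zero, add_zero] at h1
      exact (mul_eq_zero.1 h1).resolve_left hα

/-- The cocycle is a coboundary if it vanishes on `t_1` and the elements dual to the residues. -/
theorem mem_B2_of_laurent (h4 : D.ℓ'₄ = 1) (h3 : D.ℓ₃ = 1) {ψ : D.W →ₗ[F] D.W →ₗ[F] F}
    (hψ : ψ ∈ D.C2) (h : ∀ γ, D.form ψ (t D.first) (top γ (-1)) = 0) : ψ ∈ D.B2 := by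
  have hp3 : D.first.val < D.ℓ'₃ := by
    simp only [ℓ'₃, first]
    omega
  have hp4 : D.first.val < D.ℓ'₄ := hp3.trans_le (Nat.le_add_right _ _)
  have he := evenSupp_single (D := D) hp4 1
  have hcomm : ∀ c ∈ D.bsub D.first, adj (F := F) (t D.first) c = 0 := fun c hc =>
    EvenSupp.commute_bsub (e_mem_J hp3) he (fun q hq => by
      rw [← t, Commute, SemiconjBy, d_mul_t hp3, if_neg hq, add_zero]) hc
  refine exists_of_t hψ hp3 fun c hc => eq_zero_of_top h4 (τ := D.form ψ (t D.first))
    (fun u v hu hv => ?_) (fun α i => ?_) hc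
  · refine (cocycleAt hψ (x_mem_comp_zero he 0)).eq_zero ?_ (hcomm v hv)
    rcases hu with hu | ⟨r, hr, rfl⟩
    · exact hcomm u hu
    · exact adj_eq_zero_iff.2 (he.commute_d_odd (e_mem_J hp3) 0 hr)
  -- Downwards from `i = -1` the relation determines the values by division by `i ≠ 0`. At `i = 0`
  -- it does not involve the value at `-1`, which is why that value has to be assumed zero.
  -- Nonnegative indices vanish anyway: for `α_1 = 0` by the relation one step higher, for `α_1 ≠ 0`
  -- by ascending from `i = 0`.
  · have key : ∀ i : ℤ, α.1 D.first * D.form ψ (t D.first) (top α i) +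
        (i : F) * D.form ψ (t D.first) (top α (i - 1)) = 0 := fun i => by
      have := form_t_br hψ hp3 (top_mem_bsub α i)
      rwa [br_d_top h4 (Or.inl h3), map_add, map_smul, map_smul] at this
    have hneg : ∀ n : ℕ, D.form ψ (t D.first) (top α (-1 - n)) = 0 := by
      intro n
      induction n with
      | zero => simpa using h α
      | succ n ih =>
        have h1 := key (-1 - n)
        rw [ih, mul_zero, zero_add] at h1
        rw [show (-1 - ((n + 1 : ℕ) : ℤ)) = -1 - n - 1 by push_cast; ring]
        exact (mul_eq_zero.1 h1).resolve_left (Int.cast_ne_zero.2 (by omega))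
    rcases lt_or_ge i 0 with hi | hi
    · obtain ⟨n, hn⟩ := Int.eq_ofNat_of_zero_le (show 0 ≤ -1 - i by omega)
      rw [show i = -1 - (n : ℤ) by omega]
      exact hneg n
    · obtain ⟨n, rfl⟩ := Int.eq_ofNat_of_zero_le hi
      by_cases hα : α.1 D.first = 0
      · have h1 := key (n + 1)
        rw [hα, zero_mul, zero_add, add_sub_cancel_right] at h1
        exact (mul_eq_zero.1 h1).resolve_left (Int.cast_ne_zero.2 (by omega))
      · induction n with
        | zero =>
          have h1 := key 0
          rw [Int.cast_zero, zero_mul, add_zero] at h1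
          exact (mul_eq_zero.1 h1).resolve_left hα
        | succ n ih =>
          have h1 := key (n + 1)
          rw [add_sub_cancel_right, ih (by omega), mul_zero, add_zero] at h1
          exact (mul_eq_zero.1 h1).resolve_left hα

/-- The cocycle is a coboundary if it vanishes on one pair of elements. -/
theorem mem_B2_of_exp (h4 : D.ℓ'₄ = 1) {β : D.Γ} (hβ : β.1 D.first ≠ 0)
    (h44 : D.ℓ₄ = 1) {ψ : D.W →ₗ[F] D.W →ₗ[F] F}
    (hψ : ψ ∈ D.C2) (h : D.form ψ (x β 0) (top (-β) 0) = 0) : ψ ∈ D.B2 := by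
  have hp4 : D.first.val < D.ℓ'₄ := not_le.1 fun h => D.mon₁_aux h rfl
  have hz := x_mem_comp_zero evenSupp_zero β
  have hodd : ∀ q, q ≠ D.first → Commute (x β 0) (D.d q) := fun q hq =>
    evenSupp_zero.commute_d_odd zero_mem_J β (by
      rw [h4, Nat.one_le_iff_ne_zero]
      exact fun h => hq (Fin.ext h))
  have hcomm : ∀ c ∈ D.bsub D.first, adj (F := F) (x β 0) c = 0 := fun c hc =>
    EvenSupp.commute_bsub zero_mem_J evenSupp_zero hodd hc
  have hheis := heisenberg_of_eigenvector hβ (x_mul_x_neg β) (x_neg_mul_x β) (d_mul_x_zero β D.first)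
  refine mem_B2_of_form ((cocycleAt hψ hz).exists_eq hheis (evenSupp_zero.nilpotent zero_mem_J β)
    fun c hc => ?_)
  -- Here `z' = -β_1⁻¹ x^{-β} ∂_1`, so `∂_1 = b z'` with `b = -β_1 x^β` free of `∂_1`.
  have hc' : c ∈ D.bsub D.first := by
    refine mem_of_heisenberg (adj_heisenberg (F := F) hheis) hcomm
      (mem_powSpan hp4 (b := -β.1 D.first • x β 0) ?_ (fun v hv => ?_) c) hc
    · rw [smul_mul_assoc, mul_smul_comm, ← mul_assoc, x_mul_x_neg, one_mul, smul_smul, neg_mul_neg,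
        mul_inv_cancel₀ hβ, one_smul]
    · have h1 : x β 0 * v = v * x β 0 := adj_eq_zero_iff.1 (hcomm v hv)
      rw [mul_smul_comm, ← h1]
      exact Submodule.smul_mem _ _ (x_mul_mem_bsub zero_mem_J β hv)
  refine eq_zero_of_top h4 (τ := D.form ψ (x β 0)) (fun u v hu hv => ?_) (fun α i => ?_) hc'
  · refine (cocycleAt hψ hz).eq_zero ?_ (hcomm v hv)
    rcases hu with hu | ⟨r, hr, rfl⟩
    · exact hcomm u hu
    · exact adj_eq_zero_iff.2 (evenSupp_zero.commute_d_odd zero_mem_J β hr)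
  · by_cases hi : i = 0
    · subst hi
      -- Since `[x^β, ∂_1] = -β_1 x^β`, this gives `(α_1 + β_1) ψ(x^β, top α 0) = 0`, so only `α_1 =
      -- -β_1` can contribute.
      have h1 : D.form ψ (x β 0) (D.br (D.d D.first) (top α 0)) =
          D.form ψ (adj (F := F) (x β 0) (D.d D.first)) (top α 0) +
            D.form ψ (D.d D.first) (adj (F := F) (x β 0) (top α 0)) :=
        (cocycleAt hψ hz).cocycle _ _
      rw [br_d_top h4 (i := 0) (Or.inr rfl), Int.cast_zero, zero_smul, add_zero, map_smul,
        hcomm _ (top_mem_bsub α 0), map_zero, add_zero, adj_apply, d_mul_x_zero,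
        sub_add_cancel_left, map_neg, LinearMap.neg_apply, map_smul, LinearMap.smul_apply,
        smul_eq_mul, smul_eq_mul, ← sub_eq_zero, sub_neg_eq_add, ← add_mul] at h1
      by_cases hα : α.1 D.first + β.1 D.first = 0
      · have : α = -β := by
          refine eq_neg_of_add_eq_zero_left (Subtype.ext (funext fun q => ?_))
          rcases eq_or_ne q D.first with rfl | hq
          · exact hα
          · exact D.gamma_odd (α + β) (by
              rw [h4, Nat.one_le_iff_ne_zero]
              exact fun h => hq (Fin.ext h))
        rw [this]
        exact h
      · exact (mul_eq_zero.1 h1).resolve_left hα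
    · have : top α i = 0 := by
        refine mon_of_not_mem_J fun hJ => hi ?_
        have h2 := (hJ D.first).2.1 (by
          simp only [ℓ'₃, ℓ'₄, first] at h4 ⊢
          omega) hp4
        rwa [Pi.add_apply, Pi.single_eq_same, topz, if_neg (not_le.2 hp4), add_zero] at h2
      rw [this, map_zero]

end CharZero

end WeylData

end WeylSuper

end

/-! ### Existence and uniqueness of the functional `P` -/

noncomputable section

namespace WeylSuper

open Finset

namespace WeylData

variable {F : Type*} [Field F] {D : WeylData F}

/-! ### The supertrace -/

theorem topz_mem_J : D.topz ∈ D.J := by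
  intro p
  by_cases h : D.ℓ'₄ ≤ p.val
  · rw [topz, if_pos h]
    exact ⟨fun _ => zero_le_one, fun _ h' => absurd h' (not_lt.2 h), fun _ => Or.inr rfl⟩
  · rw [topz, if_neg h]
    exact ⟨fun _ => le_rfl, fun _ _ => rfl, fun _ => Or.inl rfl⟩

variable (D) in
/-- The coefficient of `s_1 ⋯ s_{ℓ₅} ∂̌_1 ⋯ ∂̌_{ℓ₅}`. -/
def str : D.R →ₗ[F] F :=
  (Finsupp.lapply ((0 : D.Γ), (⟨D.topz, topz_mem_J⟩ : D.J), (⟨D.topn, topn_mem_K⟩ : D.K)) :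
    D.W →ₗ[F] F)

theorem str_top : D.str (m 0 D.topz D.topn) = 1 := by
  rw [m, mon_of_mem topz_mem_J topn_mem_K]
  exact Finsupp.single_eq_same

theorem str_m {k : Fin D.ℓ → ℤ} {μ : Fin D.ℓ → ℕ} (h : k ≠ D.topz ∨ μ ≠ D.topn) (α : D.Γ) :
    D.str (m α k μ) = 0 := by
  by_cases h' : k ∈ D.J ∧ μ ∈ D.K
  · rw [m, mon_of_mem h'.1 h'.2]
    refine Finsupp.single_eq_of_ne fun he => ?_
    rw [Prod.ext_iff, Prod.ext_iff] at he
    rcases h with h | h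
    · exact h (congrArg Subtype.val he.2.1).symm
    · exact h (congrArg Subtype.val he.2.2).symm
  · have : m α k μ = 0 := dif_neg h'
    rw [this, map_zero]

/-- The bracket lowers the exponent of `s_r`, so the top exponent `1` is never reached. -/
theorem str_br_d {r : Fin D.ℓ} (hr : D.ℓ'₄ ≤ r.val) (w : D.R) : D.str (D.br (D.d r) w) = 0 := by
  suffices H : D.str ∘ₗ D.br (D.d r) = 0 from LinearMap.congr_fun H w
  refine R.ext_m fun α k hk μ hμ => ?_
  rw [LinearMap.comp_apply, br_d_m r hk hμ, D.gamma_odd α hr, zero_smul, zero_add, map_smul, str_m,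
    smul_zero, LinearMap.zero_apply]
  refine Or.inl fun h => ?_
  have h1 := congrFun h r
  rw [Pi.sub_apply, show D.e r r = 1 from Pi.single_eq_same _ _, topz, if_pos hr] at h1
  have := (hk r).2.2 hr
  omega

theorem br_s_m_zero {r : Fin D.ℓ} (hr : D.ℓ'₄ ≤ r.val) {k : Fin D.ℓ → ℤ} (hk : k ∈ D.J)
    {μ : Fin D.ℓ → ℕ} (hμ : μ ∈ D.K) (h0 : μ r = 0) (α : D.Γ) :
    D.br (D.s r) (m α k μ) = 0 := by
  rw [← x_mul_dm hk, br_mul (s_mem_comp r) (x_mem_comp α k) (dm_mem_comp _), br_s_x hr hk,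
    br_s_dm hr hμ h0]
  simp

/-- The bracket lowers the exponent of `∂̌_r`, so the top exponent `1` is never reached. -/
theorem str_br_s {r : Fin D.ℓ} (hr : D.ℓ'₄ ≤ r.val) (w : D.R) : D.str (D.br (D.s r) w) = 0 := by
  suffices H : D.str ∘ₗ D.br (D.s r) = 0 from LinearMap.congr_fun H w
  refine R.ext_m fun α k hk μ hμ => ?_
  rw [LinearMap.comp_apply, LinearMap.zero_apply]
  by_cases h0 : μ r = 0
  · rw [br_s_m_zero hr hk hμ h0, map_zero]
  · have h1 : D.en r ≤ μ := fun q => by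
      rcases eq_or_ne q r with rfl | hq
      · rw [show D.en q q = 1 from Pi.single_eq_same _ _]
        exact Nat.one_le_iff_ne_zero.2 h0
      · rw [show D.en r q = 0 from Pi.single_eq_of_ne hq _]
        exact Nat.zero_le _
    have h2 : (μ - D.en r) r = 0 := by
      rw [Pi.sub_apply, show D.en r r = 1 from Pi.single_eq_same _ _]
      have := hμ r hr
      omega
    obtain ⟨c, -, h3⟩ := br_s_m hr hk (K_of_le (ν := μ - D.en r) (fun q => Nat.sub_le (μ q) (D.en r q)) hμ) h2 α
    rw [tsub_add_cancel_of_le h1] at h3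
    rw [h3, map_smul, str_m, smul_zero]
    refine Or.inr fun h => ?_
    rw [h, topn, if_pos hr] at h2
    exact one_ne_zero h2

variable (D) in
/-- The homogeneous elements `z` of parity `a` with `str [z, w] = 0` for all `w`. -/
def Cyclic (a : ZMod 2) (z : D.R) : Prop := z ∈ D.comp a ∧ ∀ w, D.str (D.br z w) = 0

/-- Unlike the Leibniz rule, this leaves whole brackets on the right, to which `str` applies. It
makes the elements with `str [z, ·] = 0` closed under products. -/
theorem br_mul_left {a b c : ZMod 2} {u v w : D.R} (hu : u ∈ D.comp a) (hv : v ∈ D.comp b)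
    (hw : w ∈ D.comp c) :
    D.br (u * v) w = D.br u (v * w) + (koszul a (b + c) : F) • D.br v (w * u) := by
  rw [br_apply (mul_mem_comp hu hv) hw, br_apply hu (mul_mem_comp hv hw),
    br_apply hv (mul_mem_comp hw hu), smul_sub, smul_smul, koszul_add_left, koszul_add_right,
    koszul_add_right, koszul_comm b a]
  have h := koszul_mul_self (F := F) a b
  rw [show koszul a b * koszul a c * (koszul b c * koszul a b) =
    (koszul a b * koszul a b : F) * (koszul a c * koszul b c) by ring, h, one_mul, mul_assoc,
    mul_assoc, mul_assoc]
  abel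

theorem Cyclic.mul {a b : ZMod 2} {u v : D.R} (hu : D.Cyclic a u) (hv : D.Cyclic b v) :
    D.Cyclic (a + b) (u * v) := by
  refine ⟨mul_mem_comp hu.1 hv.1, hom_induction (fun c w hw => ?_) fun w w' h h' => ?_⟩
  · rw [br_mul_left hu.1 hv.1 hw, map_add, map_smul, hu.2, hv.2, smul_zero, add_zero]
  · rw [map_add, map_add, h, h', add_zero]

theorem Cyclic.smul {a : ZMod 2} {u : D.R} (hu : D.Cyclic a u) (c : F) : D.Cyclic a (c • u) :=
  ⟨Submodule.smul_mem _ _ hu.1, fun w => by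
    rw [map_smul, LinearMap.smul_apply, map_smul, hu.2, smul_zero]⟩

theorem cyclic_one : D.Cyclic 0 1 := by
  have h : (1 : D.R) ∈ D.comp 0 := x_mem_comp_zero evenSupp_zero 0
  refine ⟨h, fun w => ?_⟩
  rw [br_even h, adj_eq_zero_iff.2 (Commute.one_left w), map_zero]

variable (D) in
/-- The vectors supported in the odd coordinates. -/
def OddSupp {M : Type*} [Zero M] (k : Fin D.ℓ → M) : Prop := ∀ p : Fin D.ℓ, p.val < D.ℓ'₄ → k p = 0

theorem oddSupp_of_add {μ : Fin D.ℓ → ℕ} {p : Fin D.ℓ} (h : D.OddSupp (μ + D.en p)) :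
    D.OddSupp μ ∧ D.ℓ'₄ ≤ p.val := by
  refine ⟨fun q hq => ?_, ?_⟩
  · have := h q hq
    rw [Pi.add_apply] at this
    omega
  · by_contra hp
    have := h p (not_le.1 hp)
    rw [Pi.add_apply, show D.en p p = 1 from Pi.single_eq_same _ _] at this
    omega

theorem cyclic_dm {μ : Fin D.ℓ → ℕ} (hμ : μ ∈ D.K) (ho : D.OddSupp μ) :
    ∃ a, D.Cyclic a (m 0 0 μ) := by
  refine K_induction (P := fun μ => D.OddSupp μ → ∃ a, D.Cyclic a (m 0 0 μ))
    (fun _ => ⟨0, cyclic_one⟩) (fun μ p _ ih h => ?_) μ hμ ho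
  obtain ⟨h1, h2⟩ := oddSupp_of_add h
  obtain ⟨a, ha⟩ := ih h1
  rw [dm_succ]
  exact ⟨_, (Cyclic.mul ⟨d_mem_comp p, str_br_d h2⟩ ha).smul _⟩

theorem cz_mem_J {μ : Fin D.ℓ → ℕ} (hμ : μ ∈ D.K) (ho : D.OddSupp μ) : D.cz μ ∈ D.J := by
  intro p
  refine ⟨fun _ => Int.natCast_nonneg _, fun _ h => ?_, fun h => ?_⟩
  · rw [cz, ho p h, Nat.cast_zero]
  · have := hμ p h
    rw [cz]
    omega

theorem cyclic_cz {μ : Fin D.ℓ → ℕ} (hμ : μ ∈ D.K) (ho : D.OddSupp μ) :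
    ∃ a, D.Cyclic a (x 0 (D.cz μ)) := by
  refine K_induction (P := fun μ => D.OddSupp μ → ∃ a, D.Cyclic a (x 0 (D.cz μ)))
    (fun _ => ⟨0, by rw [cz_zero]; exact cyclic_one⟩) (fun μ p hK ih h => ?_) μ hμ ho
  obtain ⟨h1, h2⟩ := oddSupp_of_add h
  obtain ⟨a, ha⟩ := ih h1
  have h3 : x 0 (D.cz (μ + D.en p)) =
      sgn F (D.pair (D.e p) (D.cz μ)) • (D.s p * x 0 (D.cz μ)) := by
    rw [s, x_mul_x (e_odd_mem_J h2)
      (cz_mem_J (K_of_le (fun q => Nat.le_add_right _ _) hK) h1), smul_smul, sgn_mul_self,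
      one_smul, cz_add, cz_en, add_zero, add_comm (D.e p)]
  rw [h3]
  exact ⟨_, (Cyclic.mul ⟨s_mem_comp p, str_br_s h2⟩ ha).smul _⟩

/-- Up to sign a monomial of `𝒲₁` is a product of elements `s_r` and odd `∂_r`, and `Cyclic.mul`
applies. -/
theorem cyclic_m {k : Fin D.ℓ → ℤ} (hk : k ∈ D.J) (hko : D.OddSupp k) {μ : Fin D.ℓ → ℕ}
    (hμ : μ ∈ D.K) (hμo : D.OddSupp μ) : ∃ a, D.Cyclic a (m 0 k μ) := by
  have h : k = D.cz fun p => (k p).toNat := by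
    ext p
    rw [cz]
    rcases lt_or_ge p.val D.ℓ'₄ with h | h
    · simp [hko p h]
    · have := (hk p).2.2 h
      omega
  obtain ⟨a, ha⟩ := cyclic_dm hμ hμo
  obtain ⟨b, hb⟩ := cyclic_cz (μ := fun p => (k p).toNat) (fun p hp => by
    rcases (hk p).2.2 hp with h | h <;> simp [h]) (fun p hp => by simp [hko p hp])
  rw [← h] at hb
  rw [← x_mul_dm hk]
  exact ⟨_, hb.mul ha⟩

variable (D) in
/-- The Grassmann part as a subspace of the algebra. -/
def R₁ : Submodule F D.R := D.W₁

theorem R₁_le {N : Submodule F D.R} (h : ∀ k ∈ D.J, ∀ μ ∈ D.K, D.OddSupp k → D.OddSupp μ →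
    m 0 k μ ∈ N) : D.R₁ ≤ N := by
  intro u hu
  have h1 : u ∈ Finsupp.supported F F
    {a : D.Idx | a.1 = 0 ∧ ∀ p : Fin D.ℓ, p.val < D.ℓ'₄ → a.2.1.1 p = 0 ∧ a.2.2.1 p = 0} := hu
  rw [Finsupp.supported_eq_span_single] at h1
  refine (Submodule.span_le (p := N)).2 ?_ h1
  rintro _ ⟨⟨α, k, μ⟩, ⟨h0, h2⟩, rfl⟩
  change α = 0 at h0
  subst h0
  change (Finsupp.single _ 1 : D.W) ∈ N
  rw [single_eq_mon]
  exact h k k.2 μ μ.2 (fun p hp => (h2 p hp).1) fun p hp => (h2 p hp).2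

theorem str_br {u : D.R} (hu : u ∈ D.R₁) (w : D.R) : D.str (D.br u w) = 0 := by
  have : D.R₁ ≤ LinearMap.ker (D.str ∘ₗ D.br.flip w) := R₁_le fun k hk μ hμ h h' => by
    obtain ⟨a, ha⟩ := cyclic_m hk h hμ h'
    exact ha.2 w
  exact this hu

theorem str_mul_comm {a b : ZMod 2} {u v : D.R} (hu : u ∈ D.R₁) (hua : u ∈ D.comp a)
    (hvb : v ∈ D.comp b) : D.str (u * v) = koszul a b * D.str (v * u) := by
  have h := str_br hu v
  rw [br_apply hua hvb, map_sub, map_smul, sub_eq_zero] at h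
  exact h

variable (D) in
/-- The restriction of the supertrace to `𝒲₁`. -/
def strW : D.W₁ →ₗ[F] F := D.str ∘ₗ (Submodule.subtype D.R₁)

theorem isSupertrace_strW : D.IsSupertrace D.strW :=
  ⟨str_top, fun u v => str_br u.2 (v.1 : D.W)⟩

/-- By `m_eq_br` every monomial of `𝒲₁` other than `u₁` is a multiple of a bracket inside `𝒲₁`, so
the two conditions on `P` leave no freedom. -/
theorem IsSupertrace.eq_strW {P : D.W₁ →ₗ[F] F} (hP : D.IsSupertrace P) : P = D.strW := by
  have key : D.R₁ ≤ (LinearMap.ker (P - D.strW)).map (Submodule.subtype D.R₁) := by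
    refine R₁_le fun k hk μ hμ hko hμo => ?_
    have hm : ∀ {k : Fin D.ℓ → ℤ} {μ : Fin D.ℓ → ℕ}, D.OddSupp k → D.OddSupp μ →
        m 0 k μ ∈ D.R₁ := fun h h' => D.mon_mem fun p hp => ⟨h p hp, h' p hp⟩
    have hbr : ∀ (c : F) (u v : D.R), u ∈ D.R₁ → v ∈ D.R₁ →
        c • D.br u v ∈ (LinearMap.ker (P - D.strW)).map (Submodule.subtype D.R₁) := by
      refine fun c u v hu hv => Submodule.smul_mem _ _ ⟨⟨_, D.bracket_mem_W₁ hu hv⟩, ?_, rfl⟩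
      exact sub_eq_zero.2 ((hP.2 ⟨u, hu⟩ ⟨v, hv⟩).trans
        (isSupertrace_strW.2 ⟨u, hu⟩ ⟨v, hv⟩).symm)
    by_cases h : ∃ r : Fin D.ℓ, D.ℓ'₄ ≤ r.val ∧ (k r ≠ 1 ∨ μ r ≠ 1)
    · obtain ⟨r, hr, h⟩ := h
      have he : ∀ {p : Fin D.ℓ}, p.val < D.ℓ'₄ → p ≠ r := fun hp h' =>
        absurd (h' ▸ hp) (not_lt.2 hr)
      have h1 : D.OddSupp (D.e r) := fun p hp => Pi.single_eq_of_ne (he hp) _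
      have h2 : D.OddSupp (D.en r) := fun p hp => Pi.single_eq_of_ne (he hp) _
      rcases m_eq_br hk hμ hr h (0 : D.Γ) with ⟨c, hc⟩ | ⟨c, hc⟩
      · rw [hc]
        exact hbr _ _ _ (hm (fun _ _ => rfl) h2) (hm (fun p hp => by
          rw [Pi.add_apply, hko p hp, h1 p hp, add_zero]) hμo)
      · rw [hc]
        exact hbr _ _ _ (hm h1 fun _ _ => rfl) (hm hko fun p hp => by
          rw [Pi.add_apply, hμo p hp, h2 p hp, add_zero])
    · push Not at h
      have h1 : k = D.topz := funext fun p => by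
        by_cases hp : D.ℓ'₄ ≤ p.val
        · rw [(h p hp).1, topz, if_pos hp]
        · rw [hko p (not_le.1 hp), topz, if_neg hp]
      have h2 : μ = D.topn := funext fun p => by
        by_cases hp : D.ℓ'₄ ≤ p.val
        · rw [(h p hp).2, topn, if_pos hp]
        · rw [hμo p (not_le.1 hp), topn, if_neg hp]
      rw [h1, h2]
      refine ⟨D.u₁, ?_, rfl⟩
      change P _ - D.strW _ = 0
      rw [hP.1, isSupertrace_strW.1, sub_self]
  refine LinearMap.ext fun u => ?_
  obtain ⟨u', h1, h2⟩ := key u.2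
  rw [← Subtype.ext (a1 := u') h2]
  exact sub_eq_zero.1 h1

end WeylData

end WeylSuper

end

/-! ### Cocycles on `𝒲` from cyclic forms on `𝒲₀` -/

noncomputable section

namespace WeylSuper

open Finset

namespace WeylData

variable {F : Type*} [Field F] {D : WeylData F}

/-! ### Tensor products of forms -/

variable (D) in
/-- The even part as a subspace of the algebra. -/
def R₀ : Submodule F D.R := D.W₀

theorem R₀_le {N : Submodule F D.R} (h : ∀ α, ∀ k ∈ D.J, ∀ μ ∈ D.K, EvenSupp k → EvenSupp μ →
    m α k μ ∈ N) : D.R₀ ≤ N := by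
  intro u hu
  have h1 : u ∈ Finsupp.supported F F
    {a : D.Idx | ∀ p : Fin D.ℓ, D.ℓ'₄ ≤ p.val → a.2.1.1 p = 0 ∧ a.2.2.1 p = 0} := hu
  rw [Finsupp.supported_eq_span_single] at h1
  refine (Submodule.span_le (p := N)).2 ?_ h1
  rintro _ ⟨⟨α, k, μ⟩, h2, rfl⟩
  change (Finsupp.single _ 1 : D.W) ∈ N
  rw [single_eq_mon]
  exact h α k k.2 μ μ.2 (fun p hp => (h2 p hp).1) fun p hp => (h2 p hp).2

theorem m_mem_R₀ (α : D.Γ) {k : Fin D.ℓ → ℤ} {μ : Fin D.ℓ → ℕ} (h : EvenSupp k)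
    (h' : EvenSupp μ) : m α k μ ∈ D.R₀ := by
  by_cases hm : k ∈ D.J ∧ μ ∈ D.K
  · rw [m, mon_of_mem hm.1 hm.2]
    exact Finsupp.single_mem_supported F 1 fun p hp => ⟨h p hp, h' p hp⟩
  · have : m α k μ = 0 := dif_neg hm
    rw [this]
    exact zero_mem _

theorem m_mem_R₁ {k : Fin D.ℓ → ℤ} {μ : Fin D.ℓ → ℕ} (h : D.OddSupp k) (h' : D.OddSupp μ) :
    m 0 k μ ∈ D.R₁ := D.mon_mem fun p hp => ⟨h p hp, h' p hp⟩

theorem R₀_le_comp : D.R₀ ≤ D.comp 0 := R₀_le fun α k _ μ _ h h' => by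
  have := m_mem α k μ
  have h2 : EvenSupp (D.cz μ) := fun p hp => by rw [cz, h' p hp, Nat.cast_zero]
  rwa [h.deg, h2.deg, add_zero, Int.cast_zero] at this

theorem mul_mem_R₁ {u v : D.R} (hu : u ∈ D.R₁) (hv : v ∈ D.R₁) : u * v ∈ D.R₁ :=
  D.mul_mem_W₁ hu hv

theorem commute_d_dm {p : Fin D.ℓ} (hp : p.val < D.ℓ'₄) {μ : Fin D.ℓ → ℕ} (hμ : μ ∈ D.K) :
    Commute (D.d p) (m 0 0 μ) :=
  adj_eq_zero_iff.1 (by rw [← br_even (d_even_mem hp), br_d_dm p hμ])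

theorem commute_d_x {p : Fin D.ℓ} (hp : p.val < D.ℓ'₄) {k : Fin D.ℓ → ℤ} (hk : k ∈ D.J)
    (h : D.OddSupp k) : Commute (D.d p) (x 0 k) := by
  refine (adj_eq_zero_iff (F := F)).1 ?_
  rw [← br_even (d_even_mem hp), br_d_x p hk, h p hp]
  simp

theorem not_odd_of_add {μ : Fin D.ℓ → ℕ} {p : Fin D.ℓ} (h : EvenSupp (μ + D.en p)) :
    EvenSupp μ ∧ p.val < D.ℓ'₄ := by
  refine ⟨fun q hq => ?_, ?_⟩
  · have := h q hq
    rw [Pi.add_apply] at this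
    omega
  · by_contra hp
    have := h p (not_lt.1 hp)
    rw [Pi.add_apply, show D.en p p = 1 from Pi.single_eq_same _ _] at this
    omega

/-- The generators of the two parts involve disjoint coordinates, and no sign arises because `𝒲₀` is
even. -/
theorem commute_R₀_R₁ {a u : D.R} (ha : a ∈ D.R₀) (hu : u ∈ D.R₁) : Commute a u := by
  have h1 : ∀ α, ∀ k ∈ D.J, ∀ μ ∈ D.K, EvenSupp k → EvenSupp μ →
      D.R₁ ≤ LinearMap.ker (adj (F := F) (m α k μ)) := by
    intro α k hk μ hμ h h'
    refine R₁_le fun l hl ν hν hl' hν' => adj_eq_zero_iff.2 ?_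
    rw [← x_mul_dm hk, ← x_mul_dm hl]
    refine Commute.mul_left ((h.commute_x hk hl _ _).mul_right (commute_x_dm hν fun q hq => ?_)) ?_
    · exact h.commute_d_odd hk α (not_lt.1 fun hq' => hq (hν' q hq'))
    · refine K_induction (P := fun μ => EvenSupp μ → Commute (m 0 0 μ) (x 0 l * m 0 0 ν))
        (fun _ => Commute.one_left _) (fun μ p hK ih h => ?_) μ hμ h'
      obtain ⟨h2, h3⟩ := not_odd_of_add h
      rw [dm_succ]
      exact (Commute.mul_left ((commute_d_x h3 hl hl').mul_right (commute_d_dm h3 hν))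
        (ih h2)).smul_left _
  have h2 : D.R₀ ≤ LinearMap.ker (adj (F := F) u) := R₀_le fun α k hk μ hμ h h' =>
    adj_eq_zero_iff.2 (adj_eq_zero_iff.1 (h1 α k hk μ hμ h h' hu)).symm
  exact (adj_eq_zero_iff.1 (h2 ha)).symm

theorem dm_mul_dm {μ ν : Fin D.ℓ → ℕ} (hμ : μ ∈ D.K) (h : EvenSupp μ) :
    (m 0 0 μ : D.R) * m 0 0 ν = m 0 0 (μ + ν) := by
  have hb : ∀ {p : Fin D.ℓ} (k : Fin D.ℓ → ℤ), p.val < D.ℓ'₄ → sgn F (D.below p k) = 1 :=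
    fun k hp => by rw [D.below_of_lt hp, sgn_zero]
  refine K_induction (P := fun μ => EvenSupp μ → (m 0 0 μ : D.R) * m 0 0 ν = m 0 0 (μ + ν))
    (fun _ => by rw [zero_add]; exact one_mul _) (fun μ p hK ih h => ?_) μ hμ h
  obtain ⟨h2, h3⟩ := not_odd_of_add h
  rw [dm_succ, hb _ h3, one_smul, mul_assoc, ih h2, d_mul_dm, hb _ h3, one_smul,
    add_right_comm μ]

theorem m_mul_m_odd {k l : Fin D.ℓ → ℤ} (hk : k ∈ D.J) (hl : l ∈ D.J) {μ ν : Fin D.ℓ → ℕ}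
    (hμ : μ ∈ D.K) (hke : EvenSupp k) (hμe : EvenSupp μ)
    (hlo : D.OddSupp l) (α : D.Γ) :
    m α k μ * m 0 l ν = m α (k + l) (μ + ν) := by
  have h1 : Commute (m 0 0 μ) (x 0 l) :=
    commute_R₀_R₁ (m_mem_R₀ 0 (fun _ _ => rfl) hμe) (m_mem_R₁ hlo fun _ _ => rfl)
  rw [← x_mul_dm hk, ← x_mul_dm hl, mul_assoc, ← mul_assoc (m 0 0 μ), h1.eq, mul_assoc,
    dm_mul_dm hμ hμe, ← mul_assoc, x_mul_x hk hl, hke.pair_left, sgn_zero, one_smul, add_zero,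
    x_mul_dm (add_mem_J hk hl fun p hp => Or.inl (hke p hp))]

variable (D) in
/-- The part of a vector in the even coordinates. -/
def ev {M : Type*} [Zero M] (k : Fin D.ℓ → M) : Fin D.ℓ → M :=
  fun p => if D.ℓ'₄ ≤ p.val then 0 else k p

variable (D) in
/-- The part of a vector in the odd coordinates. -/
def od {M : Type*} [Zero M] (k : Fin D.ℓ → M) : Fin D.ℓ → M :=
  fun p => if D.ℓ'₄ ≤ p.val then k p else 0

theorem ev_add_od {M : Type*} [AddZeroClass M] (k : Fin D.ℓ → M) : D.ev k + D.od k = k := by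
  ext p
  rw [Pi.add_apply, ev, od]
  split_ifs <;> simp

theorem ev_add {M : Type*} [AddZeroClass M] {k l : Fin D.ℓ → M} (hk : EvenSupp k)
    (hl : D.OddSupp l) : D.ev (k + l) = k := by
  ext p
  rw [ev]
  split_ifs with h
  · rw [hk p h]
  · rw [Pi.add_apply, hl p (not_le.1 h), add_zero]

theorem od_add {M : Type*} [AddZeroClass M] {k l : Fin D.ℓ → M} (hk : EvenSupp k)
    (hl : D.OddSupp l) : D.od (k + l) = l := by
  ext p
  rw [od]
  split_ifs with h
  · rw [Pi.add_apply, hk p h, zero_add]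
  · rw [hl p (not_le.1 h)]

theorem evenSupp_ev {M : Type*} [Zero M] (k : Fin D.ℓ → M) : EvenSupp (D.ev k) :=
  fun _ hp => if_pos hp

theorem oddSupp_od {M : Type*} [Zero M] (k : Fin D.ℓ → M) : D.OddSupp (D.od k) :=
  fun _ hp => if_neg (not_le.2 hp)

theorem ev_mem_J {k : Fin D.ℓ → ℤ} (hk : k ∈ D.J) : D.ev k ∈ D.J := fun p => by
  rw [ev]
  split_ifs with h
  · exact ⟨fun _ => le_rfl, fun _ _ => rfl, fun _ => Or.inl rfl⟩
  · exact hk p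

theorem od_mem_J {k : Fin D.ℓ → ℤ} (hk : k ∈ D.J) : D.od k ∈ D.J := fun p => by
  rw [od]
  split_ifs with h
  · exact hk p
  · exact ⟨fun _ => le_rfl, fun _ _ => rfl, fun _ => Or.inl rfl⟩

theorem ev_mem_K {μ : Fin D.ℓ → ℕ} : D.ev μ ∈ D.K := fun p hp => by
  rw [ev, if_pos hp]
  exact Nat.zero_le _

/-- This factorization of basis elements identifies `𝒲` with `𝒲₀ ⊗ 𝒲₁`, which is what `tens` rests
on. -/
theorem ev_mul_od {k : Fin D.ℓ → ℤ} (hk : k ∈ D.J) (α : D.Γ) (μ : Fin D.ℓ → ℕ) :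
    m α (D.ev k) (D.ev μ) * m 0 (D.od k) (D.od μ) = m α k μ := by
  rw [m_mul_m_odd (ev_mem_J hk) (od_mem_J hk) ev_mem_K (evenSupp_ev _) (evenSupp_ev _)
    (oddSupp_od _), ev_add_od, ev_add_od]

/-- The form `φ ⊗ str`, i.e. `(a u, b v) ↦ φ(a, b) str(u v)`. -/
def tens (φ : D.R →ₗ[F] D.R →ₗ[F] F) : D.R →ₗ[F] D.R →ₗ[F] F :=
  (Finsupp.linearCombination F fun a : D.Idx => Finsupp.linearCombination F fun b : D.Idx =>
    φ (m a.1 (D.ev a.2.1.1) (D.ev a.2.2.1)) (m b.1 (D.ev b.2.1.1) (D.ev b.2.2.1)) *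
      D.str (m 0 (D.od a.2.1.1) (D.od a.2.2.1) * m 0 (D.od b.2.1.1) (D.od b.2.2.1)) :
    D.W →ₗ[F] D.W →ₗ[F] F)

theorem lc₂_single {ι κ M : Type*} [AddCommGroup M] [Module F M] (f : ι → κ → M) (a : ι) (b : κ) :
    Finsupp.linearCombination F (fun a => Finsupp.linearCombination F (f a)) (Finsupp.single a 1)
      (Finsupp.single b 1) = f a b := by
  rw [Finsupp.linearCombination_single, one_smul, Finsupp.linearCombination_single, one_smul]

theorem tens_m (φ : D.R →ₗ[F] D.R →ₗ[F] F) {k l : Fin D.ℓ → ℤ} (hk : k ∈ D.J) (hl : l ∈ D.J)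
    {μ ν : Fin D.ℓ → ℕ} (hμ : μ ∈ D.K) (hν : ν ∈ D.K) (α β : D.Γ) :
    tens φ (m α k μ) (m β l ν) = φ (m α (D.ev k) (D.ev μ)) (m β (D.ev l) (D.ev ν)) *
      D.str (m 0 (D.od k) (D.od μ) * m 0 (D.od l) (D.od ν)) := by
  have h1 : m α k μ = (Finsupp.single (α, ⟨k, hk⟩, ⟨μ, hμ⟩) 1 : D.W) := mon_of_mem hk hμ
  have h2 : m β l ν = (Finsupp.single (β, ⟨l, hl⟩, ⟨ν, hν⟩) 1 : D.W) := mon_of_mem hl hν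
  conv_lhs => rw [h1, h2]
  exact lc₂_single _ _ _

/-- `tens` is given on basis elements; the four nested inclusions extend the formula linearly, one
argument at a time. -/
theorem tens_mul (φ : D.R →ₗ[F] D.R →ₗ[F] F) {a b u v : D.R} (ha : a ∈ D.R₀) (hb : b ∈ D.R₀)
    (hu : u ∈ D.R₁) (hv : v ∈ D.R₁) :
    tens φ (a * u) (b * v) = φ a b * D.str (u * v) := by
  have h1 : ∀ α, ∀ k ∈ D.J, ∀ μ ∈ D.K, EvenSupp k → EvenSupp μ → ∀ β, ∀ l ∈ D.J, ∀ ν ∈ D.K,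
      EvenSupp l → EvenSupp ν → ∀ k' ∈ D.J, ∀ μ' ∈ D.K, D.OddSupp k' → D.OddSupp μ' →
      ∀ l' ∈ D.J, ∀ ν' ∈ D.K, D.OddSupp l' → D.OddSupp ν' →
      tens φ (m α k μ * m 0 k' μ') (m β l ν * m 0 l' ν') =
        φ (m α k μ) (m β l ν) * D.str (m 0 k' μ' * m 0 l' ν') := by
    intro α k hk μ hμ hke hμe β l hl ν hν hle hνe k' hk' μ' hμ' hko hμo l' hl' ν' hν' hlo hνo
    have hK : ∀ {μ ν : Fin D.ℓ → ℕ}, ν ∈ D.K → EvenSupp μ → μ + ν ∈ D.K := fun h h' p hp => by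
      rw [Pi.add_apply, h' p hp, zero_add]
      exact h p hp
    rw [m_mul_m_odd hk hk' hμ hke hμe hko, m_mul_m_odd hl hl' hν hle hνe hlo,
      tens_m φ (add_mem_J hk hk' fun p hp => Or.inl (hke p hp))
        (add_mem_J hl hl' fun p hp => Or.inl (hle p hp)) (hK hμ' hμe) (hK hν' hνe),
      ev_add hke hko, ev_add hμe hμo, ev_add hle hlo, ev_add hνe hνo,
      od_add hke hko, od_add hμe hμo, od_add hle hlo, od_add hνe hνo]
  have h2 : D.R₁ ≤ LinearMap.ker ((tens φ (a * u)) ∘ₗ LinearMap.mulLeft F b -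
      φ a b • D.str ∘ₗ LinearMap.mulLeft F u) := by
    refine R₁_le fun l' hl' ν' hν' hlo hνo => ?_
    have h3 : D.R₁ ≤ LinearMap.ker ((tens φ).flip (b * m 0 l' ν') ∘ₗ LinearMap.mulLeft F a -
        φ a b • D.str ∘ₗ LinearMap.mulRight F (m 0 l' ν')) := by
      refine R₁_le fun k' hk' μ' hμ' hko hμo => ?_
      have h4 : D.R₀ ≤ LinearMap.ker ((tens φ (a * m 0 k' μ')) ∘ₗ
          LinearMap.mulRight F (m 0 l' ν') - D.str (m 0 k' μ' * m 0 l' ν') • φ a) := by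
        refine R₀_le fun β l hl ν hν hle hνe => ?_
        have h5 : D.R₀ ≤ LinearMap.ker ((tens φ).flip (m β l ν * m 0 l' ν') ∘ₗ
            LinearMap.mulRight F (m 0 k' μ') -
            D.str (m 0 k' μ' * m 0 l' ν') • φ.flip (m β l ν)) := by
          refine R₀_le fun α k hk μ hμ hke hμe => ?_
          rw [LinearMap.mem_ker, LinearMap.sub_apply, sub_eq_zero]
          exact (h1 α k hk μ hμ hke hμe β l hl ν hν hle hνe k' hk' μ' hμ' hko hμo l' hl' ν' hν'
            hlo hνo).trans (mul_comm _ _)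
        have h6 := h5 ha
        rw [LinearMap.mem_ker, LinearMap.sub_apply, sub_eq_zero] at h6 ⊢
        exact h6
      have h6 := h4 hb
      rw [LinearMap.mem_ker, LinearMap.sub_apply, sub_eq_zero] at h6 ⊢
      exact h6.trans (mul_comm _ _)
    have h6 := h3 hu
    rw [LinearMap.mem_ker, LinearMap.sub_apply, sub_eq_zero] at h6 ⊢
    exact h6
  have h6 := h2 hv
  rw [LinearMap.mem_ker, LinearMap.sub_apply, sub_eq_zero] at h6
  exact h6

/-- A super-skew form with the cyclic property is a 2-cocycle. -/
theorem mem_C2_of_cyclic {Φ : D.R →ₗ[F] D.R →ₗ[F] F}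
    (hskew : ∀ a b : ZMod 2, ∀ u ∈ D.comp a, ∀ v ∈ D.comp b, Φ u v = -(koszul a b * Φ v u))
    (hcyc : ∀ a b c : ZMod 2, ∀ u ∈ D.comp a, ∀ v ∈ D.comp b, ∀ w ∈ D.comp c,
      Φ (u * v) w = Φ u (v * w) + koszul a (b + c) * Φ v (w * u)) :
    (Φ : D.W →ₗ[F] D.W →ₗ[F] F) ∈ D.C2 := by
  suffices H : ∀ a b c : ZMod 2, ∀ u ∈ D.comp a, ∀ v ∈ D.comp b, ∀ w ∈ D.comp c,
      Φ u (D.br v w) = Φ (D.br u v) w + koszul a b * Φ v (D.br u w) from ⟨hskew, H⟩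
  intro a b c u hu v hv w hw
  rw [br_apply hv hw, br_apply hu hv, br_apply hu hw]
  simp only [map_sub, map_smul, LinearMap.sub_apply, LinearMap.smul_apply, smul_eq_mul]
  -- Antisymmetrization turns the cyclic identity into the Lie cocycle identity: its instances for
  -- `(u, v)` and `(v, u)` account for all six terms.
  rw [hcyc a b c u hu v hv w hw, hcyc b a c v hv u hu w hw, koszul_add_right, koszul_add_right,
    koszul_comm b a]
  have h := koszul_mul_self (F := F) a b
  linear_combination (koszul b c * Φ u (w * v)) * h

/-- The homogeneous components are spanned by products. -/
theorem comp_le_of_products {e : ZMod 2} {N : Submodule F D.R}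
    (h : ∀ a ∈ D.R₀, ∀ u ∈ D.R₁, u ∈ D.comp e → a * u ∈ N) : D.comp e ≤ N := by
  intro v hv
  refine comp_le_comap (f := LinearMap.id) (fun α k hk μ hμ he => ?_) hv
  rw [LinearMap.id_apply, ← ev_mul_od hk]
  refine h _ (m_mem_R₀ _ (evenSupp_ev _) (evenSupp_ev _)) _
    (m_mem_R₁ (oddSupp_od _) (oddSupp_od _)) ?_
  have := m_mem (0 : D.Γ) (D.od k) (D.od μ)
  have h1 : D.deg (D.od k) = D.deg k := by
    conv_rhs => rw [← ev_add_od k, deg_add, (evenSupp_ev k).deg, zero_add]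
  have h2 : D.deg (D.cz (D.od μ)) = D.deg (D.cz μ) := by
    have h3 : EvenSupp (D.cz (D.ev μ)) := fun p hp => by rw [cz, ev, if_pos hp, Nat.cast_zero]
    conv_rhs => rw [← ev_add_od μ, cz_add, deg_add, h3.deg, zero_add]
  rwa [h1, h2, he] at this

/-- `φ ⊗ str` is a 2-cocycle if `φ` is alternating and cyclic on `𝒲₀`. -/
theorem tens_mem_C2 {φ : D.R →ₗ[F] D.R →ₗ[F] F}
    (hmul : ∀ a ∈ D.R₀, ∀ b ∈ D.R₀, a * b ∈ D.R₀)
    (hskew : ∀ a ∈ D.R₀, ∀ b ∈ D.R₀, φ a b = -φ b a)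
    (hcyc : ∀ a ∈ D.R₀, ∀ b ∈ D.R₀, ∀ c ∈ D.R₀, φ (a * b) c = φ a (b * c) + φ b (c * a)) :
    (tens φ : D.W →ₗ[F] D.W →ₗ[F] F) ∈ D.C2 := by
  have hswap : ∀ {a b u v : D.R}, b ∈ D.R₀ → u ∈ D.R₁ → a * u * (b * v) = a * b * (u * v) := by
    intro a b u v hb hu
    rw [mul_assoc, ← mul_assoc u, ← (commute_R₀_R₁ hb hu).eq, mul_assoc b, mul_assoc]
  refine mem_C2_of_cyclic (fun d e u hu v hv => ?_) fun d e f u hu v hv w hw => ?_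
  · have h1 : D.comp d ≤ LinearMap.ker ((tens φ).flip v + (koszul d e : F) • tens φ v) := by
      refine comp_le_of_products fun a ha u hu hud => ?_
      have h2 : D.comp e ≤ LinearMap.ker (tens φ (a * u) +
          (koszul d e : F) • (tens φ).flip (a * u)) := by
        refine comp_le_of_products fun b hb v hv hve => ?_
        change tens φ (a * u) (b * v) + koszul d e * tens φ (b * v) (a * u) = 0
        rw [tens_mul φ ha hb hu hv, tens_mul φ hb ha hv hu, hskew a ha b hb,
          str_mul_comm hu hud hve]
        ring
      exact h2 hv
    exact eq_neg_of_add_eq_zero_left (h1 hu)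
  · have h1 : D.comp d ≤ LinearMap.ker ((tens φ).flip w ∘ₗ LinearMap.mulRight F v -
        (tens φ).flip (v * w) - (koszul d (e + f) : F) • tens φ v ∘ₗ LinearMap.mulLeft F w) := by
      refine comp_le_of_products fun a ha u hu hud => ?_
      have h2 : D.comp e ≤ LinearMap.ker ((tens φ).flip w ∘ₗ LinearMap.mulLeft F (a * u) -
          tens φ (a * u) ∘ₗ LinearMap.mulRight F w -
          (koszul d (e + f) : F) • (tens φ).flip (w * (a * u))) := by
        refine comp_le_of_products fun b hb v hv hve => ?_
        have h3 : D.comp f ≤ LinearMap.ker (tens φ (a * u * (b * v)) -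
            tens φ (a * u) ∘ₗ LinearMap.mulLeft F (b * v) -
            (koszul d (e + f) : F) • tens φ (b * v) ∘ₗ LinearMap.mulRight F (a * u)) := by
          refine comp_le_of_products fun c hc w hw hwf => ?_
          change tens φ (a * u * (b * v)) (c * w) - tens φ (a * u) (b * v * (c * w)) -
            koszul d (e + f) * tens φ (b * v) (c * w * (a * u)) = 0
          -- Since `𝒲₀` and `𝒲₁` commute, each product separates. The three supertraces then agree
          -- up to the Koszul sign by `str_mul_comm`, and the `𝒲₀` factors satisfy `hcyc`.
          rw [hswap hb hu, hswap hc hv, hswap ha hw,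
            tens_mul φ (hmul a ha b hb) hc (mul_mem_R₁ hu hv) hw,
            tens_mul φ ha (hmul b hb c hc) hu (mul_mem_R₁ hv hw),
            tens_mul φ hb (hmul c hc a ha) hv (mul_mem_R₁ hw hu), hcyc a ha b hb c hc, mul_assoc u,
            ← mul_assoc v, str_mul_comm hu hud (mul_mem_comp hve hwf), mul_assoc v]
          ring
        exact h3 hw
      exact h2 hv
    have h4 := h1 hu
    change tens φ (u * v) w - tens φ u (v * w) - koszul d (e + f) * tens φ v (w * u) = 0 at h4
    linear_combination h4

end WeylData

end WeylSuper

end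

/-! ### Reduction of the cyclic identity to generators -/

noncomputable section

namespace WeylSuper

open Finset

section Cyclic

variable {F R : Type*} [Field F] [Ring R] [Algebra F R]

/-- A skew form on `S` is cyclic if the cyclic identity holds for a generator `z` and for pairs
from `A`, where `S` is spanned by the `f z^n`, `f ∈ A`. -/
theorem cyclic_of_generators {φ : R →ₗ[F] R →ₗ[F] F} {A S : Submodule F R} {z : R}
    (hS : ∀ a ∈ S, ∀ b ∈ S, a * b ∈ S) (hA : A ≤ S) (hz : z ∈ S) (h1 : 1 ∈ A)
    (hspan : ∀ N : Submodule F R, (∀ f ∈ A, ∀ n : ℕ, f * z ^ n ∈ N) → S ≤ N)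
    (hskew : ∀ a ∈ S, ∀ b ∈ S, φ a b = -φ b a)
    (hcz : ∀ b ∈ S, ∀ c ∈ S, φ (z * b) c = φ z (b * c) + φ b (c * z))
    (hcA : ∀ f ∈ A, ∀ g ∈ A, ∀ c ∈ S, φ (f * g) c = φ f (g * c) + φ g (c * f)) :
    ∀ a ∈ S, ∀ b ∈ S, ∀ c ∈ S, φ (a * b) c = φ a (b * c) + φ b (c * a) := by
  -- The elements admissible as first entry of the cyclic identity are closed under products, by
  -- combining three instances. So it suffices to treat `z` and the elements of `A`.
  let Z : R → Prop := fun a => a ∈ S ∧ ∀ b ∈ S, ∀ c ∈ S, φ (a * b) c = φ a (b * c) + φ b (c * a)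
  have hmul : ∀ a a', Z a → Z a' → Z (a * a') := fun a a' ha ha' =>
    ⟨hS a ha.1 a' ha'.1, fun b hb c hc => by
      have e1 := ha.2 (a' * b) (hS _ ha'.1 _ hb) c hc
      have e2 := ha'.2 b hb (c * a) (hS _ hc _ ha.1)
      have e3 := ha.2 a' ha'.1 (b * c) (hS _ hb _ hc)
      simp only [mul_assoc] at e1 e2 e3 ⊢
      linear_combination e1 + e2 - e3⟩
  have hpow : ∀ n : ℕ, Z (z ^ n) := by
    intro n
    induction n with
    | zero =>
      refine ⟨by rw [pow_zero]; exact hA h1, fun b hb c hc => ?_⟩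
      have h := hcA 1 h1 1 h1 (b * c) (hS _ hb _ hc)
      rw [one_mul, one_mul, mul_one] at h
      rw [pow_zero, one_mul, mul_one]
      linear_combination h
    | succ n ih =>
      rw [pow_succ]
      exact hmul _ _ ih ⟨hz, hcz⟩
  have hf : ∀ f ∈ A, Z f := by
    refine fun f hf => ⟨hA hf, fun b hb c hc => ?_⟩
    have : S ≤ LinearMap.ker (φ.flip c ∘ₗ LinearMap.mulLeft F f -
        φ f ∘ₗ LinearMap.mulRight F c - φ.flip (c * f)) := by
      refine hspan _ fun g hg n => ?_
      change φ (f * (g * z ^ n)) c - φ f (g * z ^ n * c) - φ (g * z ^ n) (c * f) = 0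
      have hn := hpow n
      have hfS := hA hf
      have hgS := hA hg
      -- For `b = g z^n` skewness and the identity for `z^n` move the power around the cycle, until
      -- only the pair `f`, `g` from `A` is left.
      have e1 := hcA f hf g hg (z ^ n * c) (hS _ hn.1 _ hc)
      have e2 := hn.2 c hc (f * g) (hS _ hfS _ hgS)
      have e3 := hn.2 (c * f) (hS _ hc _ hfS) g hgS
      have s1 := hskew (z ^ n * c) (hS _ hn.1 _ hc) (f * g) (hS _ hfS _ hgS)
      have s2 := hskew c hc (f * (g * z ^ n)) (hS _ hfS _ (hS _ hgS _ hn.1))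
      have s3 := hskew (z ^ n * (c * f)) (hS _ hn.1 _ (hS _ hc _ hfS)) g hgS
      have s4 := hskew (c * f) (hS _ hc _ hfS) (g * z ^ n) (hS _ hgS _ hn.1)
      simp only [mul_assoc] at e1 e2 e3 s1 s2 s3 s4 ⊢
      linear_combination e1 + e2 - e3 - s1 + s2 + s3 - s4
    have h := this hb
    change φ (f * b) c - φ f (b * c) - φ b (c * f) = 0 at h
    linear_combination h
  intro a ha b hb c hc
  have : S ≤ LinearMap.ker (φ.flip c ∘ₗ LinearMap.mulRight F b -
      φ.flip (b * c) - φ b ∘ₗ LinearMap.mulLeft F c) := by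
    refine hspan _ fun f hf' n => ?_
    have h := (hmul _ _ (hf f hf') (hpow n)).2 b hb c hc
    change φ (f * z ^ n * b) c - φ (f * z ^ n) (b * c) - φ b (c * (f * z ^ n)) = 0
    linear_combination h
  have h := this ha
  change φ (a * b) c - φ a (b * c) - φ b (c * a) = 0 at h
  linear_combination h

end Cyclic

namespace WeylData

variable {F : Type*} [Field F] {D : WeylData F}

theorem x_mul_mem_R₀ {k : Fin D.ℓ → ℤ} (hk : k ∈ D.J) (hke : EvenSupp k) (α : D.Γ) {v : D.R}
    (hv : v ∈ D.R₀) : x α k * v ∈ D.R₀ := by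
  have : D.R₀ ≤ D.R₀.comap (LinearMap.mulLeft F (x α k)) := R₀_le fun β l hl ν _ hle hνe => by
    rw [Submodule.mem_comap, LinearMap.mulLeft_apply, x_mul_m hk hl]
    refine Submodule.smul_mem _ _ (m_mem_R₀ _ (fun p hp => ?_) hνe)
    rw [Pi.add_apply, hke p hp, hle p hp, add_zero]
  exact this hv

theorem d_mul_mem_R₀ {p : Fin D.ℓ} (hp : p.val < D.ℓ'₄) {v : D.R}
    (hv : v ∈ D.R₀) : D.d p * v ∈ D.R₀ := by
  have hne : ∀ {q : Fin D.ℓ}, D.ℓ'₄ ≤ q.val → q ≠ p := fun hq h =>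
    absurd hp (not_lt.2 (h ▸ hq))
  have : D.R₀ ≤ D.R₀.comap (LinearMap.mulLeft F (D.d p)) := R₀_le fun β l hl ν _ hle hνe => by
    rw [Submodule.mem_comap, LinearMap.mulLeft_apply, d_mul_m hl]
    refine add_mem (add_mem ?_ ?_) ?_ <;> refine Submodule.smul_mem _ _ (m_mem_R₀ _ ?_ ?_)
    · exact hle
    · exact hνe
    · exact fun q hq => by
        rw [Pi.sub_apply, hle q hq, show D.e p q = 0 from Pi.single_eq_of_ne (hne hq) _, sub_zero]
    · exact hνe
    · exact hle
    · exact fun q hq => by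
        rw [Pi.add_apply, hνe q hq, show D.en p q = 0 from Pi.single_eq_of_ne (hne hq) _, add_zero]
  exact this hv

theorem mul_mem_R₀ : ∀ a ∈ D.R₀, ∀ b ∈ D.R₀, a * b ∈ D.R₀ := by
  intro a ha b hb
  have : D.R₀ ≤ D.R₀.comap (LinearMap.mulRight F b) := R₀_le fun α k hk μ hμ hke hμe => by
    rw [Submodule.mem_comap, LinearMap.mulRight_apply, ← x_mul_dm hk, mul_assoc]
    refine x_mul_mem_R₀ hk hke α (K_induction (P := fun μ => EvenSupp μ → m 0 0 μ * b ∈ D.R₀)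
      (fun _ => ?_) (fun μ p _ ih h => ?_) μ hμ hμe)
    · exact (one_mul b).symm ▸ hb
    · obtain ⟨h2, h3⟩ := not_odd_of_add h
      rw [dm_succ, smul_mul_assoc, mul_assoc]
      exact Submodule.smul_mem _ _ (d_mul_mem_R₀ h3 (ih h2))
  exact this ha

theorem isTensor_tens (φ : D.R →ₗ[F] D.R →ₗ[F] F) {P : D.W₁ →ₗ[F] F} (hP : D.IsSupertrace P) :
    D.IsTensor (tens φ) (φ.domRestrict₁₂ D.R₀ D.R₀) P := by
  rw [hP.eq_strW]
  exact fun a b u v => tens_mul φ a.2 b.2 u.2 v.2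

/-! ### The even part for one even coordinate -/

theorem single_first_mem_K (n : ℕ) : (Pi.single D.first n : Fin D.ℓ → ℕ) ∈ D.K := fun p hp => by
  rw [Pi.single_eq_of_ne (D.mon₁_aux hp)]
  exact Nat.zero_le _

theorem first_lt : D.first.val < D.ℓ'₄ := not_le.1 fun h => D.mon₁_aux h rfl

theorem evenSupp_single_first (n : ℕ) : EvenSupp (Pi.single D.first n : Fin D.ℓ → ℕ) :=
  fun _ hp => Pi.single_eq_of_ne (D.mon₁_aux hp) _

theorem dm_single (n : ℕ) : (m 0 0 (Pi.single D.first n) : D.R) = D.d D.first ^ n := by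
  induction n with
  | zero => rw [Pi.single_zero, pow_zero]; rfl
  | succ n ih =>
    rw [pow_succ, ← ih, d, dm_mul_dm (single_first_mem_K n) (evenSupp_single_first n),
      ← Pi.single_add]

theorem m_single {k : Fin D.ℓ → ℤ} (hk : k ∈ D.J) (α : D.Γ) (n : ℕ) :
    m α k (Pi.single D.first n) = x α k * D.d D.first ^ n := by
  rw [← dm_single, x_mul_dm hk]

theorem eq_single_first (h4 : D.ℓ'₄ = 1) {M : Type*} [Zero M] {k : Fin D.ℓ → M} (hk : EvenSupp k) :
    k = Pi.single D.first (k D.first) := by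
  ext p
  rcases eq_or_ne p D.first with rfl | hp
  · rw [Pi.single_eq_same]
  · rw [Pi.single_eq_of_ne hp, hk p]
    rw [h4, Nat.one_le_iff_ne_zero]
    exact fun h => hp (Fin.ext h)

variable (D) in
/-- The span of the even monomials `x^{α,k}`. -/
def A₀ : Submodule F D.R := Submodule.span F {v | ∃ α, ∃ k ∈ D.J, EvenSupp k ∧ v = x α k}

theorem x_mem_A₀ {k : Fin D.ℓ → ℤ} (hk : k ∈ D.J) (h : EvenSupp k) (α : D.Γ) : x α k ∈ D.A₀ :=
  Submodule.subset_span ⟨α, k, hk, h, rfl⟩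

theorem A₀_le {N : Submodule F D.R} (h : ∀ α, ∀ k ∈ D.J, EvenSupp k → x α k ∈ N) : D.A₀ ≤ N := by
  refine Submodule.span_le.2 ?_
  rintro _ ⟨α, k, hk, he, rfl⟩
  exact h α k hk he

theorem A₀_le_R₀ : D.A₀ ≤ D.R₀ := A₀_le fun _ _ _ h => m_mem_R₀ _ h fun _ _ => rfl

theorem R₀_le_of_mul_pow (h4 : D.ℓ'₄ = 1) (N : Submodule F D.R)
    (h : ∀ f ∈ D.A₀, ∀ n : ℕ, f * D.d D.first ^ n ∈ N) : D.R₀ ≤ N :=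
  R₀_le fun α k hk μ _ hke hμe => by
    rw [eq_single_first h4 hμe, m_single hk]
    exact h _ (x_mem_A₀ hk hke α) _

/-- A form on `𝒲₀` with one even coordinate gives a cocycle under conditions on generators. -/
theorem tens_mem_C2_of_generators (h4 : D.ℓ'₄ = 1) {φ : D.R →ₗ[F] D.R →ₗ[F] F}
    (hskew : ∀ a ∈ D.R₀, ∀ b ∈ D.R₀, φ a b = -φ b a)
    (hd : ∀ b ∈ D.R₀, ∀ c ∈ D.R₀,
      φ (D.d D.first * b) c = φ (D.d D.first) (b * c) + φ b (c * D.d D.first))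
    (hA : ∀ f ∈ D.A₀, ∀ g ∈ D.A₀, ∀ c ∈ D.R₀, φ (f * g) c = φ f (g * c) + φ g (c * f)) :
    (tens φ : D.W →ₗ[F] D.W →ₗ[F] F) ∈ D.C2 :=
  tens_mem_C2 mul_mem_R₀ hskew (cyclic_of_generators mul_mem_R₀ A₀_le_R₀
    (m_mem_R₀ 0 (fun _ _ => rfl) (evenSupp_single_first 1)) (x_mem_A₀ zero_mem_J evenSupp_zero 0)
    (R₀_le_of_mul_pow h4) hskew hd hA)

end WeylData

end WeylSuper

end

/-! ### Residue cocycles -/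

noncomputable section

namespace WeylSuper

open Finset

section Leibniz

variable {F R : Type*} [Field F] [Ring R] [Algebra F R]

theorem adj_pow_succ (z : R) (n : ℕ) (u : R) :
    (adj (F := F) z ^ (n + 1)) u = adj (F := F) z ((adj (F := F) z ^ n) u) := by
  rw [pow_succ', Module.End.mul_apply]

theorem adj_pow_succ_right (z : R) (n : ℕ) (u : R) :
    (adj (F := F) z ^ (n + 1)) u = (adj (F := F) z ^ n) (adj (F := F) z u) := by
  rw [pow_succ, Module.End.mul_apply]

theorem choose_antidiagonal {n : ℕ} {p : ℕ × ℕ} (hp : p ∈ antidiagonal n) :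
    n.choose p.2 = n.choose p.1 := by
  rw [← mem_antidiagonal.1 hp]
  exact (Nat.choose_symm_add).symm

theorem adj_pow_mul_eq_sum (z u v : R) (n : ℕ) :
    (adj (F := F) z ^ n) (u * v) = ∑ p ∈ antidiagonal n, n.choose p.1 •
      ((adj (F := F) z ^ p.1) u * (adj (F := F) z ^ p.2) v) := by
  induction n with
  | zero => simp
  | succ n ih =>
    rw [sum_antidiagonal_choose_succ_nsmul
      (fun i j => (adj (F := F) z ^ i) u * (adj (F := F) z ^ j) v), adj_pow_succ, ih, map_sum,
      ← sum_add_distrib]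
    refine sum_congr rfl fun p hp => ?_
    rw [map_nsmul, adj_mul, choose_antidiagonal hp, adj_pow_succ, adj_pow_succ, smul_add, add_comm]

theorem pow_mul_eq_sum (z u : R) (n : ℕ) :
    z ^ n * u = ∑ p ∈ antidiagonal n, n.choose p.1 • ((adj (F := F) z ^ p.1) u * z ^ p.2) := by
  induction n with
  | zero => simp
  | succ n ih =>
    rw [sum_antidiagonal_choose_succ_nsmul (fun i j => (adj (F := F) z ^ i) u * z ^ j), pow_succ',
      mul_assoc, ih, mul_sum, ← sum_add_distrib]
    refine sum_congr rfl fun p hp => ?_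
    rw [choose_antidiagonal hp, adj_pow_succ, adj_apply, mul_smul_comm, ← smul_add, pow_succ' z p.2]
    congr 1
    simp only [sub_mul, mul_assoc]
    abel

end Leibniz

section DivPow

variable {F : Type*} [Field F]

/-- At `n = -1` the left side is zero by convention, and on the right the factor `n + 1` vanishes.
-/
theorem mul_divPow [CharZero F] (a : F) (n : ℤ) :
    a * divPow a n = ((n + 1 : ℤ) : F) * divPow a (n + 1) := by
  rcases lt_trichotomy n (-1) with h | rfl | h
  · rw [divPow, if_pos (by omega), divPow, if_pos (by omega), mul_zero, mul_zero]
  · rw [divPow, if_pos (by omega)]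
    simp
  · obtain ⟨n, rfl⟩ := Int.eq_ofNat_of_zero_le (show 0 ≤ n by omega)
    rw [divPow, if_neg (by omega), divPow, if_neg (by omega),
      show ((n : ℤ) + 1).toNat = n + 1 from rfl, Int.toNat_natCast, Nat.factorial_succ, pow_succ]
    push_cast
    have h1 : (n : F) + 1 ≠ 0 := Nat.cast_add_one_ne_zero n
    have h2 : (n.factorial : F) ≠ 0 := Nat.cast_ne_zero.2 n.factorial_ne_zero
    field_simp

theorem divPow_zero (a : F) : divPow a 0 = 1 := by simp [divPow]

theorem gbinom_zero (a : F) : gbinom a 0 = 1 := by simp [gbinom]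

theorem gbinom_succ [CharZero F] (a : F) (n : ℕ) :
    ((n : F) + 1) * gbinom a (n + 1) = (a - n) * gbinom a n := by
  rw [gbinom, gbinom, prod_range_succ, Nat.factorial_succ]
  push_cast
  have h1 : (n : F) + 1 ≠ 0 := Nat.cast_add_one_ne_zero n
  have h2 : (n.factorial : F) ≠ 0 := Nat.cast_ne_zero.2 n.factorial_ne_zero
  field_simp

end DivPow

namespace WeylData

variable {F : Type*} [Field F] {D : WeylData F}

/-! ### Residue cocycles -/

theorem commute_A₀ {f g : D.R} (hf : f ∈ D.A₀) (hg : g ∈ D.A₀) : Commute f g := by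
  have h : D.A₀ ≤ LinearMap.ker (adj (F := F) f) := A₀_le fun α k hk hke => by
    have h' : D.A₀ ≤ LinearMap.ker (adj (F := F) (x α k)) := A₀_le fun β l hl hle =>
      adj_eq_zero_iff.2 (hke.commute_x hk hl α β)
    exact adj_eq_zero_iff.2 (adj_eq_zero_iff.1 (h' hf)).symm
  exact adj_eq_zero_iff.1 (h hg)

theorem mul_mem_A₀ {f g : D.R} (hf : f ∈ D.A₀) (hg : g ∈ D.A₀) : f * g ∈ D.A₀ := by
  have h : D.A₀ ≤ D.A₀.comap (LinearMap.mulLeft F f) := A₀_le fun β l hl hle => by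
    have h' : D.A₀ ≤ D.A₀.comap (LinearMap.mulRight F (x β l)) := A₀_le fun α k hk hke => by
      rw [Submodule.mem_comap, LinearMap.mulRight_apply, x_mul_x hk hl]
      refine Submodule.smul_mem _ _ (x_mem_A₀ (add_mem_J hk hl fun p hp => Or.inl (hke p hp))
        (fun p hp => ?_) _)
      rw [Pi.add_apply, hke p hp, hle p hp, add_zero]
    exact h' hf
  exact h hg

theorem adj_d_x {k : Fin D.ℓ → ℤ} (hk : k ∈ D.J) (h : EvenSupp k) (α : D.Γ) (p : Fin D.ℓ) :
    adj (F := F) (D.d p) (x α k) = α.1 p • x α k + (k p : F) • x α (k - D.e p) := by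
  rw [adj_apply, h.d_mul hk, add_sub_cancel_left]

theorem adj_d_mem_A₀ {f : D.R} (hf : f ∈ D.A₀) (p : Fin D.ℓ) :
    adj (F := F) (D.d p) f ∈ D.A₀ := by
  have h : D.A₀ ≤ D.A₀.comap (adj (F := F) (D.d p)) := A₀_le fun α k hk hke => by
    have h1 := adj_d_x hk hke α p
    change adj (F := F) (D.d p) (x α k) ∈ D.A₀
    rw [h1]
    refine add_mem (Submodule.smul_mem _ _ (x_mem_A₀ hk hke α)) ?_
    by_cases h0 : k p = 0
    · rw [h0, Int.cast_zero, zero_smul]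
      exact zero_mem _
    · exact Submodule.smul_mem _ _ (x_mem_A₀ (sub_e_mem_J hk h0) (hke.sub_e h0) α)
  exact h hf

theorem adj_d_pow_mem_A₀ {f : D.R} (hf : f ∈ D.A₀) (p : Fin D.ℓ) (n : ℕ) :
    (adj (F := F) (D.d p) ^ n) f ∈ D.A₀ := by
  induction n with
  | zero => exact hf
  | succ n ih =>
    rw [adj_pow_succ]
    exact adj_d_mem_A₀ ih p

/-- The residue functional with weights `c`. -/
def resid (c : D.Γ → F) : D.R →ₗ[F] F :=
  (Finsupp.linearCombination F fun a : D.Idx =>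
    c a.1 * divPow (a.1.1 D.first) (-a.2.1.1 D.first - 1) : D.W →ₗ[F] F)

/-- `x^{α,k}` plays the role of `t^k e^{αt}`, and the divided power is its coefficient of `t^{-1}`.
-/
theorem resid_x (c : D.Γ → F) {k : Fin D.ℓ → ℤ} (hk : k ∈ D.J) (α : D.Γ) :
    resid c (x α k) = c α * divPow (α.1 D.first) (-k D.first - 1) := by
  rw [x, m, mon_of_mem hk zero_mem_K]
  refine (Finsupp.linearCombination_single F _ _).trans ?_
  rw [one_smul]

/-- `ad ∂_1` acts on `A₀` as `d/dt`, and a derivative has no residue. -/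
theorem resid_adj [CharZero F] (c : D.Γ → F) {f : D.R} (hf : f ∈ D.A₀) :
    resid c (adj (F := F) (D.d D.first) f) = 0 := by
  have h : D.A₀ ≤ LinearMap.ker (resid c ∘ₗ adj (F := F) (D.d D.first)) :=
    A₀_le fun α k hk hke => by
      change resid c (adj (F := F) (D.d D.first) (x α k)) = 0
      rw [adj_d_x hk hke, map_add, map_smul, map_smul, resid_x c hk]
      by_cases h0 : k D.first = 0
      · have := mul_divPow (α.1 D.first) (-1)
        rw [h0, Int.cast_zero, zero_smul, add_zero, neg_zero, zero_sub, smul_eq_mul,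
          mul_left_comm, this]
        simp
      · rw [resid_x c (sub_e_mem_J hk h0), Pi.sub_apply,
          show D.e D.first D.first = 1 from Pi.single_eq_same _ _]
        have := mul_divPow (α.1 D.first) (-k D.first - 1)
        rw [sub_add_cancel] at this
        rw [show -(k D.first - 1) - 1 = -k D.first by ring, smul_eq_mul, smul_eq_mul,
          mul_left_comm, this]
        push_cast
        ring
  exact h hf

/-- Integration by parts, `n` times. -/
theorem resid_adj_pow_mul [CharZero F] (c : D.Γ → F) (n : ℕ) {f g : D.R} (hf : f ∈ D.A₀)
    (hg : g ∈ D.A₀) :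
    resid c ((adj (F := F) (D.d D.first) ^ n) f * g) =
      (-1) ^ n * resid c (f * (adj (F := F) (D.d D.first) ^ n) g) := by
  induction n generalizing g with
  | zero => simp
  | succ n ih =>
    have h1 := resid_adj c (mul_mem_A₀ (adj_d_pow_mem_A₀ hf D.first n) hg)
    rw [adj_mul, map_add, ih (adj_d_mem_A₀ hg _)] at h1
    rw [adj_pow_succ, adj_pow_succ_right, pow_succ]
    linear_combination h1

/-- The form `(f ∂^m, g ∂^n) ↦ (-1)^m m! n! / (m + n + 1)! Res(f^{(m + n + 1)} g)`. -/
def residForm (c : D.Γ → F) : D.R →ₗ[F] D.R →ₗ[F] F :=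
  (Finsupp.linearCombination F fun a : D.Idx => Finsupp.linearCombination F fun b : D.Idx =>
    (-1) ^ (a.2.2.1 D.first) * ((a.2.2.1 D.first).factorial : F) *
      ((b.2.2.1 D.first).factorial : F) /
        ((a.2.2.1 D.first + b.2.2.1 D.first + 1).factorial : F) *
      resid c ((adj (F := F) (D.d D.first) ^ (a.2.2.1 D.first + b.2.2.1 D.first + 1))
        (x a.1 a.2.1.1) * x b.1 b.2.1.1) : D.W →ₗ[F] D.W →ₗ[F] F)

theorem residForm_m (c : D.Γ → F) {k l : Fin D.ℓ → ℤ} (hk : k ∈ D.J) (hl : l ∈ D.J)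
    {μ ν : Fin D.ℓ → ℕ} (hμ : μ ∈ D.K) (hν : ν ∈ D.K) (α β : D.Γ) :
    residForm c (m α k μ) (m β l ν) =
      (-1) ^ (μ D.first) * ((μ D.first).factorial : F) * ((ν D.first).factorial : F) /
        ((μ D.first + ν D.first + 1).factorial : F) *
      resid c ((adj (F := F) (D.d D.first) ^ (μ D.first + ν D.first + 1)) (x α k) * x β l) := by
  have h1 : m α k μ = (Finsupp.single (α, ⟨k, hk⟩, ⟨μ, hμ⟩) 1 : D.W) := mon_of_mem hk hμ
  have h2 : m β l ν = (Finsupp.single (β, ⟨l, hl⟩, ⟨ν, hν⟩) 1 : D.W) := mon_of_mem hl hν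
  rw [h1, h2]
  exact lc₂_single _ _ _

theorem residForm_mul (c : D.Γ → F) (i j : ℕ) {f g : D.R} (hf : f ∈ D.A₀) (hg : g ∈ D.A₀) :
    residForm c (f * D.d D.first ^ i) (g * D.d D.first ^ j) =
      (-1) ^ i * (i.factorial : F) * (j.factorial : F) / ((i + j + 1).factorial : F) *
      resid c ((adj (F := F) (D.d D.first) ^ (i + j + 1)) f * g) := by
  set C : F := (-1) ^ i * (i.factorial : F) * (j.factorial : F) / ((i + j + 1).factorial : F)
  have h : D.A₀ ≤ LinearMap.ker (residForm c (f * D.d D.first ^ i) ∘ₗ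
      LinearMap.mulRight F (D.d D.first ^ j) - C • (resid c).comp
        (LinearMap.mulLeft F ((adj (F := F) (D.d D.first) ^ (i + j + 1)) f))) := by
    refine A₀_le fun β l hl hle => ?_
    have h' : D.A₀ ≤ LinearMap.ker ((residForm c).flip (x β l * D.d D.first ^ j) ∘ₗ
        LinearMap.mulRight F (D.d D.first ^ i) - C • (resid c ∘ₗ
        LinearMap.mulRight F (x β l) ∘ₗ
          (show D.R →ₗ[F] D.R from adj (F := F) (D.d D.first) ^ (i + j + 1)))) := by
      refine A₀_le fun α k hk hke => ?_
      change residForm c (x α k * D.d D.first ^ i) (x β l * D.d D.first ^ j) -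
        C * resid c ((adj (F := F) (D.d D.first) ^ (i + j + 1)) (x α k) * x β l) = 0
      rw [← m_single hk, ← m_single hl, residForm_m c hk hl (single_first_mem_K i)
        (single_first_mem_K j), Pi.single_eq_same, Pi.single_eq_same, sub_self]
    exact h' hf
  exact sub_eq_zero.1 (h hg)

/-- Integrating by parts `i + j + 1` times produces `(-1)^{i+j+1}`, which converts `(-1)^i` into
`-(-1)^j`. -/
theorem residForm_skew [CharZero F] (h4 : D.ℓ'₄ = 1) (c : D.Γ → F) :
    ∀ a ∈ D.R₀, ∀ b ∈ D.R₀, residForm c a b = -residForm c b a := by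
  intro a ha b hb
  have h : D.R₀ ≤ LinearMap.ker (residForm c a + (residForm c).flip a) := by
    refine R₀_le_of_mul_pow h4 _ fun g hg j => ?_
    have h' : D.R₀ ≤ LinearMap.ker ((residForm c).flip (g * D.d D.first ^ j) +
        residForm c (g * D.d D.first ^ j)) := by
      refine R₀_le_of_mul_pow h4 _ fun f hf i => ?_
      change residForm c (f * D.d D.first ^ i) (g * D.d D.first ^ j) +
        residForm c (g * D.d D.first ^ j) (f * D.d D.first ^ i) = 0
      rw [residForm_mul c i j hf hg, residForm_mul c j i hg hf, resid_adj_pow_mul c _ hf hg,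
        (commute_A₀ hf (adj_d_pow_mem_A₀ hg _ _)).eq, add_comm j i, pow_add, pow_add, pow_one]
      have h1 : ((-1 : F) ^ i) * (-1) ^ i = 1 := by rw [← mul_pow]; simp
      set X := resid c ((adj (F := F) (D.d D.first) ^ (i + j + 1)) g * f)
      linear_combination (-(-1) ^ j * (i.factorial : F) * (j.factorial : F) /
        ((i + j + 1).factorial : F) * X) * h1
    exact h' ha
  exact eq_neg_of_add_eq_zero_left (h hb)

/-- The coefficient of `∂_1` is the constant `1`, whose derivatives vanish. -/
theorem residForm_d_left (h4 : D.ℓ'₄ = 1) (c : D.Γ → F) {v : D.R} (hv : v ∈ D.R₀) :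
    residForm c (D.d D.first) v = 0 := by
  have h : D.R₀ ≤ LinearMap.ker (residForm c (D.d D.first)) := by
    refine R₀_le_of_mul_pow h4 _ fun g hg j => ?_
    have h1 := residForm_mul c 1 j (x_mem_A₀ zero_mem_J evenSupp_zero 0) hg
    have h2 : adj (F := F) (D.d D.first) 1 = 0 := adj_eq_zero_iff.2 (Commute.one_right _)
    rw [x_zero, one_mul, pow_one, adj_pow_succ_right, h2, map_zero, zero_mul, map_zero,
      mul_zero] at h1
    exact h1
  exact h hv

theorem residForm_d_mul [CharZero F] (h4 : D.ℓ'₄ = 1) (c : D.Γ → F) : ∀ b ∈ D.R₀, ∀ v ∈ D.R₀,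
    residForm c (D.d D.first * b) v =
      residForm c (D.d D.first) (b * v) + residForm c b (v * D.d D.first) := by
  intro b hb v hv
  rw [residForm_d_left h4 c (mul_mem_R₀ b hb v hv), zero_add]
  have h : D.R₀ ≤ LinearMap.ker ((residForm c).flip v ∘ₗ LinearMap.mulLeft F (D.d D.first) -
      (residForm c).flip (v * D.d D.first)) := by
    refine R₀_le_of_mul_pow h4 _ fun f hf i => ?_
    have h' : D.R₀ ≤ LinearMap.ker (residForm c (D.d D.first * (f * D.d D.first ^ i)) -
        residForm c (f * D.d D.first ^ i) ∘ₗ LinearMap.mulRight F (D.d D.first)) := by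
      refine R₀_le_of_mul_pow h4 _ fun g hg j => ?_
      change residForm c (D.d D.first * (f * D.d D.first ^ i)) (g * D.d D.first ^ j) -
        residForm c (f * D.d D.first ^ i) (g * D.d D.first ^ j * D.d D.first) = 0
      have h1 : D.d D.first * (f * D.d D.first ^ i) =
          adj (F := F) (D.d D.first) f * D.d D.first ^ i + f * D.d D.first ^ (i + 1) := by
        rw [adj_apply, pow_succ', sub_mul]
        simp only [mul_assoc]
        abel
      rw [h1, mul_assoc g, ← pow_succ, map_add, LinearMap.add_apply,
        residForm_mul c _ _ (adj_d_mem_A₀ hf _) hg, residForm_mul c _ _ hf hg,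
        residForm_mul c _ _ hf hg, ← adj_pow_succ_right, add_right_comm i 1 j, ← add_assoc,
        Nat.factorial_succ (i + j + 1), Nat.factorial_succ i, Nat.factorial_succ j, pow_succ]
      have e1 : ((i + j + 1).factorial : F) ≠ 0 := Nat.cast_ne_zero.2 (Nat.factorial_ne_zero _)
      have e2 : ((i + j + 1 + 1 : ℕ) : F) ≠ 0 := Nat.cast_ne_zero.2 (by omega)
      -- All three terms are multiples of the same residue, and their coefficients match because `(i
      -- + j + 2) - (i + 1) = j + 1`.
      set X := resid c ((adj (F := F) (D.d D.first) ^ (i + j + 1 + 1)) f * g)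
      push_cast at e2 ⊢
      field_simp
      ring
    exact h' hv
  exact sub_eq_zero.1 (h hb)

/-- The Leibniz expansion of `(f g)^{(n+1)}` contains `f^{(n+1)} g`, which gives the first summand
on the right. The other terms match those obtained by moving `∂_1^n` past `f`. -/
theorem residForm_A₀ [CharZero F] (h4 : D.ℓ'₄ = 1) (c : D.Γ → F) : ∀ f ∈ D.A₀, ∀ g ∈ D.A₀, ∀ v ∈ D.R₀,
    residForm c (f * g) v = residForm c f (g * v) + residForm c g (v * f) := by
  intro f hf g hg v hv
  have h0 : ∀ (j : ℕ) {f h : D.R}, f ∈ D.A₀ → h ∈ D.A₀ →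
      residForm c f (h * D.d D.first ^ j) = (j.factorial : F) / ((j + 1).factorial : F) *
        resid c ((adj (F := F) (D.d D.first) ^ (j + 1)) f * h) := by
    intro j f h hf hh
    have := residForm_mul c 0 j hf hh
    simpa using this
  have h : D.R₀ ≤ LinearMap.ker (residForm c (f * g) -
      residForm c f ∘ₗ LinearMap.mulLeft F g - residForm c g ∘ₗ LinearMap.mulRight F f) := by
    refine R₀_le_of_mul_pow h4 _ fun h hh n => ?_
    change residForm c (f * g) (h * D.d D.first ^ n) - residForm c f (g * (h * D.d D.first ^ n)) -
      residForm c g (h * D.d D.first ^ n * f) = 0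
    have hfn := fun i => adj_d_pow_mem_A₀ hf D.first i
    have hgn := fun i => adj_d_pow_mem_A₀ hg D.first i
    rw [h0 n (mul_mem_A₀ hf hg) hh, ← mul_assoc g, h0 n hf (mul_mem_A₀ hg hh), mul_assoc h,
      pow_mul_eq_sum (F := F), mul_sum, map_sum, adj_pow_mul_eq_sum,
      Finset.Nat.sum_antidiagonal_succ', add_mul, map_add, pow_zero, Module.End.one_apply,
      Nat.choose_self, one_smul, mul_assoc _ g h, mul_add, add_sub_cancel_left, sum_mul, map_sum,
      mul_sum, sub_eq_zero]
    refine sum_congr rfl fun p hp => ?_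
    rw [mul_smul_comm, map_nsmul, smul_mul_assoc, map_nsmul, ← mul_assoc h,
      h0 p.2 hg (mul_mem_A₀ hh (hfn p.1)), (commute_A₀ hh (hfn p.1)).eq, ← mul_assoc _ _ h,
      (commute_A₀ (hgn (p.2 + 1)) (hfn p.1)).eq]
    set X := resid c ((adj (F := F) (D.d D.first) ^ p.1) f *
      (adj (F := F) (D.d D.first) ^ (p.2 + 1)) g * h)
    have hp' := mem_antidiagonal.1 hp
    -- This compares the binomial coefficients of the two expansions.
    have h1 := Nat.choose_mul_succ_eq n p.1
    rw [show n + 1 - p.1 = p.2 + 1 by omega] at h1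
    have h2 : (n.choose p.1 : F) * (n + 1) = ((n + 1).choose p.1 : F) * (p.2 + 1) := by
      exact_mod_cast h1
    rw [nsmul_eq_mul, nsmul_eq_mul, Nat.factorial_succ, Nat.factorial_succ]
    have e1 : (n.factorial : F) ≠ 0 := Nat.cast_ne_zero.2 (Nat.factorial_ne_zero _)
    have e2 : (p.2.factorial : F) ≠ 0 := Nat.cast_ne_zero.2 (Nat.factorial_ne_zero _)
    have e3 : (n : F) + 1 ≠ 0 := Nat.cast_add_one_ne_zero n
    have e4 : (p.2 : F) + 1 ≠ 0 := Nat.cast_add_one_ne_zero p.2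
    push_cast
    field_simp
    linear_combination (-X) * h2
  have h' := h hv
  change residForm c (f * g) v - residForm c f (g * v) - residForm c g (v * f) = 0 at h'
  linear_combination h'

theorem residForm_mem_C2 [CharZero F] (h4 : D.ℓ'₄ = 1) (c : D.Γ → F) :
    (tens (residForm c) : D.W →ₗ[F] D.W →ₗ[F] F) ∈ D.C2 :=
  tens_mem_C2_of_generators h4 (residForm_skew h4 c) (residForm_d_mul h4 c) (residForm_A₀ h4 c)

end WeylData

end WeylSuper

end

/-! ### Cohomology for one Laurent coordinate -/

noncomputable section

namespace WeylSuper

open Finset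

/-- The factor `n + 1` is split as `(n + 1 - s) + s`. The first weight vanishes at `s = n + 1` and
the second at `s = 0`, whence the shorter sums. This is the induction step of `adj_d_pow_x`. -/
theorem sum_weights_add {F M : Type*} [Field F] [AddCommGroup M] [Module F M] (n : ℕ) (a : ℕ → F)
    (y : ℕ → M) :
    ∑ s ∈ range (n + 1), (((n : F) + 1 - s) * a s) • y s +
        ∑ s ∈ range (n + 1), (((s + 1 : ℕ) : F) * a (s + 1)) • y (s + 1) =
      ((n + 1 : ℕ) : F) • ∑ s ∈ range (n + 1 + 1), a s • y s := by
  have h1 : ∑ s ∈ range (n + 1 + 1), (((n : F) + 1 - s) * a s) • y s =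
      ∑ s ∈ range (n + 1), (((n : F) + 1 - s) * a s) • y s := by
    rw [sum_range_succ]
    simp
  have h2 : ∑ s ∈ range (n + 1 + 1), ((s : F) * a s) • y s =
      ∑ s ∈ range (n + 1), (((s + 1 : ℕ) : F) * a (s + 1)) • y (s + 1) := by
    rw [sum_range_succ']
    simp
  rw [← h1, ← h2, ← sum_add_distrib, smul_sum]
  refine sum_congr rfl fun s _ => ?_
  rw [← add_smul, smul_smul]
  congr 1
  push_cast
  ring

namespace WeylData

variable {F : Type*} [Field F] {D : WeylData F}

/-! ### One even coordinate of Laurent type -/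

theorem single_first_mem_J (h4 : D.ℓ'₄ = 1) (h3 : D.ℓ₃ = 1) (i : ℤ) :
    (Pi.single D.first i : Fin D.ℓ → ℤ) ∈ D.J := by
  have h0 : D.first.val = 0 := rfl
  refine single_mem_J ?_ fun h => ?_
  · rw [h0]
    simp only [ℓ'₃]
    omega
  · rw [h0] at h
    simp only [ℓ'₄, ℓ'₂] at h4 h
    omega

theorem evenSupp_first (i : ℤ) : EvenSupp (Pi.single D.first i : Fin D.ℓ → ℤ) :=
  evenSupp_single first_lt i

/-- The Leibniz rule for the `n`-th derivative of `t^i e^{αt}`; generalized binomials are needed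
because `i` may be negative. -/
theorem adj_d_pow_x [CharZero F] (h4 : D.ℓ'₄ = 1) (h3 : D.ℓ₃ = 1) (α : D.Γ) (i : ℤ) (n : ℕ) :
    (adj (F := F) (D.d D.first) ^ n) (x α (Pi.single D.first i)) =
      (n.factorial : F) • ∑ s ∈ range (n + 1),
        (gbinom (i : F) s * divPow (α.1 D.first) ((n : ℤ) - s)) •
          x α (Pi.single D.first (i - s)) := by
  induction n with
  | zero => simp [gbinom_zero, divPow_zero]
  | succ n ih =>
    have h1 : ∀ s : ℕ, adj (F := F) (D.d D.first) (x α (Pi.single D.first (i - s))) =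
        α.1 D.first • x α (Pi.single D.first (i - s)) +
          ((i : F) - s) • x α (Pi.single D.first (i - (s + 1 : ℕ))) := fun s => by
      rw [adj_d_x (single_first_mem_J h4 h3 _) (evenSupp_first _), Pi.single_eq_same, e,
        ← Pi.single_sub]
      push_cast
      rw [sub_sub]
    rw [adj_pow_succ, ih, map_smul, map_sum, Nat.factorial_succ, Nat.cast_mul,
      mul_comm ((n + 1 : ℕ) : F), mul_smul]
    congr 1
    have h2 : ∀ s : ℕ, adj (F := F) (D.d D.first) ((gbinom (i : F) s *
          divPow (α.1 D.first) ((n : ℤ) - s)) • x α (Pi.single D.first (i - s))) =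
        (((n + 1 : F) - s) * (gbinom (i : F) s * divPow (α.1 D.first) ((n + 1 : ℕ) - s : ℤ))) •
            x α (Pi.single D.first (i - s)) +
          (((s + 1 : ℕ) : F) * (gbinom (i : F) (s + 1) *
            divPow (α.1 D.first) ((n + 1 : ℕ) - (s + 1 : ℕ) : ℤ))) •
              x α (Pi.single D.first (i - (s + 1 : ℕ))) := fun s => by
      have e1 := mul_divPow (α.1 D.first) ((n : ℤ) - s)
      have e2 := gbinom_succ (i : F) s
      rw [map_smul, h1, smul_add, smul_smul, smul_smul]
      congr 2
      · rw [show ((n + 1 : ℕ) : ℤ) - s = n - s + 1 by push_cast; ring]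
        push_cast at e1
        linear_combination gbinom (i : F) s * e1
      · rw [show ((n + 1 : ℕ) : ℤ) - (s + 1 : ℕ) = n - s by push_cast; ring]
        push_cast
        linear_combination -divPow (α.1 D.first) ((n : ℤ) - s) * e2
    rw [sum_congr rfl fun s _ => h2 s, sum_add_distrib]
    exact sum_weights_add n (fun s : ℕ => gbinom (i : F) s *
      divPow (α.1 D.first) ((n + 1 : ℕ) - s : ℤ)) fun s : ℕ => x α (Pi.single D.first (i - s))

/-- The value of the residue form on monomials. -/
theorem residForm_single [CharZero F] (h4 : D.ℓ'₄ = 1) (h3 : D.ℓ₃ = 1) (c : D.Γ → F) (α β : D.Γ)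
    (i j : ℤ) (a b : ℕ) :
    residForm c (m α (Pi.single D.first i) (Pi.single D.first a))
        (m β (Pi.single D.first j) (Pi.single D.first b)) =
      c (α + β) * ((-1) ^ a * (a.factorial : F) * (b.factorial : F) *
        ∑ s ∈ range (a + b + 2), gbinom (i : F) s * divPow (α.1 D.first) ((a : ℤ) + b + 1 - s) *
          divPow ((α + β).1 D.first) ((s : ℤ) - i - j - 1)) := by
  have hJ := single_first_mem_J h4 h3
  rw [m_single (hJ i), m_single (hJ j), residForm_mul c a b (x_mem_A₀ (hJ i) (evenSupp_first i) α)
    (x_mem_A₀ (hJ j) (evenSupp_first j) β), adj_d_pow_x h4 h3, smul_mul_assoc, map_smul, sum_mul,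
    map_sum, smul_eq_mul, ← mul_assoc, div_mul_cancel₀ _ (Nat.cast_ne_zero.2
      (Nat.factorial_ne_zero _)), mul_left_comm]
  congr 1
  rw [mul_sum]
  refine sum_congr rfl fun s _ => ?_
  rw [smul_mul_assoc, map_smul, x_mul_x (hJ _) (hJ _), (evenSupp_first _).pair_left, sgn_zero,
    one_smul, ← Pi.single_add, resid_x c (hJ _), Pi.single_eq_same, smul_eq_mul,
    show -(i - s + j) - 1 = (s : ℤ) - i - j - 1 by ring]
  push_cast
  ring

open Classical in
theorem isPhi_residForm [CharZero F] (h4 : D.ℓ'₄ = 1) (h3 : D.ℓ₃ = 1) (γ : D.Γ) :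
    D.IsPhi γ ((residForm fun α => if α = γ then 1 else 0).domRestrict₁₂ D.R₀ D.R₀) := by
  intro α β i j a b
  refine (residForm_single h4 h3 _ α β i j a b).trans ?_
  by_cases h : α + β = γ
  · rw [if_pos h, if_pos h, one_mul, h]
  · rw [if_neg h, if_neg h, zero_mul]

/-- The universal form whose coefficient at `γ` is `φ_γ ⊗ str`. -/
def residUniv : D.R →ₗ[F] D.R →ₗ[F] D.Γ →₀ F :=
  (Finsupp.linearCombination F fun a : D.Idx => Finsupp.linearCombination F fun b : D.Idx =>
    Finsupp.single (a.1 + b.1)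
      (tens (residForm fun _ => 1) (m a.1 a.2.1.1 a.2.2.1) (m b.1 b.2.1.1 b.2.2.1)) :
    D.W →ₗ[F] D.W →ₗ[F] D.Γ →₀ F)

/-- On two basis elements the form involves `c` only through `c (α + β)`. Hence it is linear in an
arbitrary `c : Γ → F`, and for given `u`, `v` only finitely many `γ` matter. -/
theorem tens_residForm [CharZero F] (h4 : D.ℓ'₄ = 1) (h3 : D.ℓ₃ = 1) (c : D.Γ → F) (u v : D.R) :
    tens (residForm c) u v = Finsupp.bilinearCombination F F c (residUniv u v) := by
  suffices H : tens (residForm c) =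
      residUniv.compr₂ (Finsupp.bilinearCombination F F c) by rw [H]; rfl
  refine R.ext_m fun α k hk μ hμ => R.ext_m fun β l hl ν hν => ?_
  have h1 : m α k μ = (Finsupp.single (α, ⟨k, hk⟩, ⟨μ, hμ⟩) 1 : D.W) := mon_of_mem hk hμ
  have h2 : m β l ν = (Finsupp.single (β, ⟨l, hl⟩, ⟨ν, hν⟩) 1 : D.W) := mon_of_mem hl hν
  have h3' : residUniv (m α k μ) (m β l ν) = Finsupp.single (α + β)
      (tens (residForm fun _ => 1) (m α k μ) (m β l ν)) := by
    conv_lhs => rw [h1, h2]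
    exact lc₂_single _ _ _
  rw [LinearMap.compr₂_apply, h3', Finsupp.bilinearCombination_apply,
    Finsupp.linearCombination_single, tens_m _ hk hl hμ hν, tens_m _ hk hl hμ hν,
    eq_single_first h4 (evenSupp_ev k), eq_single_first h4 (evenSupp_ev l),
    eq_single_first h4 (evenSupp_ev μ), eq_single_first h4 (evenSupp_ev ν),
    residForm_single h4 h3, residForm_single h4 h3, smul_eq_mul]
  ring

theorem mul_topn {i : ℤ} (hJ : Pi.single D.first i ∈ D.J) (α : D.Γ) :
    top α i = x α (Pi.single D.first i) * m 0 D.topz D.topn := by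
  have h := m_mul_m_odd hJ topz_mem_J (ν := D.topn) zero_mem_K (evenSupp_first i)
    (fun _ _ => rfl) (fun p hp => if_neg (not_le.2 hp)) α
  rw [zero_add] at h
  exact h.symm

theorem top_mem_R₁ : m 0 D.topz D.topn ∈ D.R₁ :=
  m_mem_R₁ (fun _ hp => if_neg (not_le.2 hp)) fun _ hp => if_neg (not_le.2 hp)

/-- The value of `φ ⊗ str` on an even monomial and a top monomial. -/
theorem tens_top (φ : D.R →ₗ[F] D.R →ₗ[F] F) {i : ℤ}
    (hJ : Pi.single D.first i ∈ D.J) (α : D.Γ) {f : D.R} (hf : f ∈ D.A₀) :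
    tens φ f (top α i) = φ f (x α (Pi.single D.first i)) := by
  have h1 : (1 : D.R) ∈ D.R₁ := m_mem_R₁ (fun _ _ => rfl) fun _ _ => rfl
  have h := tens_mul φ (A₀_le_R₀ hf) (A₀_le_R₀ (x_mem_A₀ hJ (evenSupp_first i) α)) h1 top_mem_R₁
  rwa [mul_one, one_mul, str_top, mul_one, ← mul_topn hJ] at h

theorem form_eq_zero_of_mem_B2 {ψ : D.W →ₗ[F] D.W →ₗ[F] F} (hψ : ψ ∈ D.B2) {u v : D.R}
    (h : D.br u v = 0) : D.form ψ u v = 0 := by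
  obtain ⟨f, rfl⟩ := hψ
  change f (D.br u v) = 0
  rw [h]
  exact map_zero f

theorem br_t_top (h4 : D.ℓ'₄ = 1) (h3 : D.ℓ₃ = 1) (γ : D.Γ) (i : ℤ) :
    D.br (t D.first) (top γ i) = 0 := by
  have hJ := single_first_mem_J h4 h3
  have he : t D.first ∈ D.R₀ := m_mem_R₀ 0 (evenSupp_first 1) fun _ _ => rfl
  rw [br_even (R₀_le_comp he), mul_topn (hJ i)]
  exact adj_eq_zero_iff.2 (((evenSupp_first 1).commute_x (hJ 1) (hJ i) 0 γ).mul_right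
    (commute_R₀_R₁ he top_mem_R₁))

/-- The derivative of `t_1` is `1`, so the value is the weighted residue of `x^{γ,-1}`. -/
theorem tens_residForm_top [CharZero F] (h4 : D.ℓ'₄ = 1) (h3 : D.ℓ₃ = 1) (c : D.Γ → F) (γ : D.Γ) :
    tens (residForm c) (t D.first) (top γ (-1)) = c γ := by
  have hJ := single_first_mem_J h4 h3
  have ht : t D.first ∈ D.A₀ := x_mem_A₀ (hJ 1) (evenSupp_first 1) 0
  have h := residForm_mul c 0 0 ht (x_mem_A₀ (hJ (-1)) (evenSupp_first (-1)) γ)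
  rw [pow_zero, mul_one, mul_one, zero_add, pow_one, t, adj_d_x (hJ 1) (evenSupp_first 1),
    Pi.single_eq_same, e, sub_self, x_zero, Int.cast_one, one_smul, zero_add] at h
  rw [tens_top _ (hJ (-1)) γ ht, t, e, h,
    show (0 : D.Γ).1 D.first = 0 from rfl, zero_smul, zero_add, one_mul, resid_x c (hJ (-1)),
    Pi.single_eq_same]
  simp [divPow_zero]

/-- The map `c ↦ ∑ c_γ φ_γ ⊗ str` into the cocycles. -/
def residCocycle [CharZero F] (h4 : D.ℓ'₄ = 1) (h3 : D.ℓ₃ = 1) : (D.Γ → F) →ₗ[F] D.C2 where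
  toFun c := ⟨tens (residForm c), residForm_mem_C2 h4 c⟩
  map_add' c c' := by
    suffices H : ∀ u v : D.R, tens (residForm (c + c')) u v =
        tens (residForm c) u v + tens (residForm c') u v from Subtype.ext (LinearMap.ext₂ H)
    intro u v
    rw [tens_residForm h4 h3, tens_residForm h4 h3, tens_residForm h4 h3, map_add,
      LinearMap.add_apply]
  map_smul' a c := by
    suffices H : ∀ u v : D.R, tens (residForm (a • c)) u v = a • tens (residForm c) u v from
      Subtype.ext (LinearMap.ext₂ H)
    intro u v
    rw [tens_residForm h4 h3, tens_residForm h4 h3, map_smul, LinearMap.smul_apply]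

theorem cls_eq_zero_iff (ψ : D.C2) : D.cls ψ = 0 ↔ ψ.1 ∈ D.B2 := by
  rw [cls, Submodule.mkQ_apply, Submodule.Quotient.mk_eq_zero]
  rfl

/-- The values on the commuting pairs `(t_1, top γ (-1))` recover `c`, which gives injectivity.
Conversely, subtracting from a cocycle the combination with the same values leaves one to which
`mem_B2_of_laurent` applies. -/
theorem residCocycle_bijective [CharZero F] (h4 : D.ℓ'₄ = 1) (h3 : D.ℓ₃ = 1) :
    Function.Bijective (D.cls ∘ₗ residCocycle h4 h3) := by
  refine ⟨(injective_iff_map_eq_zero _).2 fun c hc => funext fun γ => ?_, fun h => ?_⟩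
  · rw [← tens_residForm_top h4 h3 c γ]
    exact form_eq_zero_of_mem_B2 ((cls_eq_zero_iff _).1 hc) (br_t_top h4 h3 γ (-1))
  · obtain ⟨ψ, rfl⟩ := Submodule.mkQ_surjective _ h
    refine ⟨fun γ => D.form ψ.1 (t D.first) (top γ (-1)), ?_⟩
    rw [← sub_eq_zero]
    refine (map_sub D.cls _ _).symm.trans ((cls_eq_zero_iff _).2 ?_)
    refine mem_B2_of_laurent h4 h3 (Subtype.prop _) fun γ => ?_
    exact sub_eq_zero.2 (tens_residForm_top h4 h3 _ γ)

open Classical in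
theorem residCocycle_single [CharZero F] (h4 : D.ℓ'₄ = 1) (h3 : D.ℓ₃ = 1) (γ : D.Γ) (u v : D.W) :
    (residCocycle h4 h3 fun α => if α = γ then 1 else 0).1 u v = residUniv (D := D) u v γ := by
  refine (tens_residForm h4 h3 _ u v).trans ?_
  rw [Finsupp.bilinearCombination_apply, Finsupp.linearCombination_apply, Finsupp.sum]
  simpa using fun h : (residUniv (D := D) u v) γ = 0 => h.symm

/-- The cohomology for one even coordinate of Laurent type. -/
theorem h2_laurent [CharZero F] (h4 : D.ℓ'₄ = 1) (h3 : D.ℓ₃ = 1) {P : D.W₁ →ₗ[F] F}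
    (hP : D.IsSupertrace P) :
    ∃ φ : D.Γ → (D.W₀ →ₗ[F] D.W₀ →ₗ[F] F), (∀ γ, D.IsPhi γ (φ γ)) ∧
      ∃ Φ : D.Γ → D.C2, (∀ γ, D.IsTensor (Φ γ) (φ γ) P) ∧
        (∀ u v : D.W, {γ : D.Γ | (Φ γ).1 u v ≠ 0}.Finite) ∧
        ∃ e : (D.Γ → F) ≃ₗ[F] D.H2, ∀ c : D.Γ → F,
          ∃ Ψ : D.C2, (∀ u v : D.W, Ψ.1 u v = ∑ᶠ γ : D.Γ, c γ * (Φ γ).1 u v) ∧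
            e c = D.cls Ψ := by
  classical
  refine ⟨_, isPhi_residForm h4 h3, fun γ => residCocycle h4 h3 fun α => if α = γ then 1 else 0,
    fun γ => isTensor_tens _ hP, fun u v => ?_,
    LinearEquiv.ofBijective _ (residCocycle_bijective h4 h3), fun c => ⟨residCocycle h4 h3 c,
      fun u v => ?_, rfl⟩⟩
  · refine (residUniv (D := D) u v).support.finite_toSet.subset fun γ hγ => ?_
    have h : (residCocycle h4 h3 fun α => if α = γ then 1 else 0).1 u v ≠ 0 := hγ
    rw [residCocycle_single] at h
    exact Finsupp.mem_support_iff.2 h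
  · refine (tens_residForm h4 h3 c u v).trans ?_
    simp only [residCocycle_single]
    rw [finsum_eq_sum_of_support_subset (s := (residUniv (D := D) u v).support),
      Finsupp.bilinearCombination_apply, Finsupp.linearCombination_apply, Finsupp.sum]
    · exact sum_congr rfl fun γ _ => mul_comm _ _
    · exact fun γ hγ => Finsupp.mem_support_iff.2 fun h => hγ ((congrArg (c γ * ·) h).trans (mul_zero _))

end WeylData

end WeylSuper

end

/-! ### Indefinite summation, and cohomology for one exponential coordinate -/

noncomputable section

namespace WeylSuper

open Finset

section Summation

open Polynomial

variable {F : Type*} [Field F]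

/-- The forward difference `p(X + 1) - p(X)`. -/
def difference : F[X] →ₗ[F] F[X] := taylor 1 - LinearMap.id

variable [CharZero F]

/-- A periodic polynomial takes the same value at all natural numbers, which are infinitely many in
characteristic zero. -/
theorem eval_eq_of_periodic {p : F[X]} (h : taylor 1 p = p) (a : F) : p.eval a = p.eval 0 := by
  have h1 : ∀ n : ℕ, p.eval (n : F) = p.eval 0 := fun n => by
    induction n with
    | zero => simp
    | succ n ih => rw [Nat.cast_succ, ← taylor_eval, h, ih]
  have h2 : p = C (p.eval 0) := by
    refine eq_of_infinite_eval_eq _ _ (Set.Infinite.mono ?_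
      (Set.infinite_range_of_injective (Nat.cast_injective (R := F))))
    rintro _ ⟨n, rfl⟩
    simp [h1 n]
  rw [h2]
  simp

/-- The difference of `X^{n+1}` is `(n + 1) X^n` plus terms of lower degree, which lie in the range
by induction. -/
theorem difference_surjective : Function.Surjective (difference (F := F)) := by
  have h : ∀ n : ℕ, (X : F[X]) ^ n ∈ LinearMap.range (difference (F := F)) := by
    intro n
    induction n using Nat.strong_induction_on with
    | _ n ih =>
      have h1 : difference (X ^ (n + 1)) =
          ∑ k ∈ range n, ((n + 1).choose k : F) • (X : F[X]) ^ k + ((n : F) + 1) • X ^ n := by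
        rw [difference, LinearMap.sub_apply, taylor_X_pow, LinearMap.id_apply, C_1, add_pow, sum_range_succ,
          sum_range_succ]
        simp [smul_eq_C_mul, mul_comm]
      have h2 : (X : F[X]) ^ n = ((n : F) + 1)⁻¹ • (difference (X ^ (n + 1)) -
          ∑ k ∈ range n, ((n + 1).choose k : F) • (X : F[X]) ^ k) := by
        rw [h1, add_sub_cancel_left, smul_smul, inv_mul_cancel₀ (Nat.cast_add_one_ne_zero n),
          one_smul]
      rw [h2]
      exact Submodule.smul_mem _ _ (sub_mem ⟨_, rfl⟩ (sum_mem fun k hk =>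
        Submodule.smul_mem _ _ (ih k (mem_range.1 hk))))
  intro p
  rw [← LinearMap.mem_range, as_sum_range_C_mul_X_pow p]
  refine sum_mem fun k _ => ?_
  rw [← smul_eq_C_mul]
  exact Submodule.smul_mem _ _ (h k)

/-- The indefinite sum `∑_{0 ≤ k < a} q(k)`, extended polynomially to `a ∈ F`. -/
def indefSum (a : F) : F[X] →ₗ[F] F :=
  (leval a - leval 0) ∘ₗ (LinearMap.exists_rightInverse_of_surjective _
    (LinearMap.range_eq_top.2 (difference_surjective (F := F)))).choose

/-- Two antidifferences differ by a periodic polynomial, hence by a constant, so the choice made in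
`indefSum` is immaterial. -/
theorem indefSum_eq {p q : F[X]} (h : taylor 1 p = p + q) (a : F) :
    indefSum a q = p.eval a - p.eval 0 := by
  set S := (LinearMap.exists_rightInverse_of_surjective _
    (LinearMap.range_eq_top.2 (difference_surjective (F := F)))).choose with hS
  have h1 : taylor 1 (S q) - S q = q := LinearMap.congr_fun
    (LinearMap.exists_rightInverse_of_surjective _
      (LinearMap.range_eq_top.2 (difference_surjective (F := F)))).choose_spec q
  have h2 := eval_eq_of_periodic (p := S q - p) (by
    rw [map_sub, h, ← sub_eq_zero]
    linear_combination h1) a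
  rw [eval_sub, eval_sub] at h2
  change (S q).eval a - (S q).eval 0 = _
  linear_combination h2

theorem exists_antidifference (q : F[X]) : ∃ p : F[X], taylor 1 p = p + q := by
  obtain ⟨p, hp⟩ := difference_surjective q
  exact ⟨p, by rw [← hp]; simp [difference]⟩

theorem indefSum_zero (q : F[X]) : indefSum 0 q = 0 := by
  obtain ⟨p, hp⟩ := exists_antidifference q
  rw [indefSum_eq hp, sub_self]

theorem indefSum_one (a : F) : indefSum a 1 = a := by
  rw [indefSum_eq (p := X) (by rw [taylor_X, C_1])]
  simp

/-- The summation range `0 ≤ k < a + b` is cut at `a`, and the second piece is shifted to start at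
`0`. -/
theorem indefSum_add (a b : F) (q : F[X]) :
    indefSum (a + b) q = indefSum a q + indefSum b (taylor a q) := by
  obtain ⟨p, hp⟩ := exists_antidifference q
  rw [indefSum_eq hp, indefSum_eq hp, indefSum_eq (p := taylor a p) (by
    rw [taylor_taylor, add_comm, ← taylor_taylor, hp, map_add]), taylor_eval, taylor_eval, zero_add,
    add_comm b]
  ring

theorem indefSum_neg (a : F) (q : F[X]) : indefSum (-a) (taylor a q) = -indefSum a q := by
  have h := indefSum_add a (-a) q
  rw [add_neg_cancel, indefSum_zero] at h
  linear_combination -h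

theorem gbinom_add_one (a : F) (n : ℕ) : gbinom (a + 1) (n + 1) = gbinom a (n + 1) + gbinom a n := by
  have h1 : ((n : F) + 1) * gbinom (a + 1) (n + 1) = (a + 1) * gbinom a n := by
    rw [gbinom, gbinom, prod_range_succ', Nat.factorial_succ]
    have e1 : (n : F) + 1 ≠ 0 := Nat.cast_add_one_ne_zero n
    have e2 : (n.factorial : F) ≠ 0 := Nat.cast_ne_zero.2 n.factorial_ne_zero
    push_cast
    rw [prod_congr rfl fun (i : ℕ) _ => show a + 1 - ((i : F) + 1) = a - i by ring]
    field_simp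
    ring
  have h2 := gbinom_succ a n
  refine mul_left_cancel₀ (Nat.cast_add_one_ne_zero (R := F) n) ?_
  linear_combination h1 - h2

/-- The difference of `[X]_{n+1}` is `(n + 1) [X]_n`. -/
theorem indefSum_descPochhammer (a : F) (n : ℕ) :
    indefSum a (descPochhammer F n) = n.factorial * gbinom a (n + 1) := by
  have e1 : (n : F) + 1 ≠ 0 := Nat.cast_add_one_ne_zero n
  have e2 : (n.factorial : F) ≠ 0 := Nat.cast_ne_zero.2 n.factorial_ne_zero
  have h : taylor 1 (descPochhammer F (n + 1)) =
      descPochhammer F (n + 1) + ((n : F) + 1) • descPochhammer F n := by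
    rw [descPochhammer_succ_left, taylor_mul, taylor_X]
    have h1 : taylor 1 ((descPochhammer F n).comp (X - 1)) = descPochhammer F n := by
      rw [taylor_apply, comp_assoc]
      simp
    rw [h1, ← descPochhammer_succ_left, descPochhammer_succ_right, smul_eq_C_mul]
    simp only [C_add, C_1, map_natCast]
    ring
  have h2 := indefSum_eq h a
  rw [map_smul, smul_eq_mul, descPochhammer_ne_zero_eval_zero F n.succ_ne_zero,
    descPochhammer_eval_eq_prod_range, sub_zero] at h2
  rw [gbinom, Nat.factorial_succ]
  push_cast
  field_simp
  linear_combination h2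

/-- Writing `X - a - i = (X - j) + (j - a - i)` trades a factor of the first falling factorial for
one of the second. The two results combine by `gbinom_add_one` and `gbinom_succ`. -/
theorem indefSum_taylor_mul (a : F) (i j : ℕ) :
    indefSum a (taylor (-a) (descPochhammer F i) * descPochhammer F j) =
      (-1) ^ i * i.factorial * j.factorial * gbinom (a + i) (i + j + 1) := by
  induction i generalizing j with
  | zero =>
    rw [descPochhammer_zero, taylor_one, C_1, one_mul, indefSum_descPochhammer]
    simp
  | succ i ih =>
    have h : taylor (-a) (descPochhammer F (i + 1)) * descPochhammer F j =
        taylor (-a) (descPochhammer F i) * descPochhammer F (j + 1) +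
          ((j : F) - a - i) • (taylor (-a) (descPochhammer F i) * descPochhammer F j) := by
      rw [descPochhammer_succ_right F i, descPochhammer_succ_right F j, taylor_mul, smul_eq_C_mul]
      simp only [map_sub, taylor_X, C_neg, map_natCast]
      have : taylor (-a) (i : F[X]) = i := by
        rw [← C_eq_natCast, taylor_C]
      rw [this]
      ring
    have e1 := gbinom_add_one (a + i) (i + j + 1)
    have e2 := gbinom_succ (a + i) (i + j + 1)
    rw [h, map_add, map_smul, ih, ih, smul_eq_mul, Nat.factorial_succ, Nat.factorial_succ,
      show i + (j + 1) + 1 = i + j + 1 + 1 by ring, show i + 1 + j + 1 = i + j + 1 + 1 by ring]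
    push_cast at e2 ⊢
    rw [← add_assoc a, e1, pow_succ]
    linear_combination ((-1) ^ i * (i.factorial : F) * j.factorial) * e2

end Summation

namespace WeylData

open Polynomial

variable {F : Type*} [Field F] {D : WeylData F}

/-! ### One even coordinate of exponential type -/

theorem eq_zero_of_evenSupp (h4 : D.ℓ'₄ = 1) (h44 : D.ℓ₄ = 1) {k : Fin D.ℓ → ℤ} (hk : k ∈ D.J)
    (h : EvenSupp k) : k = 0 := by
  have h0 : D.first.val = 0 := rfl
  have h1 : k D.first = 0 := by
    refine (hk D.first).2.1 ?_ first_lt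
    rw [h0]
    simp only [ℓ'₃, ℓ'₄] at h4 ⊢
    omega
  rw [eq_single_first h4 h, h1, Pi.single_zero]

theorem A₀_le_exp (h4 : D.ℓ'₄ = 1) (h44 : D.ℓ₄ = 1) {N : Submodule F D.R}
    (h : ∀ α, x α 0 ∈ N) : D.A₀ ≤ N :=
  A₀_le fun α k hk hke => by
    rw [eq_zero_of_evenSupp h4 h44 hk hke]
    exact h α

theorem R₀_le_exp (h4 : D.ℓ'₄ = 1) (h44 : D.ℓ₄ = 1) {N : Submodule F D.R}
    (h : ∀ α (n : ℕ), x α 0 * D.d D.first ^ n ∈ N) : D.R₀ ≤ N :=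
  R₀_le fun α k hk μ _ hke hμe => by
    rw [eq_single_first h4 hμe, m_single hk, eq_zero_of_evenSupp h4 h44 hk hke]
    exact h α _

theorem neg_first {α β : D.Γ} (h : α + β = 0) : β.1 D.first = -α.1 D.first := by
  rw [eq_neg_of_add_eq_zero_right h]
  rfl

/-- Since `∂_1 x^α = x^α (∂_1 + α_1)`, moving `x^α` to the left translates polynomials in `∂_1`. -/
theorem pow_d_mul_x (α : D.Γ) (n : ℕ) : D.d D.first ^ n * x α 0 =
    x α 0 * aeval (D.d D.first) (taylor (α.1 D.first) (X ^ n)) := by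
  have h : SemiconjBy (x α 0) (aeval (D.d D.first) (X + C (α.1 D.first))) (D.d D.first) := by
    rw [SemiconjBy, d_mul_x_zero, map_add, aeval_X, aeval_C, mul_add, ← Algebra.commutes,
      ← Algebra.smul_def]
  rw [taylor_X_pow, map_pow]
  exact (h.pow_right n).eq.symm

theorem fallMon_eq (α : D.Γ) (n : ℕ) :
    ((D.fallMon α n : D.W) : D.R) = x α 0 * aeval (D.d D.first) (descPochhammer F n) := by
  rw [aeval_eq_sum_range, fallMon, Polynomial.sum_over_range _ (by simp), mul_sum]
  refine (map_sum (Submodule.subtype D.R₀) _ _).trans (sum_congr rfl fun i _ => ?_)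
  rw [mul_smul_comm, ← m_single zero_mem_J]
  change (descPochhammer F n).coeff i • m α (Pi.single D.first 0) (Pi.single D.first i) = _
  rw [Pi.single_zero]

theorem br_x_top (β γ : D.Γ) : D.br (x β 0) (top γ 0) = 0 := by
  have h0 : (Pi.single D.first 0 : Fin D.ℓ → ℤ) ∈ D.J := by
    rw [Pi.single_zero]
    exact zero_mem_J
  have he : x β 0 ∈ D.R₀ := A₀_le_R₀ (x_mem_A₀ zero_mem_J evenSupp_zero β)
  rw [br_even (R₀_le_comp he), mul_topn h0]
  exact adj_eq_zero_iff.2 ((evenSupp_zero.commute_x zero_mem_J h0 β γ).mul_right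
    (commute_R₀_R₁ he top_mem_R₁))

section CharZero

variable [CharZero F]

open Classical in
/-- The form `(x^α p(∂), x^β q(∂)) ↦ δ_{α+β,0} ∑_{0 ≤ k < α} p(k - α) q(k)`. -/
def expForm : D.R →ₗ[F] D.R →ₗ[F] F :=
  (Finsupp.linearCombination F fun a : D.Idx => Finsupp.linearCombination F fun b : D.Idx =>
    if a.1 + b.1 = 0 then indefSum (a.1.1 D.first)
      (taylor (-a.1.1 D.first) (X ^ a.2.2.1 D.first) * X ^ b.2.2.1 D.first) else 0 :
    D.W →ₗ[F] D.W →ₗ[F] F)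

open Classical in
theorem expForm_pow (α β : D.Γ) (i j : ℕ) :
    expForm (x α 0 * D.d D.first ^ i) (x β 0 * D.d D.first ^ j) =
      if α + β = 0 then indefSum (α.1 D.first)
        (taylor (-α.1 D.first) (X ^ i) * X ^ j) else 0 := by
  have h : ∀ (α : D.Γ) (n : ℕ), x α 0 * D.d D.first ^ n = (Finsupp.single
      (α, ⟨0, zero_mem_J⟩, ⟨Pi.single D.first n, single_first_mem_K n⟩) 1 : D.W) := fun α n => by
    rw [← m_single zero_mem_J]
    exact mon_of_mem _ _
  rw [h, h]
  refine (lc₂_single _ _ _).trans ?_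
  simp only [Pi.single_eq_same]

open Classical in
theorem expForm_aeval (α β : D.Γ) (p q : F[X]) :
    expForm (x α 0 * aeval (D.d D.first) p) (x β 0 * aeval (D.d D.first) q) =
      if α + β = 0 then indefSum (α.1 D.first) (taylor (-α.1 D.first) p * q) else 0 := by
  induction p using Polynomial.induction_on' with
  | add p p' h h' =>
    rw [map_add, mul_add, map_add, LinearMap.add_apply, h, h', map_add, add_mul, map_add]
    split_ifs <;> simp
  | monomial i c =>
    induction q using Polynomial.induction_on' with
    | add q q' h h' =>
      rw [map_add, mul_add, map_add, h, h', mul_add, map_add]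
      split_ifs <;> simp
    | monomial j c' =>
      rw [← C_mul_X_pow_eq_monomial, ← C_mul_X_pow_eq_monomial, ← smul_eq_C_mul, ← smul_eq_C_mul,
        map_smul, map_smul, map_pow, map_pow, aeval_X, mul_smul_comm, mul_smul_comm, map_smul,
        map_smul, LinearMap.smul_apply, expForm_pow, map_smul, smul_mul_assoc, mul_smul_comm,
        map_smul, map_smul, smul_comm c c']
      split_ifs <;> simp

/-- Shifting the summation variable by `α_1` moves the translation from one polynomial to the other
and reverses the range, which changes the sign. -/
theorem expForm_skew (h4 : D.ℓ'₄ = 1) (h44 : D.ℓ₄ = 1) :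
    ∀ a ∈ D.R₀, ∀ b ∈ D.R₀, expForm a b = -expForm b a := by
  intro a ha b hb
  have h : D.R₀ ≤ LinearMap.ker (expForm a + expForm.flip a) := by
    refine R₀_le_exp h4 h44 fun β j => ?_
    have h' : D.R₀ ≤ LinearMap.ker (expForm.flip (x β 0 * D.d D.first ^ j) +
        expForm (x β 0 * D.d D.first ^ j)) := by
      refine R₀_le_exp h4 h44 fun α i => ?_
      change expForm (x α 0 * D.d D.first ^ i) (x β 0 * D.d D.first ^ j) +
        expForm (x β 0 * D.d D.first ^ j) (x α 0 * D.d D.first ^ i) = 0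
      rw [expForm_pow, expForm_pow, add_comm β]
      split_ifs with hαβ
      · have h1 := indefSum_neg (α.1 D.first) (taylor (-α.1 D.first) (X ^ i) * X ^ j)
        rw [taylor_mul, taylor_taylor, add_neg_cancel, taylor_zero] at h1
        rw [neg_first hαβ, neg_neg, mul_comm (taylor _ _) (X ^ i), h1, add_neg_cancel]
      · rw [add_zero]
    exact h' ha
  exact eq_neg_of_add_eq_zero_left (h hb)

/-- `∂_1` has exponent `α = 0`, so the summation range is empty. -/
theorem expForm_d_left (h4 : D.ℓ'₄ = 1) (h44 : D.ℓ₄ = 1) {v : D.R} (hv : v ∈ D.R₀) :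
    expForm (D.d D.first) v = 0 := by
  have h : D.R₀ ≤ LinearMap.ker (expForm (D.d D.first)) := by
    refine R₀_le_exp h4 h44 fun β j => ?_
    have h1 := expForm_pow (0 : D.Γ) β 1 j
    rw [x_zero, one_mul, pow_one, show (0 : D.Γ).1 D.first = 0 from rfl, indefSum_zero,
      ite_self] at h1
    exact h1
  exact h hv

theorem expForm_d_mul (h4 : D.ℓ'₄ = 1) (h44 : D.ℓ₄ = 1) : ∀ b ∈ D.R₀, ∀ v ∈ D.R₀,
    expForm (D.d D.first * b) v =
      expForm (D.d D.first) (b * v) + expForm b (v * D.d D.first) := by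
  intro b hb v hv
  rw [expForm_d_left h4 h44 (mul_mem_R₀ b hb v hv), zero_add]
  have h : D.R₀ ≤ LinearMap.ker (expForm.flip v ∘ₗ LinearMap.mulLeft F (D.d D.first) -
      expForm.flip (v * D.d D.first)) := by
    refine R₀_le_exp h4 h44 fun α i => ?_
    have h' : D.R₀ ≤ LinearMap.ker (expForm (D.d D.first * (x α 0 * D.d D.first ^ i)) -
        expForm (x α 0 * D.d D.first ^ i) ∘ₗ LinearMap.mulRight F (D.d D.first)) := by
      refine R₀_le_exp h4 h44 fun β j => ?_
      change expForm (D.d D.first * (x α 0 * D.d D.first ^ i)) (x β 0 * D.d D.first ^ j) -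
        expForm (x α 0 * D.d D.first ^ i) (x β 0 * D.d D.first ^ j * D.d D.first) = 0
      have h1 : D.d D.first * (x α 0 * D.d D.first ^ i) =
          x α 0 * D.d D.first ^ (i + 1) + α.1 D.first • (x α 0 * D.d D.first ^ i) := by
        rw [← mul_assoc, d_mul_x_zero, add_mul, mul_assoc, ← pow_succ', smul_mul_assoc]
      rw [h1, mul_assoc (x β 0), ← pow_succ, map_add, map_smul, LinearMap.add_apply,
        LinearMap.smul_apply, expForm_pow, expForm_pow, expForm_pow]
      split_ifs
      -- The translation by `-α_1` takes `X + α_1` to `X`, so `∂_1` on the left of the first entry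
      -- amounts to `∂_1` on the right of the second.
      · rw [← map_smul, ← map_add, ← map_sub, pow_succ (X : F[X]) i, taylor_mul, taylor_X,
          smul_eq_C_mul, pow_succ, C_neg]
        convert map_zero (indefSum (α.1 D.first)) using 2
        ring
      · simp
    exact h' hv
  exact sub_eq_zero.1 (h hb)

/-- Moving `x^α` past `∂_1^n` translates by `α_1`, so the identity is the additivity `indefSum_add`
of the summation range. -/
theorem expForm_A₀ (h4 : D.ℓ'₄ = 1) (h44 : D.ℓ₄ = 1) : ∀ f ∈ D.A₀, ∀ g ∈ D.A₀, ∀ v ∈ D.R₀,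
    expForm (f * g) v = expForm f (g * v) + expForm g (v * f) := by
  intro f hf g hg v hv
  have h1 : ∀ (α β γ : D.Γ) (n : ℕ), expForm (x α 0 * x β 0) (x γ 0 * D.d D.first ^ n) -
      expForm (x α 0) (x β 0 * (x γ 0 * D.d D.first ^ n)) -
      expForm (x β 0) (x γ 0 * D.d D.first ^ n * x α 0) = 0 := by
    intro α β γ n
    have hx : ∀ α β : D.Γ, x α 0 * x β 0 = x (α + β) 0 := fun α β => by
      rw [x_mul_x zero_mem_J zero_mem_J, pair_zero_left, sgn_zero, one_smul, add_zero]
    have h0 : ∀ (α β : D.Γ) (q : F[X]), α + β = 0 →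
        expForm (x α 0) (x β 0 * aeval (D.d D.first) q) = indefSum (α.1 D.first) q := by
      intro α β q h
      have := expForm_aeval α β 1 q
      rwa [map_one, mul_one, taylor_one, C_1, one_mul, if_pos h] at this
    have h0' : ∀ (α β : D.Γ) (q : F[X]), α + β ≠ 0 →
        expForm (x α 0) (x β 0 * aeval (D.d D.first) q) = 0 := by
      intro α β q h
      have := expForm_aeval α β 1 q
      rwa [map_one, mul_one, if_neg h] at this
    have hX : D.d D.first ^ n = aeval (D.d D.first) ((X : F[X]) ^ n) := by rw [map_pow, aeval_X]
    rw [mul_assoc (x γ 0), pow_d_mul_x, hX, ← mul_assoc, ← mul_assoc, hx, hx, hx]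
    by_cases h : α + β + γ = 0
    · rw [h0 _ _ _ h, h0 _ _ _ (by rw [← h]; abel), h0 _ _ _ (by rw [← h]; abel)]
      have := indefSum_add (α.1 D.first) (β.1 D.first) (X ^ n)
      change indefSum (α.1 D.first + β.1 D.first) _ - _ - _ = _
      rw [this]
      ring
    · rw [h0' _ _ _ h, h0' _ _ _ (by rwa [← add_assoc]), h0' _ _ _ (by
        rwa [add_comm γ, ← add_assoc, add_comm β]), sub_zero, sub_zero]
  have h2 : D.R₀ ≤ LinearMap.ker (expForm (f * g) - expForm f ∘ₗ LinearMap.mulLeft F g -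
      expForm g ∘ₗ LinearMap.mulRight F f) := by
    refine R₀_le_exp h4 h44 fun γ n => ?_
    set v := x γ 0 * D.d D.first ^ n with hv
    have h3 : D.A₀ ≤ LinearMap.ker (expForm.flip v ∘ₗ LinearMap.mulRight F g -
        expForm.flip (g * v) - expForm g ∘ₗ LinearMap.mulLeft F v) := by
      refine A₀_le_exp h4 h44 fun α => ?_
      have h5 : D.A₀ ≤ LinearMap.ker (expForm.flip v ∘ₗ LinearMap.mulLeft F (x α 0) -
          expForm (x α 0) ∘ₗ LinearMap.mulRight F v - expForm.flip (v * x α 0)) :=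
        A₀_le_exp h4 h44 fun β => h1 α β γ n
      exact h5 hg
    exact h3 hf
  have h3 := h2 hv
  change expForm (f * g) v - expForm f (g * v) - expForm g (v * f) = 0 at h3
  linear_combination h3

variable (D) in
/-- The cocycle `φ₀ ⊗ str`. -/
def expCocycle (h4 : D.ℓ'₄ = 1) (h44 : D.ℓ₄ = 1) : D.C2 :=
  ⟨tens expForm, tens_mem_C2_of_generators h4 (expForm_skew h4 h44) (expForm_d_mul h4 h44)
    (expForm_A₀ h4 h44)⟩

theorem isPhiZero_expForm : D.IsPhiZero (expForm.domRestrict₁₂ D.R₀ D.R₀) := by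
  intro α β i j
  change expForm ((D.fallMon α i : D.W) : D.R) ((D.fallMon β j : D.W) : D.R) = _
  rw [fallMon_eq, fallMon_eq, expForm_aeval, indefSum_taylor_mul]

/-- With both polynomials equal to `1` the sum counts its terms. -/
theorem expCocycle_top (h4 : D.ℓ'₄ = 1) (h44 : D.ℓ₄ = 1) (β : D.Γ) :
    D.form (expCocycle D h4 h44).1 (x β 0) (top (-β) 0) = β.1 D.first := by
  have h0 : (Pi.single D.first 0 : Fin D.ℓ → ℤ) ∈ D.J := by
    rw [Pi.single_zero]
    exact zero_mem_J
  refine (tens_top expForm h0 (-β) (x_mem_A₀ zero_mem_J evenSupp_zero β)).trans ?_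
  have h := expForm_pow β (-β) 0 0
  rw [pow_zero, pow_zero, mul_one, mul_one, mul_one, taylor_one, C_1, if_pos (add_neg_cancel β),
    indefSum_one] at h
  rw [Pi.single_zero, h]

/-- The cohomology for one even coordinate of exponential type. -/
theorem h2_exp (h4 : D.ℓ'₄ = 1) (h44 : D.ℓ₄ = 1) {P : D.W₁ →ₗ[F] F} (hP : D.IsSupertrace P) :
    ∃ φ₀ : D.W₀ →ₗ[F] D.W₀ →ₗ[F] F, D.IsPhiZero φ₀ ∧
      ∃ Φ₀ : D.C2, D.IsTensor Φ₀ φ₀ P ∧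
        D.cls Φ₀ ≠ 0 ∧ ∀ h : D.H2, ∃ c : F, h = c • D.cls Φ₀ := by
  obtain ⟨β, hβ⟩ := exists_gamma (D := D) (q := D.first) (by
    simp only [ℓ'₄] at h4
    omega) first_lt (LinearMap.proj D.first) (by simp)
  change β.1 D.first ≠ 0 at hβ
  refine ⟨_, isPhiZero_expForm, expCocycle D h4 h44, isTensor_tens _ hP, fun h => hβ ?_,
    fun h => ?_⟩
  · rw [← expCocycle_top h4 h44]
    exact form_eq_zero_of_mem_B2 ((cls_eq_zero_iff _).1 h) (br_x_top β _)
  · obtain ⟨ψ, rfl⟩ := Submodule.mkQ_surjective _ h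
    -- `expCocycle` takes the nonzero value `β_1` on this pair, so subtracting this multiple makes
    -- `mem_B2_of_exp` applicable.
    refine ⟨D.form ψ.1 (x β 0) (top (-β) 0) / β.1 D.first, ?_⟩
    rw [← sub_eq_zero, ← map_smul]
    refine (map_sub D.cls _ _).symm.trans ((cls_eq_zero_iff _).2 ?_)
    refine mem_B2_of_exp h4 hβ h44 (Subtype.prop _) ?_
    change D.form ψ.1 (x β 0) (top (-β) 0) - D.form ψ.1 (x β 0) (top (-β) 0) / β.1 D.first *
      D.form (expCocycle D h4 h44).1 (x β 0) (top (-β) 0) = 0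
    rw [expCocycle_top, div_mul_cancel₀ _ hβ, sub_self]

end CharZero

end WeylData

end WeylSuper

end

theorem theorem3p5 {F : Type*} [Field F] [CharZero F] (D : WeylSuper.WeylData F) :
    (∃! P : D.W₁ →ₗ[F] F, D.IsSupertrace P) ∧
    ∀ P : D.W₁ →ₗ[F] F, D.IsSupertrace P →
      (D.ℓ'₄ = 1 → D.ℓ₄ = 1 →
        ∃ φ₀ : D.W₀ →ₗ[F] D.W₀ →ₗ[F] F, D.IsPhiZero φ₀ ∧
          ∃ Φ₀ : D.C2, D.IsTensor Φ₀ φ₀ P ∧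
            D.cls Φ₀ ≠ 0 ∧ ∀ h : D.H2, ∃ c : F, h = c • D.cls Φ₀) ∧
      (D.ℓ'₄ = 1 → D.ℓ₃ = 1 →
        ∃ φ : D.Γ → (D.W₀ →ₗ[F] D.W₀ →ₗ[F] F), (∀ γ, D.IsPhi γ (φ γ)) ∧
          ∃ Φ : D.Γ → D.C2, (∀ γ, D.IsTensor (Φ γ) (φ γ) P) ∧
            (∀ u v : D.W, {γ : D.Γ | (Φ γ).1 u v ≠ 0}.Finite) ∧
            ∃ e : (D.Γ → F) ≃ₗ[F] D.H2, ∀ c : D.Γ → F,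
              ∃ Ψ : D.C2, (∀ u v : D.W, Ψ.1 u v = ∑ᶠ γ : D.Γ, c γ * (Φ γ).1 u v) ∧
                e c = D.cls Ψ) ∧
      ((1 ≤ D.ℓ'₂ ∨ 2 ≤ D.ℓ'₄) → Subsingleton D.H2) := by
  refine ⟨⟨D.strW, WeylSuper.WeylData.isSupertrace_strW, fun P hP => hP.eq_strW⟩,
    fun P hP => ⟨fun h4 h44 => ?_, fun h4 h3 => WeylSuper.WeylData.h2_laurent h4 h3 hP,
      fun h => ⟨fun a b => ?_⟩⟩⟩
  · exact WeylSuper.WeylData.h2_exp h4 h44 hP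
  · have key : ∀ a : D.H2, a = 0 := fun a => by
      obtain ⟨ψ, rfl⟩ := Submodule.mkQ_surjective _ a
      exact (WeylSuper.WeylData.cls_eq_zero_iff ψ).2 (h.elim
        (fun h => WeylSuper.WeylData.mem_B2_of_poly h ψ.2)
        fun h => WeylSuper.WeylData.mem_B2_of_two_le h ψ.2)
    rw [key a, key b]
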